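/- **Theorem 4.1.** Let $X$ be a complex Banach space and let $A$ be the infinitesimal generator of a $C_0$-semigroup $T=(T(t))_{t\ge 0}$ of bounded operators on $X$. Let $\mathcal F=\mathcal F(\mathbb R,X)$ be a homogeneous function space, that is, a Banach space of (classes modulo a.e. equality of) strongly measurable functions $\mathbb R\to X$ such that: (1) $\mathcal F$ is continuously embedded into the Stepanov space $\mathcal S^1$ with norm $\sup_{t}\int_0^1\|x(s+t)\|\,ds$; (2) for all $t\in\mathbb R$ and $x\in\mathcal F$ the translate $x(t+\cdot)$ belongs to $\mathcal F$ and has the same norm as $x$; (3) for $C\in B(X)$ and $x\in\mathcal F$ we have $C\circ x\in\mathcal F$ and $\|C\circ x\|\le\|C\|\|x\|$; (4) for $x\in\mathcal F$ and every $K:\mathbb R\to B(X)$ such that $s\mapsto K(s)v$ is strongly measurable for each $v\in X$ and $\|K(\cdot)\|$ has an a.e. majorant in $L^1(\mathbb R)$, the convolution $(K*x)(t)=\int_{\mathbb R}K(s)x(t-s)\,ds$ belongs to $\mathcal F$ and $\|K*x\|\le\|K\|_1\|x\|$, where $\|K\|_1$ is the infimum of the $L^1$-norms of the majorants; (5) if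 $x\in\mathcal F$ and $f*x=0$ for all $f\in L^1(\mathbb R)$, then $x=0$. For $a\in\mathbb R$ let $\phi_a\in L^1(\mathbb R)$ be the function with $\int_{\mathbb R}\phi_a(t)e^{-it\lambda}\,dt=\max(1-|\lambda-a|,0)$, $\lambda\in\mathbb R$. Let $$\mathcal F_{as}=\Big\{x\in\mathcal F:\ \|x\|_{\widetilde{as}}=\int_{\mathbb R}\|\phi_a*x\|_{\mathcal F}\,da<\infty\Big\},\qquad \|x\|_{as}=5\sum_{n\in\mathbb Z}\|\phi_n*x\|_{\mathcal F}.$$ Let $\mathscr L=-d/dt+A$ be the operator in $\mathcal F_{as}$ defined as follows: $x\in D(\mathscr L)$ and $\mathscr Lx=y$ if $x,y\in\mathcal F_{as}$ and (a representative of) $x$ satisfies $$x(t)=T(t-s)x(s)-\int_s^tT(t-\tau)y(\tau)\,d\tau\qquad\text{for all } s\le t \text{ in }\mathbb R .$$ Assume that $\sigma(A)\cap i\mathbb R=\emptyset$ and $M=\sup_{\lambda\in i\mathbb R}\|R(\lambda,A)\|<\infty$, where $R(\lambda,A)=(A-\lambda I)^{-1}$. Then $\mathscr L$ is a well-defined operator,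 it is injective with range $\mathcal F_{as}$, its inverse $\mathscr L^{-1}$ is a linear operator on $\mathcal F_{as}$, and, both with respect to the norm $\|\cdot\|_{as}$ (which is finite on $\mathcal F_{as}$) and with respect to the norm $\|\cdot\|_{\widetilde{as}}$, it is bounded with $$\|\mathscr L^{-1}\|\le\frac{18}{\pi}\,M\,(4+4M+2M^2)^{1/2}.$$ -/

import Mathlib

open MeasureTheory Filter Topology
open scoped ENNReal NNReal

noncomputable section

namespace AbstractParabolic

/-! ### `C₀`-semigroups, generators, resolvents -/

section Semigroup

variable {X : Type*} [NormedAddCommGroup X] [NormedSpace ℂ X]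

/-- A `C₀`-semigroup of bounded operators on `X`. -/
structure C0Semigroup (X : Type*) [NormedAddCommGroup X] [NormedSpace ℂ X] where
  toFun : ℝ≥0 → X →L[ℂ] X
  map_zero : toFun 0 = ContinuousLinearMap.id ℂ X
  map_add : ∀ s t, toFun (s + t) = (toFun s).comp (toFun t)
  continuous_orbit : ∀ x, Continuous fun t => toFun t x

/-- `y` is the right derivative at `0` of the orbit `t ↦ T t x`. -/
def HasOrbitDeriv (T : C0Semigroup X) (x y : X) : Prop :=
  Tendsto (fun h : ℝ => (h : ℂ)⁻¹ • (T.toFun h.toNNReal x - x)) (𝓝[>] 0) (𝓝 y)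

theorem HasOrbitDeriv.add {T : C0Semigroup X} {x x' y y' : X} (h : HasOrbitDeriv T x y)
    (h' : HasOrbitDeriv T x' y') : HasOrbitDeriv T (x + x') (y + y') := by
  refine (Tendsto.add h h').congr fun r => ?_
  rw [← smul_add, _root_.map_add]
  congr 1
  abel

theorem HasOrbitDeriv.smul {T : C0Semigroup X} {x y : X} (c : ℂ) (h : HasOrbitDeriv T x y) :
    HasOrbitDeriv T (c • x) (c • y) := by
  refine (Tendsto.const_smul h c).congr fun r => ?_
  rw [smul_comm, smul_sub, map_smul]

/-- The infinitesimal generator of a `C₀`-semigroup, as an unbounded operator. -/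
def C0Semigroup.generator (T : C0Semigroup X) : X →ₗ.[ℂ] X where
  domain :=
    { carrier := {x | ∃ y, HasOrbitDeriv T x y}
      add_mem' := fun ⟨_, h⟩ ⟨_, h'⟩ => ⟨_, h.add h'⟩
      zero_mem' := ⟨0, by simp [HasOrbitDeriv]⟩
      smul_mem' := fun c _ ⟨_, h⟩ => ⟨_, h.smul c⟩ }
  toFun :=
    { toFun := fun x => Classical.choose x.2
      map_add' := fun x x' => tendsto_nhds_unique (Classical.choose_spec (x + x').2)
        (HasOrbitDeriv.add (Classical.choose_spec x.2) (Classical.choose_spec x'.2))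
      map_smul' := fun c x => tendsto_nhds_unique (Classical.choose_spec (c • x).2)
        (HasOrbitDeriv.smul c (Classical.choose_spec x.2)) }

/-- `R` is a bounded two-sided inverse of `A - z : D(A) → X`. -/
def IsResolventAt (A : X →ₗ.[ℂ] X) (z : ℂ) (R : X →L[ℂ] X) : Prop :=
  (∀ x, ∃ h : R x ∈ A.domain, A ⟨R x, h⟩ - z • R x = x) ∧
    ∀ x : A.domain, R (A x - z • (x : X)) = x

/-- The resolvent set of an unbounded operator. -/
def resolventSet (A : X →ₗ.[ℂ] X) : Set ℂ := {z | ∃ R, IsResolventAt A z R}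

/-- The spectrum of an unbounded operator. -/
def unboundedSpectrum (A : X →ₗ.[ℂ] X) : Set ℂ := (resolventSet A)ᶜ

open Classical in
/-- The resolvent operator `R(z, A) = (A - z)⁻¹` (zero off the resolvent set). -/
def resolventOp (A : X →ₗ.[ℂ] X) (z : ℂ) : X →L[ℂ] X :=
  if h : ∃ R, IsResolventAt A z R then Classical.choose h else 0

end Semigroup

/-! ### Homogeneous function spaces -/

section Homogeneous

variable {X : Type*} [NormedAddCommGroup X] [NormedSpace ℂ X]

/-- The Stepanov norm `sup_t ∫₀¹ ‖x (s + t)‖ ds`, with values in `[0, ∞]`. -/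
def stepanovNorm (x : ℝ → X) : ℝ≥0∞ :=
  ⨆ t : ℝ, ∫⁻ s in Set.Icc (0 : ℝ) 1, ‖x (s + t)‖ₑ

/-- `f` is an integrable a.e. majorant of `‖K‖`. -/
def IsMajorant (K : ℝ → X →L[ℂ] X) (f : ℝ → ℝ) : Prop :=
  Integrable f ∧ ∀ᵐ s, ‖K s‖ ≤ f s

/-- The class `L¹_s(ℝ, B(X))`: strongly measurable operator functions with an integrable
majorant. -/
def MemL1s (K : ℝ → X →L[ℂ] X) : Prop :=
  (∀ x, AEStronglyMeasurable (fun s => K s x) volume) ∧ ∃ f, IsMajorant K f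

/-- The norm of `L¹_s(ℝ, B(X))`: the infimum of the `L¹`-norms of the majorants. -/
def l1sNorm (K : ℝ → X →L[ℂ] X) : ℝ :=
  sInf {c | ∃ f, IsMajorant K f ∧ c = ∫ s, ‖f s‖}

/-- A homogeneous Banach function space of (classes of) functions `ℝ → X`. The Banach space is `F`;
`toAE` identifies its elements with functions modulo equality almost everywhere. -/
structure HomogeneousSpace (X F : Type*) [NormedAddCommGroup X] [NormedSpace ℂ X]
    [NormedAddCommGroup F] [NormedSpace ℂ F] where
  toAE : F →ₗ[ℂ] (ℝ →ₘ[volume] X)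
  injective : Function.Injective toAE
  /-- `F` is continuously embedded into the Stepanov space `S¹`. -/
  stepanov : ∃ C : ℝ≥0, ∀ x, stepanovNorm (toAE x) ≤ C * ‖x‖ₑ
  /-- Translations act isometrically. -/
  translate : ∀ (t : ℝ) (x : F), ∃ y : F,
    toAE y =ᵐ[volume] (fun s => toAE x (t + s)) ∧ ‖y‖ = ‖x‖
  /-- Bounded operators on `X` act pointwise. -/
  pointwise : ∀ (C : X →L[ℂ] X) (x : F), ∃ y : F,
    toAE y =ᵐ[volume] (fun s => C (toAE x s)) ∧ ‖y‖ ≤ ‖C‖ * ‖x‖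
  /-- `L¹_s(ℝ, B(X))` acts by convolution. -/
  convolve : ∀ (K : ℝ → X →L[ℂ] X) (x : F), MemL1s K → ∃ y : F,
    toAE y =ᵐ[volume] (fun t => ∫ s, K s (toAE x (t - s))) ∧ ‖y‖ ≤ l1sNorm K * ‖x‖
  /-- The `L¹`-module structure is non-degenerate. -/
  nondegenerate : ∀ x : F,
    (∀ f : ℝ → ℂ, Integrable f → (fun t => ∫ s, f s • toAE x (t - s)) =ᵐ[volume] 0) → x = 0

variable {F : Type*} [NormedAddCommGroup F] [NormedSpace ℂ F]

theorem isMajorant_smul_id {f : ℝ → ℂ} (hf : Integrable f) :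
    IsMajorant (fun s => f s • ContinuousLinearMap.id ℂ X) fun s => ‖f s‖ := by
  refine ⟨hf.norm, Eventually.of_forall fun s => ?_⟩
  refine ContinuousLinearMap.opNorm_le_bound _ (norm_nonneg _) fun v => ?_
  simp [norm_smul]

theorem memL1s_smul_id {f : ℝ → ℂ} (hf : Integrable f) :
    MemL1s (fun s => f s • ContinuousLinearMap.id ℂ X) :=
  ⟨fun v => by simpa using hf.aestronglyMeasurable.smul_const v, _, isMajorant_smul_id hf⟩

open Classical in
/-- The module action `(f x)(t) = ∫ f(s) x(t - s) ds` of `f ∈ L¹(ℝ)` on `x ∈ F`, as an element of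
`F` (it exists for every integrable `f`, see `conv_spec`). -/
def conv (H : HomogeneousSpace X F) (f : ℝ → ℂ) (x : F) : F :=
  if h : ∃ y : F, H.toAE y =ᵐ[volume] (fun t => ∫ s, f s • H.toAE x (t - s)) then
    Classical.choose h else 0

theorem conv_spec (H : HomogeneousSpace X F) {f : ℝ → ℂ} (hf : Integrable f) (x : F) :
    H.toAE (conv H f x) =ᵐ[volume] (fun t => ∫ s, f s • H.toAE x (t - s)) := by
  have h : ∃ y : F, H.toAE y =ᵐ[volume] (fun t => ∫ s, f s • H.toAE x (t - s)) := by
    obtain ⟨y, hy, -⟩ := H.convolve _ x (memL1s_smul_id hf)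
    exact ⟨y, by simpa using hy⟩
  unfold conv
  rw [dif_pos h]
  exact Classical.choose_spec h

/-- Convolutions of integrable functions with elements of `F` converge absolutely a.e. -/
theorem ae_integrable_conv (H : HomogeneousSpace X F) {f : ℝ → ℂ} (hf : Integrable f) (x : F) :
    ∀ᵐ t : ℝ, Integrable (fun s => f s • H.toAE x (t - s)) := by
  obtain ⟨C, hC⟩ := H.stepanov
  set u : ℝ → X := ⇑(H.toAE x) with hu
  have hum : AEStronglyMeasurable u volume := (H.toAE x).aestronglyMeasurable
  have hm : AEStronglyMeasurable (fun p : ℝ × ℝ => f p.2 • u (p.1 - p.2))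
      (volume.prod volume) :=
    hf.aestronglyMeasurable.convolution_integrand (ContinuousLinearMap.lsmul ℂ ℂ) hum
  have key : ∀ n : ℤ, ∀ᵐ t ∂(volume.restrict (Set.Icc (n : ℝ) (n + 1))),
      Integrable (fun s => f s • u (t - s)) := by
    intro n
    have hle : (volume.restrict (Set.Icc (n : ℝ) (n + 1))).prod (volume : Measure ℝ) ≤
        (volume : Measure ℝ).prod (volume : Measure ℝ) :=
      Measure.prod_mono Measure.restrict_le_self le_rfl
    have hm' := hm.mono_measure hle
    have hint : Integrable (fun p : ℝ × ℝ => f p.2 • u (p.1 - p.2))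
        ((volume.restrict (Set.Icc (n : ℝ) (n + 1))).prod volume) := by
      refine ⟨hm', ?_⟩
      rw [hasFiniteIntegral_iff_enorm, lintegral_prod_symm _ hm'.enorm]
      have hs : ∀ s : ℝ, ∫⁻ t in Set.Icc (n : ℝ) (n + 1), ‖f s • u (t - s)‖ₑ ≤
          ‖f s‖ₑ * (C * ‖x‖ₑ) := by
        intro s
        simp_rw [enorm_smul]
        rw [lintegral_const_mul' _ _ enorm_ne_top]
        gcongr
        refine le_trans (le_of_eq ?_) ((le_iSup _ ((n : ℝ) - s)).trans (hC x))
        have := (measurePreserving_add_right (volume : Measure ℝ) (n : ℝ)).setLIntegral_comp_emb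
          (measurableEmbedding_addRight (n : ℝ)) (fun t => ‖u (t - s)‖ₑ) (Set.Icc 0 1)
        simp only [Set.image_add_const_Icc, zero_add] at this
        rw [add_comm (n : ℝ) 1, ← this]
        simp only [add_sub_assoc, hu]
      refine (lintegral_mono hs).trans_lt ?_
      rw [lintegral_mul_const' _ _ (ENNReal.mul_ne_top ENNReal.coe_ne_top enorm_ne_top)]
      exact ENNReal.mul_lt_top hf.hasFiniteIntegral
        (ENNReal.mul_lt_top ENNReal.coe_lt_top enorm_lt_top)
    exact hint.prod_right_ae
  have hcover : (⋃ n : ℤ, Set.Icc (n : ℝ) (n + 1)) = Set.univ := iUnion_Icc_intCast ℝ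
  have h : ∀ᵐ t ∂(volume.restrict (⋃ n : ℤ, Set.Icc (n : ℝ) (n + 1))),
      Integrable (fun s => f s • u (t - s)) volume := (ae_restrict_iUnion_iff _ _).2 key
  rw [hcover, Measure.restrict_univ] at h
  exact h

theorem conv_add (H : HomogeneousSpace X F) {f : ℝ → ℂ} (hf : Integrable f) (x y : F) :
    conv H f (x + y) = conv H f x + conv H f y := by
  apply H.injective
  apply AEEqFun.ext
  have hxy : ∀ᵐ r : ℝ, H.toAE (x + y) r = H.toAE x r + H.toAE y r := by
    rw [_root_.map_add]
    exact AEEqFun.coeFn_add _ _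
  rw [_root_.map_add]
  filter_upwards [conv_spec H hf (x + y), conv_spec H hf x, conv_spec H hf y,
    AEEqFun.coeFn_add (H.toAE (conv H f x)) (H.toAE (conv H f y)),
    ae_integrable_conv H hf x, ae_integrable_conv H hf y] with t h1 h2 h3 h4 h5 h6
  rw [h1, h4, Pi.add_apply, h2, h3, ← integral_add h5 h6]
  refine integral_congr_ae ?_
  filter_upwards [(quasiMeasurePreserving_sub_left_of_right_invariant volume t).ae hxy] with s hs
  rw [hs, smul_add]

theorem conv_smul (H : HomogeneousSpace X F) {f : ℝ → ℂ} (hf : Integrable f) (c : ℂ) (x : F) :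
    conv H f (c • x) = c • conv H f x := by
  apply H.injective
  apply AEEqFun.ext
  have hx : ∀ᵐ r : ℝ, H.toAE (c • x) r = c • H.toAE x r := by
    rw [map_smul]
    exact AEEqFun.coeFn_smul _ _
  rw [map_smul]
  filter_upwards [conv_spec H hf (c • x), conv_spec H hf x,
    AEEqFun.coeFn_smul c (H.toAE (conv H f x))] with t h1 h2 h3
  rw [h1, h3, Pi.smul_apply, h2, ← integral_smul]
  refine integral_congr_ae ?_
  filter_upwards [(quasiMeasurePreserving_sub_left_of_right_invariant volume t).ae hx] with s hs
  rw [hs, smul_comm]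

theorem conv_sub_left (H : HomogeneousSpace X F) {f g : ℝ → ℂ} (hf : Integrable f)
    (hg : Integrable g) (x : F) : conv H (fun s => f s - g s) x = conv H f x - conv H g x := by
  apply H.injective
  apply AEEqFun.ext
  rw [_root_.map_sub]
  filter_upwards [conv_spec H (hf.sub hg) x, conv_spec H hf x, conv_spec H hg x,
    AEEqFun.coeFn_sub (H.toAE (conv H f x)) (H.toAE (conv H g x)),
    ae_integrable_conv H hf x, ae_integrable_conv H hg x] with t h1 h2 h3 h4 h5 h6
  rw [h4, Pi.sub_apply, h2, h3, ← integral_sub h5 h6]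
  refine h1.trans ?_
  simp only [Pi.sub_apply, sub_smul]

theorem norm_conv_le (H : HomogeneousSpace X F) {f : ℝ → ℂ} (hf : Integrable f) (x : F) :
    ‖conv H f x‖ ≤ (∫ s, ‖f s‖) * ‖x‖ := by
  have hmaj := isMajorant_smul_id (X := X) hf
  obtain ⟨y, hy, hle⟩ := H.convolve _ x (memL1s_smul_id hf)
  have hxy : conv H f x = y := by
    apply H.injective
    apply AEEqFun.ext
    filter_upwards [conv_spec H hf x, hy] with t h1 h2
    rw [h1, h2]
    simp
  rw [hxy]
  refine hle.trans (mul_le_mul_of_nonneg_right (csInf_le ⟨0, ?_⟩ ⟨_, hmaj, by simp⟩) (norm_nonneg _))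
  rintro c ⟨g, -, rfl⟩
  exact integral_nonneg fun s => norm_nonneg _

end Homogeneous

/-! ### Absolutely summable spectrum -/

/-- The triangle function `(1 - |ξ|) χ_[-1,1](ξ)`. -/
def triangle (ξ : ℝ) : ℝ := max (1 - |ξ|) 0

/-- The function `φ_a ∈ L¹(ℝ)` whose Fourier transform `ξ ↦ ∫ φ_a(t) e^{-itξ} dt` is
`ξ ↦ triangle (ξ - a)`, given by Fourier inversion. -/
def phi (a t : ℝ) : ℂ :=
  (2 * Real.pi : ℂ)⁻¹ * ∫ ξ : ℝ, (triangle (ξ - a) : ℂ) * Complex.exp (Complex.I * ξ * t)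

theorem phi_eq_mul (a t : ℝ) : phi a t = Complex.exp (Complex.I * a * t) * phi 0 t := by
  have h := integral_add_right_eq_self (μ := volume)
    (fun ξ : ℝ => (triangle (ξ - a) : ℂ) * Complex.exp (Complex.I * ξ * t)) a
  unfold phi
  rw [← h, mul_left_comm]
  congr 1
  rw [← integral_const_mul (Complex.exp (Complex.I * a * t))]
  congr 1
  funext ξ
  rw [add_sub_cancel_right, sub_zero, mul_left_comm, ← Complex.exp_add]
  congr 2
  push_cast
  ring

theorem phi_zero_eq_intervalIntegral (t : ℝ) :
    phi 0 t = (2 * Real.pi : ℂ)⁻¹ *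
      ∫ ξ in (-1 : ℝ)..1, ((1 - |ξ| : ℝ) : ℂ) * Complex.exp (Complex.I * ξ * t) := by
  unfold phi
  rw [intervalIntegral.integral_of_le (by norm_num)]
  congr 1
  rw [← setIntegral_eq_integral_of_forall_compl_eq_zero (s := Set.Ioc (-1 : ℝ) 1)]
  · refine setIntegral_congr_fun measurableSet_Ioc fun ξ hξ => ?_
    have : |ξ| ≤ 1 := abs_le.2 ⟨hξ.1.le, hξ.2⟩
    simp [triangle, this]
  · intro ξ hξ
    have : 1 ≤ |ξ| := by
      by_contra hlt
      rw [not_le, abs_lt] at hlt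
      exact hξ ⟨hlt.1, hlt.2.le⟩
    simp [triangle, this]

theorem phi_zero_eq {t : ℝ} (ht : t ≠ 0) :
    phi 0 t = (1 - Complex.cos t) / (Real.pi * t ^ 2) := by
  have htc : (t : ℂ) ≠ 0 := by exact_mod_cast ht
  have hI := Complex.I_ne_zero
  set w : ℂ := Complex.I * t with hw
  have hwz : w ≠ 0 := mul_ne_zero hI htc
  have hc : Continuous fun ξ : ℝ => ((1 - |ξ| : ℝ) : ℂ) * Complex.exp (Complex.I * ξ * t) := by
    fun_prop
  have hexp : ∀ ξ : ℝ, HasDerivAt (fun ξ : ℝ => Complex.exp (w * ξ)) (Complex.exp (w * ξ) * w) ξ :=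
    fun ξ => by
      have := ((hasDerivAt_id (ξ : ℂ)).const_mul w).cexp.comp_ofReal
      simpa using this
  have h1 : ∫ ξ in (0 : ℝ)..1, ((1 - |ξ| : ℝ) : ℂ) * Complex.exp (Complex.I * ξ * t) =
      Complex.exp w / w ^ 2 - (1 / w + 1 / w ^ 2) := by
    have hd : ∀ ξ : ℝ, HasDerivAt
        (fun ξ : ℝ => ((1 - (ξ : ℂ)) / w + 1 / w ^ 2) * Complex.exp (w * ξ))
        ((1 - (ξ : ℂ)) * Complex.exp (w * ξ)) ξ := fun ξ => by
      have h0 : HasDerivAt (fun ξ : ℝ => (1 - (ξ : ℂ)) / w + 1 / w ^ 2) (-1 / w) ξ := by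
        have := (((hasDerivAt_id (ξ : ℂ)).const_sub 1).div_const w).add_const (1 / w ^ 2)
        exact this.comp_ofReal
      refine (h0.mul (hexp ξ)).congr_deriv ?_
      field_simp
      ring
    have := intervalIntegral.integral_eq_sub_of_hasDerivAt (a := 0) (b := 1) (fun ξ _ => hd ξ)
      ((by fun_prop : Continuous fun ξ : ℝ =>
        (1 - (ξ : ℂ)) * Complex.exp (w * ξ)).intervalIntegrable _ _)
    calc _ = ∫ ξ in (0 : ℝ)..1, (1 - (ξ : ℂ)) * Complex.exp (w * ξ) := by
          refine intervalIntegral.integral_congr fun ξ hξ => ?_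
          rw [Set.uIcc_of_le zero_le_one] at hξ
          simp only [abs_of_nonneg hξ.1, hw]
          push_cast
          ring_nf
      _ = _ := by
          rw [this]
          simp
          ring
  have h2 : ∫ ξ in (-1 : ℝ)..0, ((1 - |ξ| : ℝ) : ℂ) * Complex.exp (Complex.I * ξ * t) =
      (1 / w - 1 / w ^ 2) + Complex.exp (-w) / w ^ 2 := by
    have hd : ∀ ξ : ℝ, HasDerivAt
        (fun ξ : ℝ => ((1 + (ξ : ℂ)) / w - 1 / w ^ 2) * Complex.exp (w * ξ))
        ((1 + (ξ : ℂ)) * Complex.exp (w * ξ)) ξ := fun ξ => by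
      have h0 : HasDerivAt (fun ξ : ℝ => (1 + (ξ : ℂ)) / w - 1 / w ^ 2) (1 / w) ξ := by
        have := (((hasDerivAt_id (ξ : ℂ)).const_add 1).div_const w).sub_const (1 / w ^ 2)
        exact this.comp_ofReal
      refine (h0.mul (hexp ξ)).congr_deriv ?_
      field_simp
      ring
    have := intervalIntegral.integral_eq_sub_of_hasDerivAt (a := -1) (b := 0) (fun ξ _ => hd ξ)
      ((by fun_prop : Continuous fun ξ : ℝ =>
        (1 + (ξ : ℂ)) * Complex.exp (w * ξ)).intervalIntegrable _ _)
    calc _ = ∫ ξ in (-1 : ℝ)..0, (1 + (ξ : ℂ)) * Complex.exp (w * ξ) := by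
          refine intervalIntegral.integral_congr fun ξ hξ => ?_
          rw [Set.uIcc_of_le (by norm_num)] at hξ
          simp only [abs_of_nonpos hξ.2, hw]
          push_cast
          ring_nf
      _ = _ := by
          rw [this]
          simp
          ring
  rw [phi_zero_eq_intervalIntegral, ← intervalIntegral.integral_add_adjacent_intervals
    (hc.intervalIntegrable (-1) 0) (hc.intervalIntegrable 0 1), h1, h2]
  have hw2 : w ^ 2 = -(t : ℂ) ^ 2 := by rw [hw, mul_pow, Complex.I_sq]; ring
  have hcos : Complex.cos t = (Complex.exp w + Complex.exp (-w)) / 2 := by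
    rw [Complex.cos, hw]
    ring_nf
  have hpi : (Real.pi : ℂ) ≠ 0 := by exact_mod_cast Real.pi_ne_zero
  rw [hcos]
  have : 1 / w - 1 / w ^ 2 + Complex.exp (-w) / w ^ 2 +
      (Complex.exp w / w ^ 2 - (1 / w + 1 / w ^ 2)) =
      (Complex.exp w + Complex.exp (-w) - 2) / w ^ 2 := by ring
  rw [this, hw2]
  field_simp
  ring

theorem norm_phi_le (a t : ℝ) : ‖phi a t‖ ≤ 2 * (1 + t ^ 2)⁻¹ := by
  have hn : ‖phi a t‖ = ‖phi 0 t‖ := by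
    rw [phi_eq_mul, norm_mul, show Complex.I * a * t = ((a * t : ℝ) : ℂ) * Complex.I by
      push_cast; ring, Complex.norm_exp_ofReal_mul_I, one_mul]
  have hpi := Real.pi_gt_three
  rw [hn, ← div_eq_mul_inv, le_div_iff₀ (by positivity)]
  by_cases ht : |t| ≤ 1
  · have ht2 : t ^ 2 ≤ 1 := (sq_le_one_iff_abs_le_one t).2 ht
    have hb : ‖∫ ξ in (-1 : ℝ)..1, ((1 - |ξ| : ℝ) : ℂ) * Complex.exp (Complex.I * ξ * t)‖ ≤
        1 * |(1 : ℝ) - (-1)| := by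
      refine intervalIntegral.norm_integral_le_of_norm_le_const fun ξ hξ => ?_
      rw [Set.uIoc_of_le (by norm_num)] at hξ
      have : |ξ| ≤ 1 := abs_le.2 ⟨hξ.1.le, hξ.2⟩
      rw [norm_mul, show Complex.I * ξ * t = ((ξ * t : ℝ) : ℂ) * Complex.I by
        push_cast; ring, Complex.norm_exp_ofReal_mul_I, mul_one, Complex.norm_real,
        Real.norm_eq_abs, abs_le]
      constructor <;> linarith [abs_nonneg ξ]
    have h1 : ‖phi 0 t‖ ≤ 1 := by
      rw [phi_zero_eq_intervalIntegral, norm_mul, norm_inv, norm_mul, Complex.norm_real,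
        Real.norm_eq_abs, abs_of_pos Real.pi_pos, Complex.norm_ofNat]
      have h2 : (1 : ℝ) * |(1 : ℝ) - (-1)| = 2 := by norm_num
      rw [h2] at hb
      rw [inv_mul_le_iff₀ (by positivity)]
      linarith
    nlinarith [norm_nonneg (phi 0 t)]
  · have ht0 : t ≠ 0 := by rintro rfl; simp at ht
    have ht2 : 1 < t ^ 2 := by
      rw [not_le] at ht
      exact (one_lt_sq_iff_one_lt_abs t).2 ht
    have h1 : ‖phi 0 t‖ * t ^ 2 ≤ 1 := by
      rw [phi_zero_eq ht0, ← Complex.ofReal_cos,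
        show (1 - (Real.cos t : ℂ)) / (Real.pi * t ^ 2) =
          (((1 - Real.cos t) / (Real.pi * t ^ 2) : ℝ) : ℂ) by push_cast; ring,
        Complex.norm_real, Real.norm_eq_abs,
        abs_of_nonneg (div_nonneg (by linarith [Real.cos_le_one t]) (by positivity)),
        div_mul_eq_mul_div, div_le_one (by positivity)]
      nlinarith [Real.neg_one_le_cos t]
    nlinarith [norm_nonneg (phi 0 t)]

theorem integrable_phi (a : ℝ) : Integrable (phi a) := by
  refine (integrable_inv_one_add_sq.const_mul 2).mono' ?_ (Eventually.of_forall (norm_phi_le a))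
  have hm : Measurable fun t : ℝ => Complex.exp (Complex.I * a * t) *
      ((1 - Complex.cos t) / (Real.pi * t ^ 2)) := by fun_prop
  refine hm.aestronglyMeasurable.congr ?_
  filter_upwards [compl_mem_ae_iff.2 (Real.volume_singleton (a := 0))] with t ht
  rw [phi_eq_mul, phi_zero_eq ht]

theorem continuous_phi_left (t : ℝ) : Continuous fun a => phi a t := by
  rw [show (fun a => phi a t) = fun a : ℝ => Complex.exp (Complex.I * a * t) * phi 0 t from
    funext fun a => phi_eq_mul a t]
  fun_prop

section AbsolutelySummable

variable {X : Type*} [NormedAddCommGroup X] [NormedSpace ℂ X]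
variable {F : Type*} [NormedAddCommGroup F] [NormedSpace ℂ F]

theorem continuous_conv_phi (H : HomogeneousSpace X F) (x : F) :
    Continuous fun a => conv H (phi a) x := by
  rw [continuous_iff_continuousAt]
  intro a
  rw [ContinuousAt, tendsto_iff_norm_sub_tendsto_zero]
  have hL : Tendsto (fun b => ∫ t, ‖phi b t - phi a t‖) (𝓝 a) (𝓝 (∫ _ : ℝ, (0 : ℝ))) := by
    refine tendsto_integral_filter_of_dominated_convergence
      (fun t : ℝ => 2 * (1 + t ^ 2)⁻¹ + 2 * (1 + t ^ 2)⁻¹) ?_ ?_ ?_ ?_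
    · exact Eventually.of_forall fun b =>
        ((integrable_phi b).sub (integrable_phi a)).norm.aestronglyMeasurable
    · refine Eventually.of_forall fun b => Eventually.of_forall fun t => ?_
      rw [norm_norm]
      exact (norm_sub_le _ _).trans (add_le_add (norm_phi_le b t) (norm_phi_le a t))
    · exact (integrable_inv_one_add_sq.const_mul 2).add (integrable_inv_one_add_sq.const_mul 2)
    · refine Eventually.of_forall fun t => ?_
      exact tendsto_iff_norm_sub_tendsto_zero.1 ((continuous_phi_left t).tendsto a)
  rw [integral_zero] at hL
  have hL' := hL.mul_const ‖x‖
  rw [zero_mul] at hL'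
  refine squeeze_zero (fun b => norm_nonneg _) (fun b => ?_) hL'
  rw [← conv_sub_left H (integrable_phi b) (integrable_phi a)]
  exact norm_conv_le H ((integrable_phi b).sub (integrable_phi a)) x

/-- The integral norm `∫ ‖φ_a x‖ da`, with values in `[0, ∞]`. -/
def asIntegralNorm (H : HomogeneousSpace X F) (x : F) : ℝ≥0∞ :=
  ∫⁻ a : ℝ, ‖conv H (phi a) x‖ₑ

/-- The equivalent norm `5 ∑ₙ ‖φ_n x‖`, `n ∈ ℤ`, with values in `[0, ∞]`. -/
def asNorm (H : HomogeneousSpace X F) (x : F) : ℝ≥0∞ :=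
  5 * ∑' n : ℤ, ‖conv H (phi n) x‖ₑ

/-- The space of functions in `F` with absolutely summable spectrum. -/
def absolutelySummable (H : HomogeneousSpace X F) : Submodule ℂ F where
  carrier := {x | asIntegralNorm H x < ∞}
  add_mem' := by
    intro x y hx hy
    have hm : Measurable fun a => ‖conv H (phi a) x‖ₑ := (continuous_conv_phi H x).enorm.measurable
    calc asIntegralNorm H (x + y)
        ≤ ∫⁻ a : ℝ, (‖conv H (phi a) x‖ₑ + ‖conv H (phi a) y‖ₑ) := by
          refine lintegral_mono fun a => ?_
          rw [conv_add H (integrable_phi a)]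
          exact enorm_add_le _ _
      _ = asIntegralNorm H x + asIntegralNorm H y := lintegral_add_left hm _
      _ < ∞ := ENNReal.add_lt_top.2 ⟨hx, hy⟩
  zero_mem' := by
    have : ∀ a, conv H (phi a) (0 : F) = 0 := fun a => by
      simpa using conv_smul H (integrable_phi a) 0 (0 : F)
    simp [asIntegralNorm, this]
  smul_mem' := by
    intro c x hx
    have : asIntegralNorm H (c • x) = ‖c‖ₑ * asIntegralNorm H x := by
      simp_rw [asIntegralNorm, conv_smul H (integrable_phi _), enorm_smul]
      exact lintegral_const_mul' _ _ enorm_ne_top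
    simpa [this] using ENNReal.mul_lt_top enorm_lt_top hx

/-- The graph of the abstract parabolic operator `L = -d/dt + A` in the space `F_as` of functions
with absolutely summable spectrum: `x ∈ D(L)` and `L x = y` if some representative `u` of
the class of `x` satisfies `u(t) = T(t - s) u(s) - ∫_s^t T(t - τ) y(τ) dτ` for all `s ≤ t`. -/
def IsParabolic (H : HomogeneousSpace X F) (T : C0Semigroup X)
    (x y : absolutelySummable H) : Prop :=
  ∃ u : ℝ → X, u =ᵐ[volume] H.toAE x ∧ ∀ s t : ℝ, s ≤ t →
    u t = T.toFun (t - s).toNNReal (u s) -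
      ∫ τ in s..t, T.toFun (t - τ).toNNReal (H.toAE y τ)

end AbsolutelySummable

end AbstractParabolic

end

/-! On the exponential `e^{iξt} v` the operator `L` acts as `A - iξ`, so its inverse has to be the
Fourier multiplier with symbol `R(iξ, A)`. This symbol need not have an integrable kernel, but its
cutoff by a unit triangle around any frequency `a` does: the resolvent identity makes it twice
continuously differentiable, with derivatives `i R²` and `-2 R³` bounded in terms of `M`. Two
integrations by parts then bound the kernel of `tri a R` by a multiple of `(1 + t²)⁻¹`, and its
`L¹`-norm by a constant `C` independent of `a` (`sq_mul_norm_kernel_tri_le`,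
`integral_norm_kernel_resolvent_le`).

Existence. Integer translates of the triangle sum to one, so an absolutely summable `y` is the sum
of its pieces `φ_n * y` (`hasSum_phiL`). Each cut-off multiplier yields a mild solution with
inhomogeneity `φ_n * y`, by integrating the variation of constants formula for exponentials over
frequency and then over the argument of `y` (`evalL_tri_add`, `isMild_tri`). The quadratic decay
lets these solutions be summed uniformly on the line (`IsMild.tsum`).

Bound. Multipliers compose by multiplying symbols, and only three integer translates of the triangle
at `a` meet its support. Hence `‖φ_a * x‖ ≤ 3 C ‖φ_a * y‖` for every real `a`
(`SmoothSymbol.exists_hasSum`). Being pointwise in `a`, this gives the same constant for the sum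
norm and for the integral norm.

Uniqueness. The kernels commute with the semigroup, so they preserve homogeneous mild solutions. If
`L x = 0`, the smoothed function therefore solves both the homogeneous equation and the one with
inhomogeneity `φ_n * x`. A Duhamel integral that vanishes identically has zero integrand
(`IsMild.eq_zero`), so `φ_n * x = 0` for all `n`. A Fejér argument and nondegeneracy of the module
then give `x = 0` (`eq_zero_of_phiL_eq_zero`). -/

noncomputable section

namespace AbstractParabolic

/-! ### Semigroups and resolvents -/

section SemigroupFacts

variable {X : Type*} [NormedAddCommGroup X] [NormedSpace ℂ X]

theorem C0Semigroup.exists_norm_le [CompleteSpace X] (T : C0Semigroup X) (a : ℝ≥0) :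
    ∃ C : ℝ, 0 ≤ C ∧ ∀ t ≤ a, ‖T.toFun t‖ ≤ C := by
  have h : ∀ x, ∃ C, ∀ t : Set.Icc (0 : ℝ≥0) a, ‖T.toFun t x‖ ≤ C := by
    intro x
    obtain ⟨C, hC⟩ := (isCompact_Icc (a := (0 : ℝ≥0)) (b := a)).exists_bound_of_continuousOn
      (T.continuous_orbit x).continuousOn
    exact ⟨C, fun t => hC t t.2⟩
  obtain ⟨C, hC⟩ := banach_steinhaus (g := fun t : Set.Icc (0 : ℝ≥0) a => T.toFun t) h
  exact ⟨C, (norm_nonneg _).trans (hC ⟨0, le_rfl, zero_le⟩), fun t ht => hC ⟨t, zero_le, ht⟩⟩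

/-- Strong continuity and local boundedness combine to joint continuity. This replaces norm
continuity, which may fail, in all measurability questions about `T(σ) y(τ)`. -/
theorem C0Semigroup.continuous_uncurry [CompleteSpace X] (T : C0Semigroup X) :
    Continuous fun p : ℝ × X => T.toFun p.1.toNNReal p.2 := by
  rw [continuous_iff_continuousAt]
  rintro ⟨t, v⟩
  obtain ⟨C, hC0, hC⟩ := T.exists_norm_le (t + 1).toNNReal
  rw [ContinuousAt, tendsto_iff_norm_sub_tendsto_zero]
  have h1 : Tendsto (fun p : ℝ × X => C * ‖p.2 - v‖ +
      ‖T.toFun p.1.toNNReal v - T.toFun t.toNNReal v‖) (𝓝 (t, v)) (𝓝 0) := by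
    have hc : Continuous fun p : ℝ × X => C * ‖p.2 - v‖ +
        ‖T.toFun p.1.toNNReal v - T.toFun t.toNNReal v‖ := by
      have := (T.continuous_orbit v).comp (continuous_real_toNNReal.comp
        (continuous_fst (X := ℝ) (Y := X)))
      simp only [Function.comp_def] at this
      fun_prop
    simpa using hc.tendsto (t, v)
  refine squeeze_zero' (Eventually.of_forall fun _ => norm_nonneg _) ?_ h1
  have : ∀ᶠ p : ℝ × X in 𝓝 (t, v), p.1 < t + 1 :=
    (continuous_fst.tendsto (t, v)).eventually_lt_const (by simp)
  filter_upwards [this] with p hp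
  have e : T.toFun p.1.toNNReal p.2 - T.toFun t.toNNReal v =
      T.toFun p.1.toNNReal (p.2 - v) + (T.toFun p.1.toNNReal v - T.toFun t.toNNReal v) := by
    rw [map_sub]; abel
  rw [e]
  refine (norm_add_le _ _).trans (add_le_add_left ?_ _)
  exact (ContinuousLinearMap.le_opNorm _ _).trans
    (mul_le_mul_of_nonneg_right (hC _ (Real.toNNReal_le_toNNReal hp.le)) (norm_nonneg _))

theorem C0Semigroup.toFun_add_apply (T : C0Semigroup X) {s t : ℝ} (hs : 0 ≤ s) (ht : 0 ≤ t)
    (v : X) : T.toFun (s + t).toNNReal v = T.toFun s.toNNReal (T.toFun t.toNNReal v) := by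
  rw [Real.toNNReal_add hs ht, T.map_add]
  rfl

theorem HasOrbitDeriv.generator_mem {T : C0Semigroup X} {x y : X} (h : HasOrbitDeriv T x y) :
    x ∈ T.generator.domain := ⟨y, h⟩

theorem HasOrbitDeriv.generator_eq {T : C0Semigroup X} {x y : X} (h : HasOrbitDeriv T x y)
    (hx : x ∈ T.generator.domain) : T.generator ⟨x, hx⟩ = y :=
  tendsto_nhds_unique (Classical.choose_spec hx) h

theorem hasOrbitDeriv_generator {T : C0Semigroup X} (x : T.generator.domain) :
    HasOrbitDeriv T x (T.generator x) :=
  Classical.choose_spec x.2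

theorem HasOrbitDeriv.toFun {T : C0Semigroup X} {x y : X} (h : HasOrbitDeriv T x y) (t : ℝ≥0) :
    HasOrbitDeriv T (T.toFun t x) (T.toFun t y) := by
  refine (((T.toFun t).continuous.tendsto y).comp h).congr fun r => ?_
  simp only [Function.comp_apply, map_smul, map_sub]
  rw [← ContinuousLinearMap.comp_apply (T.toFun t), ← ContinuousLinearMap.comp_apply (T.toFun _),
    ← T.map_add, ← T.map_add, add_comm]

theorem resolventOp_spec {A : X →ₗ.[ℂ] X} {z : ℂ} (h : z ∈ resolventSet A) :
    IsResolventAt A z (resolventOp A z) := by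
  have h' : ∃ R, IsResolventAt A z R := h
  rw [resolventOp, dif_pos h']
  exact Classical.choose_spec h'

/-- The first resolvent identity. -/
theorem IsResolventAt.sub_eq {A : X →ₗ.[ℂ] X} {z w : ℂ} {R S : X →L[ℂ] X}
    (hR : IsResolventAt A z R) (hS : IsResolventAt A w S) : R - S = (z - w) • (R * S) := by
  ext v
  obtain ⟨hm, hv⟩ := hS.1 v
  have := hR.2 ⟨S v, hm⟩
  have e : A ⟨S v, hm⟩ - z • S v = v - (z - w) • S v := by
    rw [sub_eq_iff_eq_add.1 hv, sub_smul]
    abel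
  simp only [e, map_sub, map_smul] at this
  simp only [sub_apply, smul_apply, mul_apply_eq_comp]
  rw [sub_eq_iff_eq_add, ← sub_eq_iff_eq_add', this]

theorem IsResolventAt.hasOrbitDeriv {T : C0Semigroup X} {z : ℂ} {R : X →L[ℂ] X}
    (hR : IsResolventAt T.generator z R) (v : X) : HasOrbitDeriv T (R v) (v + z • R v) := by
  obtain ⟨hm, hv⟩ := hR.1 v
  have := hasOrbitDeriv_generator (T := T) ⟨R v, hm⟩
  rwa [sub_eq_iff_eq_add.1 hv] at this

theorem IsResolventAt.apply_of_hasOrbitDeriv {T : C0Semigroup X} {z : ℂ} {R : X →L[ℂ] X}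
    (hR : IsResolventAt T.generator z R) {x y : X} (h : HasOrbitDeriv T x y) :
    R (y - z • x) = x := by
  have := hR.2 ⟨x, h.generator_mem⟩
  rwa [h.generator_eq] at this

/-- `T(t) R v` lies in the domain and `A - z` sends it to `T(t) v`; apply `R`. -/
theorem IsResolventAt.commute {T : C0Semigroup X} {z : ℂ} {R : X →L[ℂ] X}
    (hR : IsResolventAt T.generator z R) (t : ℝ≥0) (v : X) :
    R (T.toFun t v) = T.toFun t (R v) := by
  have := hR.apply_of_hasOrbitDeriv ((hR.hasOrbitDeriv v).toFun t)
  rwa [map_add, map_smul, add_sub_cancel_right] at this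

/-- The definition of the generator directly gives right derivatives only; these suffice for the
fundamental theorem of calculus along continuous orbits. -/
theorem HasOrbitDeriv.hasDerivWithinAt {T : C0Semigroup X} {x y : X} (h : HasOrbitDeriv T x y)
    {r : ℝ} (hr : 0 ≤ r) :
    HasDerivWithinAt (fun s : ℝ => T.toFun s.toNNReal x) (T.toFun r.toNNReal y) (Set.Ioi r) r := by
  rw [hasDerivWithinAt_iff_tendsto_slope' (by simp)]
  have h1 := h.toFun r.toNNReal
  have h2 : Tendsto (fun s : ℝ => s - r) (𝓝[>] r) (𝓝[>] 0) := by
    refine tendsto_nhdsWithin_iff.2 ⟨?_, ?_⟩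
    · have : Continuous fun s : ℝ => s - r := by fun_prop
      simpa using (this.tendsto r).mono_left nhdsWithin_le_nhds
    · filter_upwards [self_mem_nhdsWithin] with s hs
      exact sub_pos.2 (Set.mem_Ioi.1 hs)
  refine (h1.comp h2).congr' ?_
  filter_upwards [self_mem_nhdsWithin] with s hs
  have hs' : 0 ≤ s - r := (sub_pos.2 (Set.mem_Ioi.1 hs)).le
  simp only [Function.comp_apply, slope, vsub_eq_sub]
  rw [← T.toFun_add_apply hs' hr, sub_add_cancel, ← Complex.ofReal_inv]
  rfl

/-- Variation of constants for the exponentials `t ↦ e^{z t}`. -/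
theorem IsResolventAt.exp_smul_eq [CompleteSpace X] {T : C0Semigroup X} {z : ℂ} {R : X →L[ℂ] X}
    (hR : IsResolventAt T.generator z R) (v : X) {h : ℝ} (hh : 0 ≤ h) :
    Complex.exp (z * h) • R v = T.toFun h.toNNReal (R v) -
      ∫ σ in (0 : ℝ)..h, Complex.exp (z * σ) • T.toFun (h - σ).toNNReal v := by
  have hcT : ∀ w, Continuous fun s : ℝ => T.toFun s.toNNReal w := fun w =>
    (T.continuous_orbit w).comp continuous_real_toNNReal
  have hexp : ∀ r : ℝ, HasDerivAt (fun r : ℝ => Complex.exp (-z * r))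
      (Complex.exp (-z * r) * -z) r := fun r => by
    have := ((hasDerivAt_id (r : ℂ)).const_mul (-z)).cexp.comp_ofReal
    simpa using this
  -- Since `A R v = v + z R v`, the terms in `z` cancel when `e^{-zr} T(r) R v` is differentiated.
  have h1 : ∫ r in (0 : ℝ)..h, Complex.exp (-z * r) • T.toFun r.toNNReal v =
      Complex.exp (-z * h) • T.toFun h.toNNReal (R v) - R v := by
    have := intervalIntegral.integral_eq_sub_of_hasDeriv_right_of_le hh
      (f := fun r : ℝ => Complex.exp (-z * r) • T.toFun r.toNNReal (R v))
      (f' := fun r : ℝ => Complex.exp (-z * r) • T.toFun r.toNNReal v) ?_ ?_ ?_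
    · rw [this]
      simp [T.map_zero]
    · have := hcT (R v)
      exact Continuous.continuousOn (by fun_prop)
    · intro r hr
      have hd := (hexp r).hasDerivWithinAt.smul
        ((hR.hasOrbitDeriv v).hasDerivWithinAt hr.1.le)
      refine hd.congr_deriv ?_
      simp only [map_add, map_smul, smul_add, smul_smul, mul_neg, neg_smul]
      abel
    · have := hcT v
      exact Continuous.intervalIntegrable (by fun_prop) _ _
  have h2 : ∫ σ in (0 : ℝ)..h, Complex.exp (z * σ) • T.toFun (h - σ).toNNReal v =
      Complex.exp (z * h) • ∫ r in (0 : ℝ)..h, Complex.exp (-z * r) • T.toFun r.toNNReal v := by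
    have := intervalIntegral.integral_comp_sub_left (a := 0) (b := h)
      (fun r : ℝ => Complex.exp (z * (h - r : ℝ)) • T.toFun r.toNNReal v) h
    simp only [sub_sub_cancel, sub_self, sub_zero] at this
    rw [this, ← intervalIntegral.integral_smul]
    refine intervalIntegral.integral_congr fun r _ => ?_
    simp only [smul_smul, ← Complex.exp_add]
    congr 2
    push_cast
    ring
  rw [h2, h1, smul_sub, smul_smul, ← Complex.exp_add]
  simp

end SemigroupFacts

/-! ### Kernels with quadratic decay -/

/-- The weight `(1 + s²)⁻¹`. -/
def wt (s : ℝ) : ℝ := (1 + s ^ 2)⁻¹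

theorem wt_pos (s : ℝ) : 0 < wt s := by unfold wt; positivity

theorem continuous_wt : Continuous wt := by
  unfold wt
  exact Continuous.inv₀ (by fun_prop) fun s => by positivity

theorem integrable_wt : Integrable wt := integrable_inv_one_add_sq

/-- A Peetre inequality: the weight changes only by a bounded factor under bounded shifts. -/
theorem wt_le_mul_wt_add (s r : ℝ) : wt s ≤ 2 * (1 + r ^ 2) * wt (s + r) := by
  unfold wt
  rw [← div_eq_mul_inv, inv_eq_one_div, div_le_div_iff₀ (by positivity) (by positivity)]
  nlinarith [sq_nonneg (s - r), sq_nonneg (s * r), sq_nonneg s, sq_nonneg r]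

theorem aestronglyMeasurable_comp_add_sub {E : Type*} [NormedAddCommGroup E] {x : ℝ → E}
    (hx : AEStronglyMeasurable x volume) (t : ℝ) :
    AEStronglyMeasurable (fun p : ℝ × ℝ => x (p.1 + (t - p.2))) (volume.prod volume) := by
  refine hx.comp_quasiMeasurePreserving (f := fun p : ℝ × ℝ => p.1 + (t - p.2)) ?_
  refine QuasiMeasurePreserving.prod_of_left (by fun_prop) (Eventually.of_forall fun y => ?_)
  exact (measurePreserving_add_right volume (t - y)).quasiMeasurePreserving

theorem aestronglyMeasurable_comp_sub {E : Type*} [NormedAddCommGroup E] {x : ℝ → E}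
    (hx : AEStronglyMeasurable x volume) (t : ℝ) :
    AEStronglyMeasurable (fun s => x (t - s)) volume :=
  hx.comp_quasiMeasurePreserving (quasiMeasurePreserving_sub_left_of_right_invariant volume t)

/-- The Stepanov norm controls weighted `L¹`-norms, uniformly under translations. -/
theorem lintegral_wt_mul_enorm_le {E : Type*} [NormedAddCommGroup E] {x : ℝ → E}
    (hx : AEStronglyMeasurable x volume) (t : ℝ) :
    ∫⁻ s, ENNReal.ofReal (wt s) * ‖x (t - s)‖ₑ ≤
      ENNReal.ofReal (4 * Real.pi) * stepanovNorm x := by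
  have hmw : Measurable fun s : ℝ => ENNReal.ofReal (wt s) := continuous_wt.measurable.ennreal_ofReal
  -- Shifting by `r ∈ [0, 1]` costs a factor `4`. Averaging over `r` and exchanging the integrals
  -- turns the inner one into a Stepanov integral.
  have h1 : ∀ r ∈ Set.Icc (0 : ℝ) 1, ∫⁻ s, ENNReal.ofReal (wt s) * ‖x (t - s)‖ₑ ≤
      ∫⁻ s, 4 * ENNReal.ofReal (wt s) * ‖x (r + (t - s))‖ₑ := by
    intro r hr
    rw [← lintegral_add_right_eq_self (μ := volume)
      (fun s => 4 * ENNReal.ofReal (wt s) * ‖x (r + (t - s))‖ₑ) r]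
    refine lintegral_mono fun s => ?_
    rw [show r + (t - (s + r)) = t - s by ring]
    gcongr
    rw [show (4 : ℝ≥0∞) = ENNReal.ofReal 4 by simp, ← ENNReal.ofReal_mul (by norm_num)]
    refine ENNReal.ofReal_le_ofReal ((wt_le_mul_wt_add s r).trans ?_)
    refine mul_le_mul_of_nonneg_right ?_ (wt_pos _).le
    nlinarith [hr.1, hr.2]
  have hm : AEMeasurable (Function.uncurry fun r s : ℝ =>
      4 * ENNReal.ofReal (wt s) * ‖x (r + (t - s))‖ₑ)
      ((volume.restrict (Set.Icc (0 : ℝ) 1)).prod volume) := by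
    have := (aestronglyMeasurable_comp_add_sub hx t).mono_measure
      (Measure.prod_mono (Measure.restrict_le_self (s := Set.Icc (0 : ℝ) 1)) le_rfl)
    exact ((measurable_const.mul (hmw.comp measurable_snd)).aemeasurable).mul this.enorm
  calc ∫⁻ s, ENNReal.ofReal (wt s) * ‖x (t - s)‖ₑ
      = ∫⁻ _ in Set.Icc (0 : ℝ) 1, ∫⁻ s, ENNReal.ofReal (wt s) * ‖x (t - s)‖ₑ := by simp
    _ ≤ ∫⁻ r in Set.Icc (0 : ℝ) 1, ∫⁻ s, 4 * ENNReal.ofReal (wt s) * ‖x (r + (t - s))‖ₑ :=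
        setLIntegral_mono' measurableSet_Icc h1
    _ = ∫⁻ s, ∫⁻ r in Set.Icc (0 : ℝ) 1, 4 * ENNReal.ofReal (wt s) * ‖x (r + (t - s))‖ₑ :=
        lintegral_lintegral_swap hm
    _ ≤ ∫⁻ s, 4 * ENNReal.ofReal (wt s) * stepanovNorm x := by
        refine lintegral_mono fun s => ?_
        dsimp only
        rw [lintegral_const_mul' _ _ (ENNReal.mul_ne_top (by simp) ENNReal.ofReal_ne_top)]
        gcongr
        exact le_iSup (fun t : ℝ => ∫⁻ s in Set.Icc (0 : ℝ) 1, ‖x (s + t)‖ₑ) (t - s)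
    _ = ENNReal.ofReal (4 * Real.pi) * stepanovNorm x := by
        rw [lintegral_mul_const _ (hmw.const_mul _), lintegral_const_mul _ hmw,
          ← ofReal_integral_eq_lintegral_ofReal integrable_wt
            (Eventually.of_forall fun s => (wt_pos s).le)]
        congr 1
        rw [show (4 : ℝ≥0∞) = ENNReal.ofReal 4 by simp, ← ENNReal.ofReal_mul (by norm_num)]
        unfold wt
        rw [integral_univ_inv_one_add_sq]

section Weighted

variable {X : Type*} [NormedAddCommGroup X] [NormedSpace ℂ X]

/-- Strongly measurable operator functions dominated by a multiple of `wt`. -/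
structure QuadDecay (k : ℝ → X →L[ℂ] X) (c : ℝ) : Prop where
  -- Measurability is required after application to functions, not in operator norm, so that
  -- truncated semigroups are admitted as kernels.
  meas : ∀ f : ℝ → X, AEStronglyMeasurable f volume →
    AEStronglyMeasurable (fun s => k s (f s)) volume
  bound : ∀ s, ‖k s‖ ≤ c * wt s

theorem QuadDecay.nonneg {k : ℝ → X →L[ℂ] X} {c : ℝ} (hk : QuadDecay k c) : 0 ≤ c := by
  have := (norm_nonneg _).trans (hk.bound 0)
  simpa [wt] using this

theorem aestronglyMeasurable_apply {k : ℝ → X →L[ℂ] X} (hk : AEStronglyMeasurable k volume)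
    {f : ℝ → X} (hf : AEStronglyMeasurable f volume) :
    AEStronglyMeasurable (fun s => k s (f s)) volume :=
  (ContinuousLinearMap.id ℂ (X →L[ℂ] X)).aestronglyMeasurable_comp₂ hk hf

theorem QuadDecay.of_continuous {k : ℝ → X →L[ℂ] X} (hk : Continuous k) {c : ℝ}
    (h : ∀ s, ‖k s‖ ≤ c * wt s) : QuadDecay k c :=
  ⟨fun _ hf => aestronglyMeasurable_apply hk.aestronglyMeasurable hf, h⟩

theorem integrable_of_le_wt {E : Type*} [NormedAddCommGroup E] {k : ℝ → E}
    (hk : AEStronglyMeasurable k volume) {c : ℝ} (h : ∀ s, ‖k s‖ ≤ c * wt s) : Integrable k :=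
  (integrable_wt.const_mul c).mono' hk (Eventually.of_forall h)

variable {F : Type*} [NormedAddCommGroup F] [NormedSpace ℂ F] (H : HomogeneousSpace X F)

theorem HomogeneousSpace.aestronglyMeasurable (x : F) :
    AEStronglyMeasurable (H.toAE x) volume := (H.toAE x).aestronglyMeasurable

/-- The constant of the embedding of `F` into weighted `L¹`. -/
def HomogeneousSpace.const : ℝ := 4 * Real.pi * (Classical.choose H.stepanov : ℝ≥0)

theorem HomogeneousSpace.const_nonneg : 0 ≤ H.const := by
  unfold HomogeneousSpace.const; positivity

theorem HomogeneousSpace.lintegral_wt_le (x : F) (t : ℝ) :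
    ∫⁻ s, ENNReal.ofReal (wt s) * ‖H.toAE x (t - s)‖ₑ ≤ ENNReal.ofReal (H.const * ‖x‖) := by
  refine (lintegral_wt_mul_enorm_le (H.aestronglyMeasurable x) t).trans ?_
  have := Classical.choose_spec H.stepanov x
  refine (mul_le_mul_right this _).trans (le_of_eq ?_)
  rw [HomogeneousSpace.const, mul_assoc (4 * Real.pi),
    ENNReal.ofReal_mul (p := 4 * Real.pi) (by positivity),
    ENNReal.ofReal_mul (p := ((Classical.choose H.stepanov : ℝ≥0) : ℝ)) (by positivity),
    ofReal_norm, ENNReal.ofReal_coe_nnreal]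

theorem HomogeneousSpace.integrable_wt_mul_norm (x : F) (t : ℝ) :
    Integrable fun s => wt s * ‖H.toAE x (t - s)‖ := by
  have hm := aestronglyMeasurable_comp_sub (H.aestronglyMeasurable x) t
  refine ⟨continuous_wt.aestronglyMeasurable.mul hm.norm, ?_⟩
  rw [hasFiniteIntegral_iff_enorm]
  refine lt_of_le_of_lt (le_of_eq ?_) ((H.lintegral_wt_le x t).trans_lt ENNReal.ofReal_lt_top)
  refine lintegral_congr fun s => ?_
  rw [enorm_mul, enorm_norm, Real.enorm_of_nonneg (wt_pos s).le]

theorem HomogeneousSpace.integral_wt_mul_norm_le (x : F) (t : ℝ) :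
    ∫ s, wt s * ‖H.toAE x (t - s)‖ ≤ H.const * ‖x‖ := by
  have hm := aestronglyMeasurable_comp_sub (H.aestronglyMeasurable x) t
  rw [integral_eq_lintegral_of_nonneg_ae
    (Eventually.of_forall fun s => mul_nonneg (wt_pos s).le (norm_nonneg _))
    (continuous_wt.aestronglyMeasurable.mul hm.norm)]
  refine ENNReal.toReal_le_of_le_ofReal (mul_nonneg H.const_nonneg (norm_nonneg _))
    (le_trans (le_of_eq ?_) (H.lintegral_wt_le x t))
  refine lintegral_congr fun s => ?_
  rw [ENNReal.ofReal_mul (wt_pos s).le, ofReal_norm]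

variable {H}

theorem QuadDecay.integrable {k : ℝ → X →L[ℂ] X} {c : ℝ} (hk : QuadDecay k c) (x : F) (t : ℝ) :
    Integrable fun s => k s (H.toAE x (t - s)) := by
  refine ((H.integrable_wt_mul_norm x t).const_mul c).mono'
    (hk.meas _ (aestronglyMeasurable_comp_sub (H.aestronglyMeasurable x) t))
    (Eventually.of_forall fun s => ?_)
  rw [← mul_assoc]
  exact ((k s).le_opNorm _).trans (mul_le_mul_of_nonneg_right (hk.bound s) (norm_nonneg _))

theorem HomogeneousSpace.toAE_add_ae (x y : F) :
    ∀ᵐ r : ℝ, H.toAE (x + y) r = H.toAE x r + H.toAE y r := by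
  rw [_root_.map_add]
  exact AEEqFun.coeFn_add _ _

theorem HomogeneousSpace.toAE_smul_ae (c : ℂ) (x : F) :
    ∀ᵐ r : ℝ, H.toAE (c • x) r = c • H.toAE x r := by
  rw [map_smul]
  exact AEEqFun.coeFn_smul _ _

theorem ae_comp_sub {p : ℝ → Prop} (h : ∀ᵐ r : ℝ, p r) (t : ℝ) : ∀ᵐ s : ℝ, p (t - s) :=
  (quasiMeasurePreserving_sub_left_of_right_invariant volume t).ae h

variable (H)

/-- The bounded operator `x ↦ ∫ k(s) x(t - s) ds` from `F` to `X`. -/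
def evalConv {k : ℝ → X →L[ℂ] X} {c : ℝ} (hk : QuadDecay k c) (t : ℝ) : F →L[ℂ] X :=
  LinearMap.mkContinuous
    { toFun := fun x => ∫ s, k s (H.toAE x (t - s))
      map_add' := fun x y => by
        rw [← integral_add (hk.integrable x t) (hk.integrable y t)]
        refine integral_congr_ae ?_
        filter_upwards [ae_comp_sub (H.toAE_add_ae x y) t] with s hs
        rw [hs, _root_.map_add]
      map_smul' := fun c x => by
        rw [RingHom.id_apply, ← integral_smul]
        refine integral_congr_ae ?_
        filter_upwards [ae_comp_sub (H.toAE_smul_ae c x) t] with s hs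
        rw [hs, map_smul] } (c * H.const) fun x => by
    refine (norm_integral_le_integral_norm _).trans ?_
    rw [mul_assoc]
    refine le_trans ?_ (mul_le_mul_of_nonneg_left (H.integral_wt_mul_norm_le x t) hk.nonneg)
    rw [← integral_const_mul]
    refine integral_mono (hk.integrable x t).norm
      ((H.integrable_wt_mul_norm x t).const_mul c) fun s => ?_
    rw [← mul_assoc]
    exact ((k s).le_opNorm _).trans (mul_le_mul_of_nonneg_right (hk.bound s) (norm_nonneg _))

theorem evalConv_apply {k : ℝ → X →L[ℂ] X} {c : ℝ} (hk : QuadDecay k c) (t : ℝ) (x : F) :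
    evalConv H hk t x = ∫ s, k s (H.toAE x (t - s)) := rfl

theorem norm_evalConv_le {k : ℝ → X →L[ℂ] X} {c : ℝ} (hk : QuadDecay k c) (t : ℝ) :
    ‖evalConv H hk t‖ ≤ c * H.const :=
  LinearMap.mkContinuous_norm_le _ (mul_nonneg hk.nonneg H.const_nonneg) _

end Weighted

/-! ### Convolution operators on homogeneous spaces -/

section OpConv

variable {X : Type*} [NormedAddCommGroup X] [NormedSpace ℂ X]
variable {F : Type*} [NormedAddCommGroup F] [NormedSpace ℂ F] (H : HomogeneousSpace X F)

variable {H} in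
theorem HomogeneousSpace.ext {x y : F} (h : H.toAE x =ᵐ[volume] H.toAE y) : x = y :=
  H.injective (AEEqFun.ext h)

open Classical in
/-- The convolution of an operator function with `x ∈ F`, as an element of `F`. -/
def opConv (K : ℝ → X →L[ℂ] X) (x : F) : F :=
  if h : ∃ y : F, H.toAE y =ᵐ[volume] (fun t => ∫ s, K s (H.toAE x (t - s))) then
    Classical.choose h else 0

theorem opConv_eq {K : ℝ → X →L[ℂ] X} {x y : F}
    (h : H.toAE y =ᵐ[volume] (fun t => ∫ s, K s (H.toAE x (t - s)))) : opConv H K x = y := by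
  have h' : ∃ y : F, H.toAE y =ᵐ[volume] (fun t => ∫ s, K s (H.toAE x (t - s))) := ⟨y, h⟩
  unfold opConv
  rw [dif_pos h']
  exact HomogeneousSpace.ext ((Classical.choose_spec h').trans h.symm)

theorem isMajorant_norm {K : ℝ → X →L[ℂ] X} (hK : Integrable K) :
    IsMajorant K fun s => ‖K s‖ :=
  ⟨hK.norm, Eventually.of_forall fun _ => le_rfl⟩

theorem memL1s_of_integrable {K : ℝ → X →L[ℂ] X} (hK : Integrable K) : MemL1s K :=
  ⟨fun _ => aestronglyMeasurable_apply hK.aestronglyMeasurable aestronglyMeasurable_const,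
    _, isMajorant_norm hK⟩

theorem opConv_spec {K : ℝ → X →L[ℂ] X} (hK : Integrable K) (x : F) :
    H.toAE (opConv H K x) =ᵐ[volume] (fun t => ∫ s, K s (H.toAE x (t - s))) := by
  obtain ⟨y, hy, -⟩ := H.convolve _ x (memL1s_of_integrable hK)
  rwa [opConv_eq H hy]

theorem norm_opConv_le {K : ℝ → X →L[ℂ] X} (hK : Integrable K) (x : F) :
    ‖opConv H K x‖ ≤ (∫ s, ‖K s‖) * ‖x‖ := by
  obtain ⟨y, hy, hle⟩ := H.convolve _ x (memL1s_of_integrable hK)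
  rw [opConv_eq H hy]
  refine hle.trans (mul_le_mul_of_nonneg_right (csInf_le ⟨0, ?_⟩ ⟨_, isMajorant_norm hK, by simp⟩)
    (norm_nonneg _))
  rintro c ⟨g, -, rfl⟩
  exact integral_nonneg fun s => norm_nonneg _

theorem conv_eq_opConv {f : ℝ → ℂ} (hf : Integrable f) (x : F) :
    conv H f x = opConv H (fun s => f s • (1 : X →L[ℂ] X)) x := by
  refine (opConv_eq H ?_).symm
  refine (conv_spec H hf x).trans (Eventually.of_forall fun t => ?_)
  simp

/-- Convolution with an integrable operator function of quadratic decay, as a bounded operator. -/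
def opConvL {K : ℝ → X →L[ℂ] X} {c : ℝ} (hd : QuadDecay K c) (hK : Integrable K) : F →L[ℂ] F :=
  LinearMap.mkContinuous
    { toFun := opConv H K
      map_add' := fun x y => by
        apply opConv_eq
        filter_upwards [opConv_spec H hK x, opConv_spec H hK y,
          H.toAE_add_ae (opConv H K x) (opConv H K y)] with t h1 h2 h3
        rw [h3, h1, h2, ← evalConv_apply H hd, ← evalConv_apply H hd, ← evalConv_apply H hd,
          _root_.map_add]
      map_smul' := fun c x => by
        apply opConv_eq
        filter_upwards [opConv_spec H hK x, H.toAE_smul_ae c (opConv H K x)] with t h1 h3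
        rw [RingHom.id_apply, h3, h1, ← evalConv_apply H hd, ← evalConv_apply H hd, map_smul] }
    (∫ s, ‖K s‖) (norm_opConv_le H hK)

theorem toAE_opConv_ae {K : ℝ → X →L[ℂ] X} {c : ℝ} (hd : QuadDecay K c) (hK : Integrable K)
    (x : F) : H.toAE (opConv H K x) =ᵐ[volume] fun t => evalConv H hd t x :=
  opConv_spec H hK x

/-- Associativity of convolution although `x` is not integrable: quadratic decay of `L` and the
Stepanov bound make `‖L‖ * ‖x‖` uniformly bounded, so Fubini applies at every `t`. -/
theorem integral_mul_apply_comp {K L : ℝ → X →L[ℂ] X} {c : ℝ} [CompleteSpace X]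
    (hK : Integrable K) (hL : QuadDecay L c) (hLm : AEStronglyMeasurable L volume) (x : F) (t : ℝ) :
    ∫ q, (∫ s, K s * L (q - s)) (H.toAE x (t - q)) =
      ∫ s, K s (∫ r, L r (H.toAE x (t - s - r))) := by
  have hLi : Integrable L := integrable_of_le_wt hLm hL.bound
  have hx := H.aestronglyMeasurable x
  have hnL : ∀ t, Integrable fun r => ‖L r‖ * ‖H.toAE x (t - r)‖ := fun t => by
    refine ((H.integrable_wt_mul_norm x t).const_mul c).mono'
      (hLm.norm.mul (aestronglyMeasurable_comp_sub hx t).norm) (Eventually.of_forall fun s => ?_)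
    rw [norm_mul, norm_norm, norm_norm, ← mul_assoc]
    exact mul_le_mul_of_nonneg_right (hL.bound s) (norm_nonneg _)
  have hle : ∀ t, ∫ r, ‖L r‖ * ‖H.toAE x (t - r)‖ ≤ c * (H.const * ‖x‖) := fun t => by
    refine le_trans ?_ (mul_le_mul_of_nonneg_left (H.integral_wt_mul_norm_le x t) hL.nonneg)
    rw [← integral_const_mul]
    refine integral_mono (hnL t) ((H.integrable_wt_mul_norm x t).const_mul c) fun s => ?_
    rw [← mul_assoc]
    exact mul_le_mul_of_nonneg_right (hL.bound s) (norm_nonneg _)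
  refine convolution_assoc (𝕜 := ℂ) (μ := volume) (ν := volume) (f := K) (g := L) (k := H.toAE x)
    (ContinuousLinearMap.mul ℂ (X →L[ℂ] X)) (ContinuousLinearMap.id ℂ (X →L[ℂ] X))
    (ContinuousLinearMap.id ℂ (X →L[ℂ] X)) (ContinuousLinearMap.id ℂ (X →L[ℂ] X))
    (fun _ _ _ => rfl) hK.aestronglyMeasurable hLm hx
    (hK.ae_convolution_exists (ContinuousLinearMap.mul ℂ (X →L[ℂ] X)) hLi)
    (Eventually.of_forall fun t => hnL t) ?_
  have hm : AEStronglyMeasurable (convolution (fun x => ‖L x‖) (fun s => ‖H.toAE x s‖)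
      (ContinuousLinearMap.mul ℝ ℝ) volume) volume := by
    have h2 := (hLm.norm).convolution_integrand (ContinuousLinearMap.mul ℝ ℝ) hx.norm
      (μ := volume) (ν := volume)
    exact h2.integral_prod_right'
  refine (hK.norm.mul_const (c * (H.const * ‖x‖))).mono'
    (hK.aestronglyMeasurable.norm.mul (aestronglyMeasurable_comp_sub hm t))
    (Eventually.of_forall fun s => ?_)
  dsimp only [ContinuousLinearMap.mul_apply']
  rw [norm_mul, norm_norm]
  refine mul_le_mul_of_nonneg_left ?_ (norm_nonneg _)
  rw [Real.norm_of_nonneg]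
  · exact hle (t - s)
  · exact integral_nonneg fun r => mul_nonneg (norm_nonneg _) (norm_nonneg _)

theorem opConv_opConv {K L : ℝ → X →L[ℂ] X} {c : ℝ} [CompleteSpace X]
    (hK : Integrable K) (hL : QuadDecay L c) (hLm : AEStronglyMeasurable L volume) (x : F) :
    opConv H (fun q => ∫ s, K s * L (q - s)) x = opConv H K (opConv H L x) := by
  apply opConv_eq
  refine (opConv_spec H hK _).trans (Eventually.of_forall fun t => ?_)
  dsimp only
  rw [integral_mul_apply_comp H hK hL hLm]
  refine integral_congr_ae ?_
  filter_upwards [ae_comp_sub (opConv_spec H (integrable_of_le_wt hLm hL.bound) x) t] with s hs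
  rw [hs]

end OpConv

/-! ### Inverse Fourier transforms of operator symbols -/

section Kernel

variable {E : Type*} [NormedAddCommGroup E] [NormedSpace ℂ E]

theorem norm_cexp_I_mul_mul (ξ t : ℝ) : ‖Complex.exp (Complex.I * ξ * t)‖ = 1 := by
  rw [show Complex.I * ξ * t = ((ξ * t : ℝ) : ℂ) * Complex.I by push_cast; ring,
    Complex.norm_exp_ofReal_mul_I]

/-- The inverse Fourier transform `t ↦ (2π)⁻¹ ∫ e^{iξt} f(ξ) dξ`. -/
def kernel (f : ℝ → E) (t : ℝ) : E :=
  (2 * Real.pi : ℂ)⁻¹ • ∫ ξ : ℝ, Complex.exp (Complex.I * ξ * t) • f ξ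

theorem integrable_cexp_smul {f : ℝ → E} (hf : Integrable f) (t : ℝ) :
    Integrable fun ξ : ℝ => Complex.exp (Complex.I * ξ * t) • f ξ := by
  refine hf.norm.mono' ?_ (Eventually.of_forall fun ξ => ?_)
  · have : Continuous fun ξ : ℝ => Complex.exp (Complex.I * ξ * t) := by fun_prop
    exact this.aestronglyMeasurable.smul hf.aestronglyMeasurable
  · rw [norm_smul, norm_cexp_I_mul_mul, one_mul]

theorem continuous_kernel {f : ℝ → E} (hf : Integrable f) : Continuous (kernel f) := by
  refine Continuous.const_smul ?_ _
  refine continuous_of_dominated (bound := fun ξ => ‖f ξ‖)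
    (fun t => (integrable_cexp_smul hf t).aestronglyMeasurable) (fun t => ?_) hf.norm ?_
  · exact Eventually.of_forall fun ξ => by rw [norm_smul, norm_cexp_I_mul_mul, one_mul]
  · exact Eventually.of_forall fun ξ => by fun_prop

theorem integrable_fun_add {E : Type*} [NormedAddCommGroup E] {f g : ℝ → E} (hf : Integrable f)
    (hg : Integrable g) : Integrable fun ξ => f ξ + g ξ := hf.add hg

theorem kernel_add {f g : ℝ → E} (hf : Integrable f) (hg : Integrable g) (t : ℝ) :
    kernel (fun ξ => f ξ + g ξ) t = kernel f t + kernel g t := by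
  unfold kernel
  simp only [smul_add]
  rw [integral_add (integrable_cexp_smul hf t) (integrable_cexp_smul hg t), smul_add]

theorem kernel_comp_div (f : ℝ → E) {N : ℝ} (hN : 0 < N) (t : ℝ) :
    kernel (fun ξ => f (ξ / N)) t = (N : ℂ) • kernel f (N * t) := by
  unfold kernel
  have h := Measure.integral_comp_div (fun ξ : ℝ =>
    Complex.exp (Complex.I * ξ * (N * t : ℝ)) • f ξ) N
  have h' : ∫ ξ : ℝ, Complex.exp (Complex.I * ξ * t) • f (ξ / N) =
      ∫ ξ : ℝ, Complex.exp (Complex.I * (ξ / N : ℝ) * (N * t : ℝ)) • f (ξ / N) := by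
    congr 1
    funext ξ
    have : (N : ℂ) ≠ 0 := by exact_mod_cast hN.ne'
    congr 2
    push_cast
    field_simp
  rw [h', h, abs_of_pos hN, smul_comm]
  rfl

theorem fourier_eq_kernel (f : ℝ → E) (w : ℝ) :
    FourierTransform.fourier f w = (2 * Real.pi : ℂ) • kernel f (-2 * Real.pi * w) := by
  have hpi : (2 * Real.pi : ℂ) ≠ 0 := by
    exact_mod_cast (mul_pos two_pos Real.pi_pos).ne'
  rw [Real.fourier_real_eq_integral_exp_smul, kernel, smul_inv_smul₀ hpi]
  congr 1
  funext ξ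
  congr 2
  push_cast
  ring

/-- Fourier inversion. -/
theorem integral_cexp_smul_kernel [CompleteSpace E] {f : ℝ → E} (hc : Continuous f)
    (hf : Integrable f) (hk : Integrable (kernel f)) (ξ : ℝ) :
    ∫ t : ℝ, Complex.exp (-(Complex.I * ξ * t)) • kernel f t = f ξ := by
  have hpi := Real.pi_pos
  have hpi' : (2 * Real.pi : ℂ) ≠ 0 := by exact_mod_cast (mul_pos two_pos hpi).ne'
  have hF : Integrable (FourierTransform.fourier f) := by
    have : FourierTransform.fourier f = fun w =>
        (2 * Real.pi : ℂ) • kernel f (-2 * Real.pi * w) := funext (fourier_eq_kernel f)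
    rw [this]
    exact (hk.comp_mul_left' (by simp [hpi.ne'])).smul _
  have h := congrFun (hc.fourierInv_fourier_eq hf hF) ξ
  rw [← h, Real.fourierInv_eq_fourier_neg, Real.fourier_real_eq_integral_exp_smul]
  have h2 := Measure.integral_comp_mul_left (fun t : ℝ =>
    Complex.exp (-(Complex.I * ξ * t)) • kernel f t) (-2 * Real.pi)
  have h3 : |(-2 * Real.pi)⁻¹| = (2 * Real.pi)⁻¹ := by
    rw [abs_inv, abs_mul, abs_of_pos hpi]; simp
  rw [h3] at h2
  have h4 : ∫ v : ℝ, Complex.exp ((-2 * Real.pi * v * -ξ : ℝ) * Complex.I) •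
      FourierTransform.fourier f v = (2 * Real.pi : ℂ) •
      ∫ x : ℝ, Complex.exp (-(Complex.I * ξ * (-2 * Real.pi * x : ℝ))) •
        kernel f (-2 * Real.pi * x) := by
    rw [← integral_smul]
    congr 1
    funext v
    rw [fourier_eq_kernel, smul_comm]
    congr 3
    push_cast
    ring
  rw [h4, h2, ← Complex.coe_smul, smul_smul]
  push_cast
  rw [mul_inv_cancel₀ hpi', one_smul]

/-- The convolution of inverse Fourier transforms is the inverse Fourier transform of the
product. -/
theorem integral_kernel_mul_kernel {A : Type*} [NormedRing A] [NormedAlgebra ℂ A]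
    [CompleteSpace A] {f g : ℝ → A} (hc : Continuous f) (hf : Integrable f)
    (hk : Integrable (kernel f)) (hg : Integrable g) (q : ℝ) :
    ∫ s, kernel f s * kernel g (q - s) = kernel (fun ξ => f ξ * g ξ) q := by
  have hint : Integrable (Function.uncurry fun s ξ : ℝ =>
      Complex.exp (Complex.I * ξ * (q - s : ℝ)) • (kernel f s * g ξ)) (volume.prod volume) := by
    have h1 : Integrable (fun p : ℝ × ℝ => kernel f p.1 * g p.2) (volume.prod volume) :=
      hk.mul_prod hg
    refine h1.norm.mono' ?_ (Eventually.of_forall fun p => ?_)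
    · have : Continuous fun p : ℝ × ℝ => Complex.exp (Complex.I * p.2 * (q - p.1 : ℝ)) := by
        fun_prop
      exact this.aestronglyMeasurable.smul h1.aestronglyMeasurable
    · simp only [Function.uncurry]
      rw [norm_smul, norm_cexp_I_mul_mul, one_mul]
  calc ∫ s, kernel f s * kernel g (q - s)
      = ∫ s : ℝ, (2 * Real.pi : ℂ)⁻¹ • ∫ ξ : ℝ,
          Complex.exp (Complex.I * ξ * (q - s : ℝ)) • (kernel f s * g ξ) := by
        congr 1
        funext s
        rw [kernel.eq_def g, mul_smul_comm, ← integral_const_mul_of_integrable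
          (integrable_cexp_smul hg _)]
        simp only [mul_smul_comm]
    _ = (2 * Real.pi : ℂ)⁻¹ • ∫ ξ : ℝ, ∫ s : ℝ,
          Complex.exp (Complex.I * ξ * (q - s : ℝ)) • (kernel f s * g ξ) := by
        rw [integral_smul, integral_integral_swap hint]
    _ = kernel (fun ξ => f ξ * g ξ) q := by
        rw [kernel]
        congr 2
        funext ξ
        -- Inversion is needed for `f` only; nothing beyond integrability is used of `g`.
        rw [← integral_cexp_smul_kernel hc hf hk ξ]
        have hi : Integrable fun s : ℝ => Complex.exp (-(Complex.I * ξ * s)) • kernel f s := by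
          have := integrable_cexp_smul hk (-ξ)
          refine this.congr (Eventually.of_forall fun s => ?_)
          dsimp only
          congr 2
          push_cast
          ring
        rw [← integral_mul_const_of_integrable hi, ← integral_smul]
        congr 1
        funext s
        rw [smul_mul_assoc, smul_smul, ← Complex.exp_add]
        congr 2
        push_cast
        ring

end Kernel

/-! ### Symbols -/

section Symbols

variable {X : Type*} [NormedAddCommGroup X] [NormedSpace ℂ X]

/-- Continuous integrable operator functions whose inverse Fourier transform decays
quadratically. -/
structure IsSymbol (f : ℝ → X →L[ℂ] X) (c : ℝ) : Prop where
  cont : Continuous f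
  integrable : Integrable f
  bound : ∀ t, ‖kernel f t‖ ≤ c * wt t

variable {f g : ℝ → X →L[ℂ] X} {c d : ℝ}

theorem IsSymbol.continuous_kernel (hf : IsSymbol f c) : Continuous (kernel f) :=
  AbstractParabolic.continuous_kernel hf.integrable

theorem IsSymbol.quadDecay (hf : IsSymbol f c) : QuadDecay (kernel f) c :=
  QuadDecay.of_continuous hf.continuous_kernel hf.bound

theorem IsSymbol.integrable_kernel (hf : IsSymbol f c) : Integrable (kernel f) :=
  integrable_of_le_wt hf.continuous_kernel.aestronglyMeasurable hf.bound

theorem IsSymbol.add (hf : IsSymbol f c) (hg : IsSymbol g d) :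
    IsSymbol (fun ξ => f ξ + g ξ) (c + d) :=
  ⟨hf.cont.add hg.cont, integrable_fun_add hf.integrable hg.integrable, fun t => by
    rw [kernel_add hf.integrable hg.integrable, add_mul]
    exact (norm_add_le _ _).trans (add_le_add (hf.bound t) (hg.bound t))⟩

/-- The kernel becomes `N k(N t)`, and `wt (N t) ≤ wt t` for `N ≥ 1`. The dilated triangle produces
the Fejér kernels. -/
theorem IsSymbol.comp_div (hf : IsSymbol f c) {N : ℝ} (hN : 1 ≤ N) :
    IsSymbol (fun ξ => f (ξ / N)) (N * c) := by
  have hN0 : 0 < N := by linarith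
  refine ⟨hf.cont.comp (continuous_id.div_const N), hf.integrable.comp_div hN0.ne', fun t => ?_⟩
  rw [kernel_comp_div f hN0, norm_smul, Complex.norm_real, Real.norm_of_nonneg hN0.le, mul_assoc]
  refine mul_le_mul_of_nonneg_left ((hf.bound _).trans ?_) hN0.le
  refine mul_le_mul_of_nonneg_left ?_ hf.quadDecay.nonneg
  unfold wt
  refine inv_anti₀ (by positivity) ?_
  rw [mul_pow]
  nlinarith [sq_nonneg t, mul_nonneg (sq_nonneg t) (show 0 ≤ N ^ 2 - 1 by nlinarith)]

variable {F : Type*} [NormedAddCommGroup F] [NormedSpace ℂ F] (H : HomogeneousSpace X F)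

/-- Reduces identities between multipliers on `F` to pointwise identities between symbols. -/
theorem IsSymbol.opConv_opConv [CompleteSpace X] (hf : IsSymbol f c) (hg : IsSymbol g d) (x : F) :
    opConv H (kernel f) (opConv H (kernel g) x) = opConv H (kernel fun ξ => f ξ * g ξ) x := by
  rw [← AbstractParabolic.opConv_opConv H hf.integrable_kernel hg.quadDecay
    hg.continuous_kernel.aestronglyMeasurable]
  congr 1
  funext q
  exact integral_kernel_mul_kernel hf.cont hf.integrable hf.integrable_kernel hg.integrable q

/-- The Fourier multiplier with symbol `f`, as a bounded operator on `F`. -/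
def IsSymbol.opL (hf : IsSymbol f c) : F →L[ℂ] F := opConvL H hf.quadDecay hf.integrable_kernel

theorem IsSymbol.opL_apply (hf : IsSymbol f c) (x : F) : hf.opL H x = opConv H (kernel f) x := rfl

/-- The continuous representative of the action of a Fourier multiplier. -/
def IsSymbol.evalL (hf : IsSymbol f c) (t : ℝ) : F →L[ℂ] X := evalConv H hf.quadDecay t

theorem IsSymbol.evalL_apply (hf : IsSymbol f c) (t : ℝ) (x : F) :
    hf.evalL H t x = ∫ s, kernel f s (H.toAE x (t - s)) := rfl

theorem IsSymbol.norm_evalL_le (hf : IsSymbol f c) (t : ℝ) : ‖hf.evalL H t‖ ≤ c * H.const :=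
  norm_evalConv_le H _ t

theorem IsSymbol.toAE_opConv (hf : IsSymbol f c) (x : F) :
    H.toAE (opConv H (kernel f) x) =ᵐ[volume] fun t => hf.evalL H t x :=
  toAE_opConv_ae H hf.quadDecay hf.integrable_kernel x

theorem IsSymbol.opL_add {f g : ℝ → X →L[ℂ] X} {c d : ℝ} (hf : IsSymbol f c) (hg : IsSymbol g d)
    (x : F) : (hf.add hg).opL H x = hf.opL H x + hg.opL H x := by
  apply opConv_eq
  filter_upwards [hf.toAE_opConv H x, hg.toAE_opConv H x,
    H.toAE_add_ae (hf.opL H x) (hg.opL H x)] with t h1 h2 h3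
  rw [h3, IsSymbol.opL_apply, IsSymbol.opL_apply, h1, h2, IsSymbol.evalL_apply,
    IsSymbol.evalL_apply, ← integral_add (hf.quadDecay.integrable x t)
      (hg.quadDecay.integrable x t)]
  congr 1
  funext s
  rw [kernel_add hf.integrable hg.integrable]
  rfl

end Symbols

/-! ### Triangular symbols -/

theorem triangle_of_nonpos {ξ : ℝ} (h0 : ξ ≤ 0) (h1 : -1 ≤ ξ) : triangle ξ = 1 + ξ := by
  rw [triangle, abs_of_nonpos h0, max_eq_left (by linarith)]
  ring

theorem triangle_of_nonneg {ξ : ℝ} (h0 : 0 ≤ ξ) (h1 : ξ ≤ 1) : triangle ξ = 1 - ξ := by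
  rw [triangle, abs_of_nonneg h0, max_eq_left (by linarith)]

theorem triangle_eq_zero {ξ : ℝ} (h : 1 ≤ |ξ|) : triangle ξ = 0 := max_eq_right (by linarith)

theorem continuous_triangle : Continuous triangle := by
  unfold triangle
  fun_prop

/-- `g` decaying quadratically has `L¹`-norm at most `2π √(c₀ c₂)`. -/
theorem integral_norm_le_sqrt {E : Type*} [NormedAddCommGroup E] {g : ℝ → E}
    (hg : AEStronglyMeasurable g volume) {c₀ c₂ : ℝ} (h₀ : 0 < c₀) (h₂ : 0 < c₂)
    (hg₀ : ∀ t, ‖g t‖ ≤ c₀) (hg₂ : ∀ t, t ^ 2 * ‖g t‖ ≤ c₂) :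
    ∫ t, ‖g t‖ ≤ 2 * Real.pi * √(c₀ * c₂) := by
  -- With this scale the two bounds add up to `‖g t‖ (1 + l² t²) ≤ 2 c₀`, and `∫ wt (l t) dt = π /
  -- l`.
  set l := √(c₀ / c₂) with hl
  have hlpos : 0 < l := Real.sqrt_pos.2 (by positivity)
  have hl2 : l ^ 2 = c₀ / c₂ := Real.sq_sqrt (by positivity)
  have hle : ∀ t, ‖g t‖ ≤ 2 * c₀ * wt (l * t) := by
    intro t
    unfold wt
    rw [← div_eq_mul_inv, le_div_iff₀ (by positivity), mul_pow, hl2]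
    have := mul_le_mul_of_nonneg_left (hg₂ t) (div_pos h₀ h₂).le
    rw [div_mul_cancel₀ _ h₂.ne'] at this
    nlinarith [hg₀ t]
  have hi : Integrable fun t => 2 * c₀ * wt (l * t) :=
    (integrable_wt.comp_mul_left' hlpos.ne').const_mul _
  refine (integral_mono (hi.mono' hg (Eventually.of_forall hle)).norm hi hle).trans (le_of_eq ?_)
  rw [integral_const_mul, Measure.integral_comp_mul_left, abs_of_pos (by positivity)]
  have : ∫ t, wt t = Real.pi := integral_univ_inv_one_add_sq
  have hs : √(c₀ * c₂) = c₀ * l⁻¹ := by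
    rw [eq_mul_inv_iff_mul_eq₀ hlpos.ne', hl, ← Real.sqrt_mul (by positivity),
      show c₀ * c₂ * (c₀ / c₂) = c₀ ^ 2 by field_simp, Real.sqrt_sq h₀.le]
  rw [this, hs, smul_eq_mul]
  ring

section Triangle

variable {E : Type*} [NormedAddCommGroup E] [NormedSpace ℂ E]

/-- The symbol `ξ ↦ triangle (ξ - a) S(ξ)`. -/
def tri (a : ℝ) (S : ℝ → E) (ξ : ℝ) : E := (triangle (ξ - a) : ℂ) • S ξ

theorem continuous_tri (a : ℝ) {S : ℝ → E} (hS : Continuous S) : Continuous (tri a S) := by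
  have : Continuous fun ξ : ℝ => (triangle (ξ - a) : ℂ) :=
    Complex.continuous_ofReal.comp (continuous_triangle.comp (continuous_id.sub continuous_const))
  exact this.smul hS

theorem tri_eq_zero {a ξ : ℝ} (S : ℝ → E) (h : 1 ≤ |ξ - a|) : tri a S ξ = 0 := by
  rw [tri, triangle_eq_zero h]; simp

theorem support_tri_subset (a : ℝ) (S : ℝ → E) :
    Function.support (tri a S) ⊆ Set.Ioc (a - 1) (a + 1) := by
  intro ξ hξ
  by_contra hn
  refine hξ (tri_eq_zero S ?_)
  by_contra hlt
  rw [not_le, abs_lt] at hlt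
  exact hn ⟨by linarith [hlt.1], by linarith [hlt.2]⟩

theorem integrable_tri (a : ℝ) {S : ℝ → E} (hS : Continuous S) : Integrable (tri a S) := by
  refine (continuous_tri a hS).integrable_of_hasCompactSupport ?_
  refine HasCompactSupport.of_support_subset_isCompact (isCompact_Icc (a := a - 1) (b := a + 1)) ?_
  exact (support_tri_subset a S).trans Set.Ioc_subset_Icc_self

variable {S S' S'' : ℝ → E}

/-- Two integrations by parts. -/
theorem sq_smul_integral_cexp_smul [CompleteSpace E] {f f' f'' : ℝ → E}
    (h1 : ∀ ξ, HasDerivAt f (f' ξ) ξ) (h2 : ∀ ξ, HasDerivAt f' (f'' ξ) ξ) (h3 : Continuous f'')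
    (t α β : ℝ) :
    ((t : ℂ) ^ 2) • ∫ ξ in α..β, Complex.exp (Complex.I * ξ * t) • f ξ =
      Complex.exp (Complex.I * β * t) • (f' β - (Complex.I * t) • f β) -
      Complex.exp (Complex.I * α * t) • (f' α - (Complex.I * t) • f α) -
      ∫ ξ in α..β, Complex.exp (Complex.I * ξ * t) • f'' ξ := by
  have hf : Continuous f := continuous_iff_continuousAt.2 fun ξ => (h1 ξ).continuousAt
  have hexp : ∀ ξ : ℝ, HasDerivAt (fun ξ : ℝ => Complex.exp (Complex.I * ξ * t))
      (Complex.exp (Complex.I * ξ * t) * (Complex.I * t)) ξ := fun ξ => by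
    have := (((hasDerivAt_id (ξ : ℂ)).const_mul Complex.I).mul_const (t : ℂ)).cexp.comp_ofReal
    simpa using this
  -- Both integrations by parts at once: the derivative of `e^{iξt} (f' - i t f)` is `e^{iξt} (f'' +
  -- t² f)`.
  have hd : ∀ ξ : ℝ, HasDerivAt
      (fun ξ : ℝ => Complex.exp (Complex.I * ξ * t) • (f' ξ - (Complex.I * t) • f ξ))
      (Complex.exp (Complex.I * ξ * t) • f'' ξ +
        ((t : ℂ) ^ 2) • (Complex.exp (Complex.I * ξ * t) • f ξ)) ξ := fun ξ => by
    refine ((hexp ξ).smul ((h2 ξ).sub ((h1 ξ).const_smul (Complex.I * t : ℂ)))).congr_deriv ?_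
    simp only [Pi.sub_apply, Pi.smul_apply]
    simp only [smul_sub, smul_smul]
    have e : Complex.exp (Complex.I * ξ * t) * (Complex.I * t) * (Complex.I * t) =
      -((t : ℂ) ^ 2 * Complex.exp (Complex.I * ξ * t)) := by
      linear_combination (Complex.exp (Complex.I * ξ * t) * t ^ 2) * Complex.I_sq
    rw [e, neg_smul]
    abel
  have hi1 : IntervalIntegrable (fun ξ : ℝ => Complex.exp (Complex.I * ξ * t) • f'' ξ)
      volume α β := Continuous.intervalIntegrable (by fun_prop) _ _
  have hi2 : IntervalIntegrable (fun ξ : ℝ => ((t : ℂ) ^ 2) •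
      (Complex.exp (Complex.I * ξ * t) • f ξ)) volume α β :=
    Continuous.intervalIntegrable (by fun_prop) _ _
  have := intervalIntegral.integral_eq_sub_of_hasDerivAt (a := α) (b := β) (fun ξ _ => hd ξ)
    (hi1.add hi2)
  rw [intervalIntegral.integral_add hi1 hi2, intervalIntegral.integral_smul] at this
  rw [← this]
  abel

theorem integral_cexp_smul_tri (a t : ℝ) (hS : Continuous S) :
    ∫ ξ : ℝ, Complex.exp (Complex.I * ξ * t) • tri a S ξ =
      (∫ ξ in (a - 1)..a, Complex.exp (Complex.I * ξ * t) • ((1 + ξ - a : ℝ) : ℂ) • S ξ) +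
      ∫ ξ in a..(a + 1), Complex.exp (Complex.I * ξ * t) • ((1 - ξ + a : ℝ) : ℂ) • S ξ := by
  have hT := continuous_tri a hS
  have hc : Continuous fun ξ : ℝ => Complex.exp (Complex.I * ξ * t) • tri a S ξ := by fun_prop
  rw [← intervalIntegral.integral_eq_integral_of_support_subset (a := a - 1) (b := a + 1),
    ← intervalIntegral.integral_add_adjacent_intervals (hc.intervalIntegrable (a - 1) a)
      (hc.intervalIntegrable a (a + 1))]
  · congr 1
    · refine intervalIntegral.integral_congr fun ξ hξ => ?_
      rw [Set.uIcc_of_le (by linarith)] at hξ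
      simp only [tri]
      rw [triangle_of_nonpos (by linarith [hξ.2]) (by linarith [hξ.1])]
      congr 3
      ring
    · refine intervalIntegral.integral_congr fun ξ hξ => ?_
      rw [Set.uIcc_of_le (by linarith)] at hξ
      simp only [tri]
      rw [triangle_of_nonneg (by linarith [hξ.1]) (by linarith [hξ.2])]
      congr 3
      ring
  · refine (Function.support_smul_subset_right _ _).trans (support_tri_subset a S)

theorem norm_two_pi_inv : ‖(2 * Real.pi : ℂ)⁻¹‖ = (2 * Real.pi)⁻¹ := by
  rw [norm_inv, norm_mul, Complex.norm_real, Real.norm_of_nonneg Real.pi_pos.le, Complex.norm_ofNat]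

/-- The triangle has integral one, each half contributing `1 / 2`. -/
theorem norm_kernel_tri_le (a t : ℝ) (hS : Continuous S) {M₀ : ℝ} (h₀ : ∀ ξ, ‖S ξ‖ ≤ M₀) :
    ‖kernel (tri a S) t‖ ≤ (2 * Real.pi)⁻¹ * M₀ := by
  rw [kernel, norm_smul, norm_two_pi_inv, integral_cexp_smul_tri a t hS]
  refine mul_le_mul_of_nonneg_left ?_ (by positivity)
  have h1 : ‖∫ ξ in (a - 1)..a, Complex.exp (Complex.I * ξ * t) • ((1 + ξ - a : ℝ) : ℂ) • S ξ‖ ≤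
      ∫ ξ in (a - 1)..a, (1 + ξ - a) * M₀ := by
    refine intervalIntegral.norm_integral_le_of_norm_le (by linarith)
      (Eventually.of_forall fun ξ hξ => ?_) (Continuous.intervalIntegrable (by fun_prop) _ _)
    rw [norm_smul, norm_cexp_I_mul_mul, one_mul, norm_smul, Complex.norm_real,
      Real.norm_of_nonneg (by linarith [hξ.1])]
    exact mul_le_mul_of_nonneg_left (h₀ ξ) (by linarith [hξ.1])
  have h2 : ‖∫ ξ in a..(a + 1), Complex.exp (Complex.I * ξ * t) • ((1 - ξ + a : ℝ) : ℂ) • S ξ‖ ≤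
      ∫ ξ in a..(a + 1), (1 - ξ + a) * M₀ := by
    refine intervalIntegral.norm_integral_le_of_norm_le (by linarith)
      (Eventually.of_forall fun ξ hξ => ?_) (Continuous.intervalIntegrable (by fun_prop) _ _)
    rw [norm_smul, norm_cexp_I_mul_mul, one_mul, norm_smul, Complex.norm_real,
      Real.norm_of_nonneg (by linarith [hξ.2])]
    exact mul_le_mul_of_nonneg_left (h₀ ξ) (by linarith [hξ.2])
  have e1 : ∫ ξ in (a - 1)..a, (1 + ξ - a) * M₀ = M₀ / 2 := by
    rw [intervalIntegral.integral_mul_const, intervalIntegral.integral_sub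
      (Continuous.intervalIntegrable (by fun_prop) _ _)
      (Continuous.intervalIntegrable (by fun_prop) _ _),
      intervalIntegral.integral_add
      (Continuous.intervalIntegrable (by fun_prop) _ _)
      (Continuous.intervalIntegrable (by fun_prop) _ _)]
    simp only [intervalIntegral.integral_const, integral_id, smul_eq_mul]
    ring
  have e2 : ∫ ξ in a..(a + 1), (1 - ξ + a) * M₀ = M₀ / 2 := by
    rw [intervalIntegral.integral_mul_const, intervalIntegral.integral_add
      (Continuous.intervalIntegrable (by fun_prop) _ _)
      (Continuous.intervalIntegrable (by fun_prop) _ _),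
      intervalIntegral.integral_sub
      (Continuous.intervalIntegrable (by fun_prop) _ _)
      (Continuous.intervalIntegrable (by fun_prop) _ _)]
    simp only [intervalIntegral.integral_const, integral_id, smul_eq_mul]
    ring
  rw [e1] at h1
  rw [e2] at h2
  refine (norm_add_le _ _).trans ?_
  linarith

/-- Integrate by parts twice on each half, where the cutoff is affine. The slope jumps `1, -2, 1` at
`a - 1, a, a + 1` leave boundary terms of total size `4 M₀`. Each half adds `2 M₁` from the product
rule and `M₂` from bounding the cutoff by `1`. -/
theorem sq_mul_norm_kernel_tri_le [CompleteSpace E] (a t : ℝ)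
    (h1 : ∀ ξ, HasDerivAt S (S' ξ) ξ) (h2 : ∀ ξ, HasDerivAt S' (S'' ξ) ξ) (h3 : Continuous S'')
    {M₀ M₁ M₂ : ℝ} (hM₀ : ∀ ξ, ‖S ξ‖ ≤ M₀) (hM₁ : ∀ ξ, ‖S' ξ‖ ≤ M₁) (hM₂ : ∀ ξ, ‖S'' ξ‖ ≤ M₂) :
    t ^ 2 * ‖kernel (tri a S) t‖ ≤ (2 * Real.pi)⁻¹ * (4 * M₀ + 4 * M₁ + 2 * M₂) := by
  have hS : Continuous S := continuous_iff_continuousAt.2 fun ξ => (h1 ξ).continuousAt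
  have hS' : Continuous S' := continuous_iff_continuousAt.2 fun ξ => (h2 ξ).continuousAt
  have hlin : ∀ (p q ξ : ℝ), HasDerivAt (fun ξ : ℝ => ((p + q * ξ : ℝ) : ℂ)) (q : ℂ) ξ :=
    fun p q ξ => by
      have := (((hasDerivAt_id ξ).const_mul q).const_add p).ofReal_comp
      simpa using this
  -- A general affine cutoff `p + q ξ`, to be used for both slopes `q = ±1`.
  have hparts : ∀ (p q α β : ℝ), _ := fun p q α β => sq_smul_integral_cexp_smul
    (f := fun ξ => ((p + q * ξ : ℝ) : ℂ) • S ξ)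
    (f' := fun ξ => ((p + q * ξ : ℝ) : ℂ) • S' ξ + (q : ℂ) • S ξ)
    (f'' := fun ξ => ((p + q * ξ : ℝ) : ℂ) • S'' ξ + (q : ℂ) • S' ξ + (q : ℂ) • S' ξ)
    (fun ξ => (hlin p q ξ).smul (h1 ξ))
    (fun ξ => ((hlin p q ξ).smul (h2 ξ)).add ((h1 ξ).const_smul (q : ℂ)))
    (by fun_prop) t α β
  have hA := hparts (1 - a) 1 (a - 1) a
  have hB := hparts (1 + a) (-1) a (a + 1)
  have hbound : ∀ (p q α β : ℝ), α + 1 = β → |q| = 1 → (∀ ξ ∈ Set.Ioc α β, |p + q * ξ| ≤ 1) →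
      ‖∫ ξ in α..β, Complex.exp (Complex.I * ξ * t) •
        (((p + q * ξ : ℝ) : ℂ) • S'' ξ + (q : ℂ) • S' ξ + (q : ℂ) • S' ξ)‖ ≤ M₂ + M₁ + M₁ := by
    intro p q α β hαβ hq hp
    have := intervalIntegral.norm_integral_le_of_norm_le_const (a := α) (b := β)
      (C := M₂ + M₁ + M₁) (f := fun ξ : ℝ => Complex.exp (Complex.I * ξ * t) •
        (((p + q * ξ : ℝ) : ℂ) • S'' ξ + (q : ℂ) • S' ξ + (q : ℂ) • S' ξ)) ?_
    · rwa [show β - α = 1 by linarith, abs_one, mul_one] at this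
    · intro ξ hξ
      rw [Set.uIoc_of_le (by linarith)] at hξ
      rw [norm_smul, norm_cexp_I_mul_mul, one_mul]
      have e1 : ‖((p + q * ξ : ℝ) : ℂ) • S'' ξ‖ ≤ M₂ := by
        rw [norm_smul, Complex.norm_real, Real.norm_eq_abs]
        exact (mul_le_of_le_one_left (norm_nonneg _) (hp ξ hξ)).trans (hM₂ ξ)
      have e2 : ‖(q : ℂ) • S' ξ‖ ≤ M₁ := by
        rw [norm_smul, Complex.norm_real, Real.norm_eq_abs, hq, one_mul]
        exact hM₁ ξ
      exact (norm_add₃_le).trans (add_le_add (add_le_add e1 e2) e2)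
  have hA' := hbound (1 - a) 1 (a - 1) a (by ring) (by simp) (fun ξ hξ => by
    rw [abs_le]; constructor <;> linarith [hξ.1, hξ.2])
  have hB' := hbound (1 + a) (-1) a (a + 1) (by ring) (by simp) (fun ξ hξ => by
    rw [abs_le]; constructor <;> linarith [hξ.1, hξ.2])
  set IA := ∫ ξ in (a - 1)..a, Complex.exp (Complex.I * ξ * t) •
    (((1 - a + 1 * ξ : ℝ) : ℂ) • S'' ξ + ((1 : ℝ) : ℂ) • S' ξ + ((1 : ℝ) : ℂ) • S' ξ) with hIA
  set IB := ∫ ξ in a..(a + 1), Complex.exp (Complex.I * ξ * t) •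
    (((1 + a + -1 * ξ : ℝ) : ℂ) • S'' ξ + ((-1 : ℝ) : ℂ) • S' ξ + ((-1 : ℝ) : ℂ) • S' ξ) with hIB
  have key : ((t : ℂ) ^ 2) • ∫ ξ : ℝ, Complex.exp (Complex.I * ξ * t) • tri a S ξ =
      (2 : ℂ) • Complex.exp (Complex.I * a * t) • S a -
      Complex.exp (Complex.I * (a - 1 : ℝ) * t) • S (a - 1) -
      Complex.exp (Complex.I * (a + 1 : ℝ) * t) • S (a + 1) - IA - IB := by
    rw [integral_cexp_smul_tri a t hS, smul_add]
    have e1 : ∀ ξ : ℝ, 1 + ξ - a = 1 - a + 1 * ξ := fun ξ => by ring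
    have e2 : ∀ ξ : ℝ, 1 - ξ + a = 1 + a + -1 * ξ := fun ξ => by ring
    simp only [e1, e2]
    rw [hA, hB, show 1 - a + 1 * (a - 1) = 0 by ring, show 1 + a + -1 * (a + 1) = 0 by ring,
      show 1 - a + 1 * a = 1 by ring, show 1 + a + -1 * a = 1 by ring]
    simp only [Complex.ofReal_zero, Complex.ofReal_one, Complex.ofReal_neg, zero_smul, smul_zero,
      one_smul, neg_smul, zero_add, sub_zero, two_smul, smul_add, smul_sub, smul_neg]
    abel
  have hn : ‖(2 : ℂ) • Complex.exp (Complex.I * a * t) • S a -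
      Complex.exp (Complex.I * (a - 1 : ℝ) * t) • S (a - 1) -
      Complex.exp (Complex.I * (a + 1 : ℝ) * t) • S (a + 1) - IA - IB‖ ≤
      4 * M₀ + 4 * M₁ + 2 * M₂ := by
    have n1 : ‖(2 : ℂ) • Complex.exp (Complex.I * a * t) • S a‖ ≤ 2 * M₀ := by
      rw [norm_smul, norm_smul, norm_cexp_I_mul_mul, one_mul, Complex.norm_ofNat]
      linarith [hM₀ a]
    have n2 : ∀ b : ℝ, ‖Complex.exp (Complex.I * b * t) • S b‖ ≤ M₀ := fun b => by
      rw [norm_smul, norm_cexp_I_mul_mul, one_mul]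
      exact hM₀ b
    refine (norm_sub_le _ _).trans ((add_le_add_left ((norm_sub_le _ _).trans
      (add_le_add_left ((norm_sub_le _ _).trans (add_le_add_left (norm_sub_le _ _) _)) _)) _).trans
      ?_)
    linarith [n2 (a - 1), n2 (a + 1)]
  rw [kernel, norm_smul, norm_two_pi_inv, mul_left_comm]
  refine mul_le_mul_of_nonneg_left ?_ (by positivity)
  rw [← key, norm_smul, norm_pow, Complex.norm_real, Real.norm_eq_abs, sq_abs] at hn
  exact hn

theorem norm_kernel_tri_le_wt [CompleteSpace E] (a t : ℝ)
    (h1 : ∀ ξ, HasDerivAt S (S' ξ) ξ) (h2 : ∀ ξ, HasDerivAt S' (S'' ξ) ξ) (h3 : Continuous S'')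
    {M₀ M₁ M₂ : ℝ} (hM₀ : ∀ ξ, ‖S ξ‖ ≤ M₀) (hM₁ : ∀ ξ, ‖S' ξ‖ ≤ M₁) (hM₂ : ∀ ξ, ‖S'' ξ‖ ≤ M₂) :
    ‖kernel (tri a S) t‖ ≤ (2 * Real.pi)⁻¹ * (5 * M₀ + 4 * M₁ + 2 * M₂) * wt t := by
  have hS : Continuous S := continuous_iff_continuousAt.2 fun ξ => (h1 ξ).continuousAt
  have e1 := norm_kernel_tri_le a t hS hM₀
  have e2 := sq_mul_norm_kernel_tri_le a t h1 h2 h3 hM₀ hM₁ hM₂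
  unfold wt
  rw [← div_eq_mul_inv, le_div_iff₀ (by positivity)]
  linarith

end Triangle

/-! ### Approximate identities in `L¹` -/

section Approx

open DomAddAct in
-- Continuity of translations in `L¹`, read off from the continuous action of the additive group on
-- `Lp`.
theorem tendsto_lintegral_enorm_sub_translate {f : ℝ → ℂ} (hf : Integrable f) :
    Tendsto (fun h : ℝ => ∫⁻ t, ‖f (t - h) - f t‖ₑ) (𝓝 0) (𝓝 0) := by
  have : Fact ((1 : ℝ≥0∞) ≤ 1) := ⟨le_rfl⟩
  have : Fact ((1 : ℝ≥0∞) ≠ ∞) := ⟨ENNReal.one_ne_top⟩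
  have hf' : MemLp f 1 volume := memLp_one_iff_integrable.2 hf
  set g : Lp ℂ 1 (volume : Measure ℝ) := hf'.toLp f with hg
  have hc : Continuous fun h : ℝ => (DomAddAct.mk (-h) +ᵥ g : Lp ℂ 1 (volume : Measure ℝ)) := by
    have : Continuous fun h : ℝ => DomAddAct.mk (-h) :=
      DomAddAct.continuous_mk.comp continuous_neg
    exact this.vadd continuous_const
  have h0 := hc.tendsto 0
  rw [tendsto_iff_edist_tendsto_0] at h0
  refine h0.congr fun h => ?_
  have e0 : DomAddAct.mk (-(0 : ℝ)) +ᵥ g = g := by simp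
  rw [e0, Lp.edist_def, eLpNorm_one_eq_lintegral_enorm]
  refine lintegral_congr_ae ?_
  have h1 : ⇑(DomAddAct.mk (-h) +ᵥ g) =ᵐ[volume] fun t => f (t - h) := by
    rw [hg, DomAddAct.mk_vadd_toLp]
    refine (MemLp.coeFn_toLp _).trans (Eventually.of_forall fun t => ?_)
    simp [sub_eq_neg_add]
  filter_upwards [h1, hf'.coeFn_toLp] with t h2 h3
  rw [Pi.sub_apply, h2, h3]

/-- `N k(N ·)`, `N → ∞`, is an approximate identity in `L¹` if `∫ k = 1`. -/
theorem tendsto_lintegral_sub_mollify {f k : ℝ → ℂ} (hf : Integrable f) (hk : Integrable k)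
    (hk1 : ∫ t, k t = 1) :
    Tendsto (fun N : ℕ => ∫⁻ q, ‖f q - ∫ s, f s * ((N : ℂ) * k (N * (q - s)))‖ₑ) atTop (𝓝 0) := by
  have hmeas : ∀ c : ℝ, AEStronglyMeasurable (fun p : ℝ × ℝ => f (p.1 - p.2 / c) - f p.1)
      (volume.prod volume) := by
    intro c
    refine AEStronglyMeasurable.sub ?_ hf.aestronglyMeasurable.comp_fst
    refine hf.aestronglyMeasurable.comp_quasiMeasurePreserving
      (f := fun p : ℝ × ℝ => p.1 - p.2 / c) ?_
    refine QuasiMeasurePreserving.prod_of_left (by fun_prop) (Eventually.of_forall fun y => ?_)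
    exact (measurePreserving_sub_right volume (y / c)).quasiMeasurePreserving
  have hmeas' : ∀ c : ℝ, AEMeasurable (fun p : ℝ × ℝ => ‖k p.2‖ₑ * ‖f (p.1 - p.2 / c) - f p.1‖ₑ)
      (volume.prod volume) := fun c =>
    (hk.aestronglyMeasurable.comp_snd).enorm.mul (hmeas c).enorm
  have hle : ∀ N : ℕ, 1 ≤ N → ∫⁻ q, ‖f q - ∫ s, f s * ((N : ℂ) * k (N * (q - s)))‖ₑ ≤
      ∫⁻ r, ‖k r‖ₑ * ∫⁻ t, ‖f (t - r / N) - f t‖ₑ := by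
    intro N hN
    have hN0 : (0 : ℝ) < N := by exact_mod_cast hN
    have hkN : Integrable fun s : ℝ => (N : ℂ) * k (N * s) :=
      (hk.comp_mul_left' hN0.ne').const_mul _
    have hsub : ∀ (G : ℝ → ℂ), ∫ s, (N : ℂ) * G (N * s) = ∫ r, G r := by
      intro G
      rw [integral_const_mul, Measure.integral_comp_mul_left, abs_of_pos (by positivity),
        Complex.real_smul, ← mul_assoc]
      push_cast
      rw [mul_inv_cancel₀ (by exact_mod_cast hN0.ne'), one_mul]
    have hae : ∀ᵐ q : ℝ, Integrable fun s => f s * ((N : ℂ) * k (N * (q - s))) := by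
      have := hf.ae_convolution_exists (ContinuousLinearMap.mul ℂ ℂ) hkN
      filter_upwards [this] with q hq
      simpa only [ConvolutionExistsAt, ContinuousLinearMap.mul_apply'] using hq
    calc ∫⁻ q, ‖f q - ∫ s, f s * ((N : ℂ) * k (N * (q - s)))‖ₑ
        ≤ ∫⁻ q, ∫⁻ r, ‖k r‖ₑ * ‖f (q - r / N) - f q‖ₑ := by
          refine lintegral_mono_ae ?_
          filter_upwards [hae] with q hq
          have hq1 : Integrable fun s => f (q - s) * ((N : ℂ) * k (N * s)) := by
            simpa using hq.comp_sub_left q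
          have e1 : ∫ s, f s * ((N : ℂ) * k (N * (q - s))) =
              ∫ s, f (q - s) * ((N : ℂ) * k (N * s)) := by
            rw [← integral_sub_left_eq_self _ volume q]
            simp
          have e2 : f q = ∫ s, f q * ((N : ℂ) * k (N * s)) := by
            rw [integral_const_mul, hsub, hk1, mul_one]
          -- As `∫ k = 1`, the error is an average, weighted by `k r`, of the increments of `f`
          -- under the shifts `r / N`. These tend to zero in `L¹` for each `r`.
          have e3 : f q - ∫ s, f s * ((N : ℂ) * k (N * (q - s))) =
              -∫ r, k r * (f (q - r / N) - f q) := by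
            rw [← hsub fun r => k r * (f (q - r / N) - f q), e1]
            nth_rewrite 1 [e2]
            rw [← neg_sub, ← integral_sub hq1 (hkN.const_mul _)]
            congr 2
            funext s
            rw [mul_div_cancel_left₀ _ hN0.ne']
            ring
          rw [e3, enorm_neg]
          refine (enorm_integral_le_lintegral_enorm _).trans (le_of_eq ?_)
          simp only [enorm_mul]
      _ = ∫⁻ r, ∫⁻ q, ‖k r‖ₑ * ‖f (q - r / N) - f q‖ₑ := lintegral_lintegral_swap (hmeas' N)
      _ = ∫⁻ r, ‖k r‖ₑ * ∫⁻ t, ‖f (t - r / N) - f t‖ₑ := by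
          simp only [lintegral_const_mul' _ _ enorm_ne_top]
  have hbd : ∀ h : ℝ, ∫⁻ t, ‖f (t - h) - f t‖ₑ ≤ 2 * ∫⁻ t, ‖f t‖ₑ := by
    intro h
    calc ∫⁻ t, ‖f (t - h) - f t‖ₑ ≤ ∫⁻ t, (‖f (t - h)‖ₑ + ‖f t‖ₑ) :=
          lintegral_mono fun t => enorm_sub_le
      _ = 2 * ∫⁻ t, ‖f t‖ₑ := by
          rw [lintegral_add_right' _ hf.aestronglyMeasurable.enorm,
            lintegral_sub_right_eq_self (fun t => ‖f t‖ₑ), two_mul]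
  have hlim : Tendsto (fun N : ℕ => ∫⁻ r, ‖k r‖ₑ * ∫⁻ t, ‖f (t - r / N) - f t‖ₑ) atTop
      (𝓝 (∫⁻ _ : ℝ, 0)) := by
    refine tendsto_lintegral_of_dominated_convergence' (fun r => ‖k r‖ₑ * (2 * ∫⁻ t, ‖f t‖ₑ))
      (fun N => ?_) (fun N => Eventually.of_forall fun r => ?_) ?_
      (Eventually.of_forall fun r => ?_)
    · exact hk.aestronglyMeasurable.enorm.mul (hmeas N).enorm.lintegral_prod_left'
    · dsimp only
      gcongr
      exact hbd _
    · rw [lintegral_mul_const' _ _ (ENNReal.mul_ne_top (by simp) hf.hasFiniteIntegral.ne)]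
      exact ENNReal.mul_ne_top hk.hasFiniteIntegral.ne
        (ENNReal.mul_ne_top (by simp) hf.hasFiniteIntegral.ne)
    · have h1 : Tendsto (fun N : ℕ => r / (N : ℝ)) atTop (𝓝 0) :=
        tendsto_const_div_atTop_nhds_zero_nat r
      have := ENNReal.Tendsto.const_mul ((tendsto_lintegral_enorm_sub_translate hf).comp h1)
        (Or.inr (enorm_ne_top (x := k r)))
      simpa using this
  rw [lintegral_zero] at hlim
  refine tendsto_of_tendsto_of_tendsto_of_le_of_le' tendsto_const_nhds hlim
    (Eventually.of_forall fun _ => zero_le) ?_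
  filter_upwards [eventually_ge_atTop 1] with N hN using hle N hN

end Approx

/-! ### The triangular partition of unity -/

/-- Only the triangles at `⌊μ⌋` and `⌊μ⌋ + 1` can be nonzero at `μ`; their values are `1 - (μ -
⌊μ⌋)` and `μ - ⌊μ⌋`. -/
theorem sum_triangle_sub_eq_one {p q : ℤ} {μ : ℝ} (hp : p ≤ μ) (hq : μ ≤ q) :
    ∑ k ∈ Finset.Icc p q, triangle (μ - k) = 1 := by
  have h1 := Int.floor_le μ
  have h2 := Int.lt_floor_add_one μ
  set m := ⌊μ⌋ with hm
  have hpm : p ≤ m := Int.le_floor.2 hp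
  have hmq : m ≤ q := by
    have : (m : ℝ) ≤ q := h1.trans hq
    exact_mod_cast this
  have hz : ∀ k : ℤ, k ≠ m → k ≠ m + 1 → triangle (μ - k) = 0 := by
    intro k hk hk'
    apply triangle_eq_zero
    rcases lt_or_gt_of_ne hk with h | h
    · have : (k : ℝ) + 1 ≤ m := by exact_mod_cast h
      rw [abs_of_nonneg] <;> linarith
    · have h3 : m + 2 ≤ k := by omega
      have : (m : ℝ) + 2 ≤ k := by exact_mod_cast h3
      rw [abs_of_nonpos] <;> linarith
  have e1 : triangle (μ - m) = 1 - (μ - m) := triangle_of_nonneg (by linarith) (by linarith)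
  have e2 : triangle (μ - (m + 1 : ℤ)) = μ - m := by
    rw [triangle_of_nonpos (by push_cast; linarith) (by push_cast; linarith)]
    push_cast
    ring
  by_cases hlt : m + 1 ≤ q
  · rw [Finset.sum_eq_add m (m + 1) (by omega) (fun k _ hk => hz k hk.1 hk.2)
      (fun h => absurd (Finset.mem_Icc.2 ⟨hpm, hmq⟩) h)
      (fun h => absurd (Finset.mem_Icc.2 ⟨by omega, hlt⟩) h), e1, e2]
    ring
  -- At the right end `μ = q` the second index is outside the range, but its triangle vanishes
  -- there.
  · have hmq' : m = q := by omega
    have hμ : μ = m := le_antisymm (by rw [hmq']; exact hq) h1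
    rw [Finset.sum_eq_single m (fun k hk hkm => hz k hkm ?_)
      (fun h => absurd (Finset.mem_Icc.2 ⟨hpm, hmq⟩) h), e1]
    · linarith
    · have := (Finset.mem_Icc.1 hk).2
      omega

/-! ### Smooth symbols cut off by triangles, and convolution with `φ_a`. -/

section

variable {X : Type*} [NormedAddCommGroup X] [NormedSpace ℂ X]

/-- Twice continuously differentiable operator functions, bounded with their derivatives. -/
structure SmoothSymbol (S S' S'' : ℝ → X →L[ℂ] X) (M₀ M₁ M₂ : ℝ) : Prop where
  deriv : ∀ ξ, HasDerivAt S (S' ξ) ξ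
  deriv' : ∀ ξ, HasDerivAt S' (S'' ξ) ξ
  cont : Continuous S''
  bound : ∀ ξ, ‖S ξ‖ ≤ M₀
  bound' : ∀ ξ, ‖S' ξ‖ ≤ M₁
  bound'' : ∀ ξ, ‖S'' ξ‖ ≤ M₂

/-- The constant of the quadratic decay of `kernel (tri a S)`. -/
def decayConst (M₀ M₁ M₂ : ℝ) : ℝ := (2 * Real.pi)⁻¹ * (5 * M₀ + 4 * M₁ + 2 * M₂)

variable {S S' S'' : ℝ → X →L[ℂ] X} {M₀ M₁ M₂ : ℝ}

theorem SmoothSymbol.continuous (h : SmoothSymbol S S' S'' M₀ M₁ M₂) : Continuous S :=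
  continuous_iff_continuousAt.2 fun ξ => (h.deriv ξ).continuousAt

theorem SmoothSymbol.isSymbol_tri [CompleteSpace X] (h : SmoothSymbol S S' S'' M₀ M₁ M₂) (a : ℝ) :
    IsSymbol (tri a S) (decayConst M₀ M₁ M₂) :=
  ⟨continuous_tri a h.continuous, integrable_tri a h.continuous, fun t =>
    norm_kernel_tri_le_wt a t h.deriv h.deriv' h.cont h.bound h.bound' h.bound''⟩

/-- Makes convolution with `φ_a` an instance of the general cut-off multiplier. -/
theorem smoothSymbol_one : SmoothSymbol (fun _ : ℝ => (1 : X →L[ℂ] X)) 0 0 1 0 0 :=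
  ⟨fun ξ => hasDerivAt_const ξ _, fun ξ => hasDerivAt_const ξ _, continuous_const,
    fun _ => ContinuousLinearMap.norm_id_le, fun _ => by simp, fun _ => by simp⟩

/-- The symbol of `φ_a`. -/
def triOne (X : Type*) [NormedAddCommGroup X] [NormedSpace ℂ X] (a : ℝ) : ℝ → X →L[ℂ] X :=
  tri a fun _ => 1

theorem isSymbol_triOne [CompleteSpace X] (a : ℝ) :
    IsSymbol (triOne X a) (decayConst 1 0 0) :=
  smoothSymbol_one.isSymbol_tri a

theorem kernel_triOne [CompleteSpace X] (a t : ℝ) : kernel (triOne X a) t = phi a t • (1 : X →L[ℂ] X) := by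
  by_cases hX : Nontrivial X
  · have h := integral_smul_const (μ := volume) (fun ξ : ℝ =>
      (triangle (ξ - a) : ℂ) * Complex.exp (Complex.I * ξ * t)) (1 : X →L[ℂ] X)
    rw [kernel, phi, mul_smul, ← h]
    congr 2
    funext ξ
    rw [triOne, tri, smul_smul, mul_comm]
  · have : Subsingleton X := not_nontrivial_iff_subsingleton.1 hX
    ext v
    exact Subsingleton.elim _ _

theorem kernel_tri_one (t : ℝ) : kernel (tri 0 fun _ => (1 : ℂ)) t = phi 0 t := by
  rw [kernel, phi, smul_eq_mul]
  congr 2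
  funext ξ
  simp [tri, mul_comm]

/-- Fourier inversion at frequency zero, where the triangle equals one. -/
theorem integral_phi_zero : ∫ t, phi 0 t = 1 := by
  have hc : Continuous fun _ : ℝ => (1 : ℂ) := continuous_const
  have hk : kernel (tri 0 fun _ => (1 : ℂ)) = phi 0 := funext kernel_tri_one
  have h := integral_cexp_smul_kernel (continuous_tri 0 hc) (integrable_tri 0 hc)
    (by rw [hk]; exact integrable_phi 0) 0
  rw [hk] at h
  simpa [tri, triangle] using h

/-- The cutoffs are scalar, so they can change places between the factors. -/
theorem tri_mul_tri_comm (a b : ℝ) (S : ℝ → X →L[ℂ] X) (ξ : ℝ) :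
    tri a S ξ * triOne X b ξ = tri b S ξ * triOne X a ξ := by
  simp only [triOne, tri, smul_mul_smul_comm, mul_comm]

theorem triOne_mul_tri (a b : ℝ) (S : ℝ → X →L[ℂ] X) (ξ : ℝ) :
    triOne X a ξ * tri b S ξ = tri a S ξ * triOne X b ξ := by
  simp only [triOne, tri, smul_mul_smul_comm, one_mul, mul_one]

variable {F : Type*} [NormedAddCommGroup F] [NormedSpace ℂ F] (H : HomogeneousSpace X F)

variable [CompleteSpace X]

theorem conv_phi (a : ℝ) (x : F) : conv H (phi a) x = opConv H (kernel (triOne X a)) x := by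
  rw [conv_eq_opConv H (integrable_phi a)]
  congr 1
  funext t
  exact (kernel_triOne a t).symm

/-- The operator of convolution with `φ_a`. -/
def phiL (a : ℝ) : F →L[ℂ] F := (isSymbol_triOne a).opL H

theorem phiL_apply (a : ℝ) (x : F) : phiL H a x = conv H (phi a) x := (conv_phi H a x).symm

theorem IsSymbol.opL_phiL {f : ℝ → X →L[ℂ] X} {c : ℝ} (hf : IsSymbol f c) (a : ℝ) (x : F) :
    hf.opL H (phiL H a x) = opConv H (kernel fun ξ => f ξ * triOne X a ξ) x :=
  hf.opConv_opConv H (isSymbol_triOne a) x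

theorem SmoothSymbol.opL_phiL_comm (h : SmoothSymbol S S' S'' M₀ M₁ M₂) (a b : ℝ) (x : F) :
    (h.isSymbol_tri a).opL H (phiL H b x) = (h.isSymbol_tri b).opL H (phiL H a x) := by
  rw [IsSymbol.opL_phiL, IsSymbol.opL_phiL]
  simp only [tri_mul_tri_comm a b]

/-- Moves the cutoff at `a` onto `S` and leaves `φ_b` on `x`, so that summation over `b` can
reassemble `x`. -/
theorem SmoothSymbol.phiL_opL (h : SmoothSymbol S S' S'' M₀ M₁ M₂) (a b : ℝ) (x : F) :
    phiL H a ((h.isSymbol_tri b).opL H x) = (h.isSymbol_tri a).opL H (phiL H b x) := by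
  rw [IsSymbol.opL_phiL]
  refine ((isSymbol_triOne a).opConv_opConv H (h.isSymbol_tri b) x).trans ?_
  simp only [triOne_mul_tri a b]

theorem opL_phiL_eq_zero {f : ℝ → X →L[ℂ] X} {c : ℝ} (hf : IsSymbol f c) (a : ℝ)
    (h : ∀ ξ, f ξ ≠ 0 → 1 ≤ |ξ - a|) (x : F) : hf.opL H (phiL H a x) = 0 := by
  rw [IsSymbol.opL_phiL]
  have : (fun ξ => f ξ * triOne X a ξ) = fun _ => 0 := by
    funext ξ
    by_cases hξ : f ξ = 0
    · rw [hξ, zero_mul]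
    · rw [triOne, tri_eq_zero _ (h ξ hξ), mul_zero]
  rw [this]
  apply opConv_eq
  have h0 := AEEqFun.coeFn_zero (α := ℝ) (β := X) (μ := volume)
  rw [_root_.map_zero]
  filter_upwards [h0] with t ht
  simp [ht, kernel]

/-- A finite piece of the partition of unity is itself a symbol, so it can be multiplied with
another symbol in one step. The value of `c` is immaterial. -/
theorem exists_isSymbol_sum_triOne (s : Finset ℤ) (b : ℤ → ℝ) :
    ∃ c, ∃ h : IsSymbol (fun ξ => ∑ k ∈ s, triOne X (b k) ξ) c,
      ∀ x : F, h.opL H x = ∑ k ∈ s, phiL H (b k) x := by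
  classical
  induction s using Finset.induction_on with
  | empty =>
    have hi : Integrable fun _ : ℝ => (0 : X →L[ℂ] X) :=
      integrable_zero ℝ (X →L[ℂ] X) volume
    refine ⟨0, ⟨by simpa using continuous_const, by simpa using hi, fun t => by simp [kernel]⟩,
      fun x => ?_⟩
    rw [Finset.sum_empty]
    apply opConv_eq
    have h0 := AEEqFun.coeFn_zero (α := ℝ) (β := X) (μ := volume)
    rw [_root_.map_zero]
    filter_upwards [h0] with t ht
    simp [ht, kernel]
  | insert k s hk ih =>
    obtain ⟨c, h, hx⟩ := ih
    simp only [Finset.sum_insert hk]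
    exact ⟨_, (isSymbol_triOne (b k)).add h, fun x => by
      rw [IsSymbol.opL_add H (isSymbol_triOne (b k)) h, hx]
      rfl⟩

/-- Decomposition of a Fourier multiplier whose symbol has compact support. -/
theorem IsSymbol.opL_eq_sum {f : ℝ → X →L[ℂ] X} {c : ℝ} (hf : IsSymbol f c) (a : ℝ) (p q : ℤ)
    (h : ∀ ξ, f ξ ≠ 0 → p ≤ ξ - a ∧ ξ - a ≤ q) (x : F) :
    hf.opL H x = ∑ k ∈ Finset.Icc p q, hf.opL H (phiL H (a + k) x) := by
  obtain ⟨d, hg, hx⟩ := exists_isSymbol_sum_triOne H (Finset.Icc p q) fun k => a + k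
  rw [← map_sum, ← hx]
  refine Eq.trans ?_ (hf.opConv_opConv H hg x).symm
  rw [IsSymbol.opL_apply]
  congr 2
  funext ξ
  by_cases hξ : f ξ = 0
  · rw [hξ, zero_mul]
  · have h1 := sum_triangle_sub_eq_one (h ξ hξ).1 (h ξ hξ).2
    have h2 : ∑ k ∈ Finset.Icc p q, triOne X (a + (k : ℝ)) ξ = 1 := by
      simp only [triOne, tri, ← sub_sub]
      rw [← Finset.sum_smul]
      norm_cast
      rw [h1]
      simp
    rw [h2, mul_one]

/-- On the support of the triangle at `a` three translates already sum to one. Exchanging cutoffs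
leaves only `φ_a * x` as the argument; this is the origin of the factor `3` in the final bound. -/
theorem SmoothSymbol.opL_tri_eq_sum (h : SmoothSymbol S S' S'' M₀ M₁ M₂) (a : ℝ) (x : F) :
    (h.isSymbol_tri a).opL H x =
      ∑ k ∈ Finset.Icc (-1 : ℤ) 1, (h.isSymbol_tri (a + k)).opL H (phiL H a x) := by
  rw [(h.isSymbol_tri a).opL_eq_sum H a (-1) 1 (fun ξ hξ => ?_)]
  · exact Finset.sum_congr rfl fun k _ => h.opL_phiL_comm H _ _ x
  · have := support_tri_subset a S hξ
    push_cast
    exact ⟨by linarith [this.1], by linarith [this.2]⟩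

/-- Elements of `F` with empty spectrum vanish. -/
theorem eq_zero_of_phiL_eq_zero (z : F) (h : ∀ n : ℤ, phiL H n z = 0) : z = 0 := by
  refine H.nondegenerate z fun f hf => ?_
  suffices hz : conv H f z = 0 by
    have := conv_spec H hf z
    rw [hz, _root_.map_zero] at this
    exact this.symm.trans (AEEqFun.coeFn_zero (α := ℝ) (β := X) (μ := volume))
  -- The triangle dilated by `N` lives on `[-N, N]`, where finitely many `φ_k` sum to one; each of
  -- them kills `z`.
  have hL : ∀ N : ℕ, 1 ≤ N →
      opConv H (kernel fun ξ => triOne X 0 (ξ / (N : ℝ))) z = 0 := by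
    intro N hN
    have hN' : (1 : ℝ) ≤ N := by exact_mod_cast hN
    have hs := (isSymbol_triOne (X := X) 0).comp_div hN'
    have := hs.opL_eq_sum H 0 (-N) N (fun ξ hξ => ?_) z
    · rw [← IsSymbol.opL_apply H hs, this]
      refine Finset.sum_eq_zero fun k _ => ?_
      rw [zero_add, h k, _root_.map_zero]
    · have h1 := support_tri_subset 0 (fun _ => (1 : X →L[ℂ] X)) hξ
      have hN0 : (0 : ℝ) < N := by linarith
      have h2 := h1.1.le
      have h3 := h1.2
      rw [le_div_iff₀ hN0] at h2
      rw [div_le_iff₀ hN0] at h3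
      push_cast
      constructor <;> linarith
  -- The Fejér mean of `f` annihilates `z`, so `f` may be replaced by its difference from that mean,
  -- which is small in `L¹`.
  have hbound : ∀ N : ℕ, 1 ≤ N → ‖conv H f z‖ₑ ≤
      (∫⁻ q, ‖f q - ∫ s, f s * ((N : ℂ) * phi 0 (N * (q - s)))‖ₑ) * ‖z‖ₑ := by
    intro N hN
    have hN' : (1 : ℝ) ≤ N := by exact_mod_cast hN
    have hs := (isSymbol_triOne (X := X) 0).comp_div hN'
    have hkN : Integrable fun s : ℝ => (N : ℂ) * phi 0 (N * s) :=
      ((integrable_phi 0).comp_mul_left' (by linarith : (N : ℝ) ≠ 0)).const_mul _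
    have hg : Integrable fun q : ℝ => ∫ s, f s * ((N : ℂ) * phi 0 (N * (q - s))) := by
      have := hf.integrable_convolution (ContinuousLinearMap.mul ℂ ℂ) hkN
      refine this.congr (Eventually.of_forall fun q => ?_)
      rw [convolution_def]
      simp only [ContinuousLinearMap.mul_apply']
    have hK : Integrable fun s => f s • (1 : X →L[ℂ] X) := hf.smul_const _
    have h0 : conv H (fun q : ℝ => ∫ s, f s * ((N : ℂ) * phi 0 (N * (q - s)))) z = 0 := by
      have h1 := AbstractParabolic.opConv_opConv H hK hs.quadDecay
        hs.continuous_kernel.aestronglyMeasurable z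
      rw [hL N hN] at h1
      have h2 : opConv H (fun s => f s • (1 : X →L[ℂ] X)) (0 : F) = 0 := by
        rw [← conv_eq_opConv H hf]
        simpa using conv_smul H hf 0 (0 : F)
      rw [h2] at h1
      rw [conv_eq_opConv H hg, ← h1]
      congr 1
      funext q
      refine (integral_smul_const (μ := volume)
        (fun s : ℝ => f s * ((N : ℂ) * phi 0 (N * (q - s)))) (1 : X →L[ℂ] X)).symm.trans ?_
      congr 1
      funext s
      rw [kernel_comp_div _ (by linarith), kernel_triOne, smul_mul_smul_comm, one_mul, smul_smul,
        mul_assoc, Complex.ofReal_natCast]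
    have h3 := norm_conv_le H (hf.sub hg) z
    have h4 : conv H (f - fun q : ℝ => ∫ s, f s * ((N : ℂ) * phi 0 (N * (q - s)))) z =
        conv H f z := by
      have := conv_sub_left H hf hg z
      rw [h0, sub_zero] at this
      exact this
    rw [h4] at h3
    have h5 := ENNReal.ofReal_le_ofReal h3
    rw [ofReal_norm, ENNReal.ofReal_mul (integral_nonneg fun _ => norm_nonneg _), ofReal_norm,
      ofReal_integral_norm_eq_lintegral_enorm (hf.sub hg)] at h5
    exact h5
  have hlim := ENNReal.Tendsto.mul_const
    (tendsto_lintegral_sub_mollify hf (integrable_phi 0) integral_phi_zero)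
    (Or.inr (enorm_ne_top (x := z)))
  rw [zero_mul] at hlim
  have : ‖conv H f z‖ₑ ≤ 0 := by
    refine ge_of_tendsto hlim ?_
    filter_upwards [eventually_ge_atTop 1] with N hN using hbound N hN
  simpa using this

end

/-! ### Spectral decomposition of absolutely summable functions -/

section Summable

variable {X : Type*} [NormedAddCommGroup X] [NormedSpace ℂ X] [CompleteSpace X]
variable {F : Type*} [NormedAddCommGroup F] [NormedSpace ℂ F] (H : HomogeneousSpace X F)

theorem norm_phiL_le (a : ℝ) (x : F) : ‖phiL H a x‖ ≤ 2 * Real.pi * ‖x‖ := by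
  rw [phiL_apply]
  refine (norm_conv_le H (integrable_phi a) x).trans
    (mul_le_mul_of_nonneg_right ?_ (norm_nonneg _))
  calc ∫ t, ‖phi a t‖ ≤ ∫ t : ℝ, 2 * (1 + t ^ 2)⁻¹ :=
        integral_mono (integrable_phi a).norm (integrable_inv_one_add_sq.const_mul 2)
          (norm_phi_le a)
    _ = 2 * Real.pi := by rw [integral_const_mul, integral_univ_inv_one_add_sq]

/-- For such `a` the support of the triangle at `n` lies in `[a - 2, a + 1]`, so the four cutoffs at
`a - 2, …, a + 1` recover `φ_n`. -/
theorem enorm_conv_phi_le (n : ℤ) (x : F) {a : ℝ} (ha : a ∈ Set.Ioc (n : ℝ) (n + 1)) :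
    ‖conv H (phi n) x‖ₑ ≤ ∑ k ∈ Finset.Icc (-2 : ℤ) 1,
      ENNReal.ofReal (2 * Real.pi) * ‖conv H (phi (a + k)) x‖ₑ := by
  have h := (isSymbol_triOne (X := X) n).opL_eq_sum H a (-2) 1 (fun ξ hξ => ?_) x
  · rw [← phiL_apply, phiL, h]
    refine (enorm_sum_le _ _).trans (Finset.sum_le_sum fun k _ => ?_)
    rw [← phiL_apply, ← ofReal_norm, ← ofReal_norm, ← ENNReal.ofReal_mul (by positivity)]
    exact ENNReal.ofReal_le_ofReal (norm_phiL_le H n _)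
  · have := support_tri_subset (n : ℝ) (fun _ => (1 : X →L[ℂ] X)) hξ
    push_cast
    constructor <;> linarith [this.1, this.2, ha.1, ha.2]

/-- Average the preceding bound over `a ∈ (n, n + 1]`; these intervals tile the line, so the sum
over `n` is controlled by the integral norm. -/
theorem asNorm_lt_top {x : F} (hx : asIntegralNorm H x < ∞) : asNorm H x < ∞ := by
  have hm : Measurable fun a => ‖conv H (phi a) x‖ₑ := (continuous_conv_phi H x).enorm.measurable
  set g : ℝ → ℝ≥0∞ := fun a => ∑ k ∈ Finset.Icc (-2 : ℤ) 1,
      ENNReal.ofReal (2 * Real.pi) * ‖conv H (phi (a + k)) x‖ₑ with hg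
  have hgi : ∫⁻ a, g a < ∞ := by
    have hk : ∀ k : ℤ, Measurable fun a : ℝ =>
        ENNReal.ofReal (2 * Real.pi) * ‖conv H (phi (a + k)) x‖ₑ := fun k =>
      (hm.comp (measurable_add_const (k : ℝ))).const_mul _
    simp only [hg]
    rw [lintegral_finsetSum _ fun k _ => hk k]
    refine ENNReal.sum_lt_top.2 fun k _ => ?_
    rw [lintegral_const_mul' _ _ ENNReal.ofReal_ne_top,
      lintegral_add_right_eq_self (fun a => ‖conv H (phi a) x‖ₑ)]
    exact ENNReal.mul_lt_top ENNReal.ofReal_lt_top hx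
  have hsum : ∑' n : ℤ, ‖conv H (phi n) x‖ₑ ≤ ∫⁻ a, g a := by
    rw [← setLIntegral_univ g, ← iUnion_Ioc_intCast ℝ,
      lintegral_iUnion (fun n => measurableSet_Ioc) (Set.pairwise_disjoint_Ioc_intCast ℝ)]
    refine ENNReal.tsum_le_tsum fun n => ?_
    calc ‖conv H (phi n) x‖ₑ = ∫⁻ _ in Set.Ioc (n : ℝ) (n + 1), ‖conv H (phi n) x‖ₑ := by simp
      _ ≤ _ := setLIntegral_mono' measurableSet_Ioc fun a ha => enorm_conv_phi_le H n x ha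
  exact ENNReal.mul_lt_top (by simp) (hsum.trans_lt hgi)

theorem summable_norm_phiL {x : F} (hx : asIntegralNorm H x < ∞) :
    Summable fun n : ℤ => ‖phiL H n x‖ := by
  have h := asNorm_lt_top H hx
  have h' : ∑' n : ℤ, ‖phiL H n x‖ₑ ≠ ∞ := by
    intro htop
    simp only [phiL_apply] at htop
    rw [asNorm, htop, ENNReal.mul_top (by simp)] at h
    exact lt_irrefl _ h
  have := ENNReal.summable_toReal h'
  simpa using this

/-- The series converges absolutely. Each `φ_m` sees only its terms `m - 1, m, m + 1`, which already
recover `φ_m * x`; hence `x` minus the sum has empty spectrum. -/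
theorem hasSum_phiL [CompleteSpace F] {x : F} (hx : asIntegralNorm H x < ∞) :
    HasSum (fun n : ℤ => phiL H n x) x := by
  have hs : Summable fun n : ℤ => phiL H n x := (summable_norm_phiL H hx).of_norm
  have : x - ∑' n : ℤ, phiL H n x = 0 := by
    refine eq_zero_of_phiL_eq_zero H _ fun m => ?_
    rw [map_sub, sub_eq_zero, (phiL H m).map_tsum hs]
    have h1 := (isSymbol_triOne (X := X) m).opL_eq_sum H 0 (m - 1) (m + 1) (fun ξ hξ => ?_) x
    · simp only [zero_add] at h1
      refine h1.trans (tsum_eq_sum fun n hn => ?_).symm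
      refine opL_phiL_eq_zero H (isSymbol_triOne m) n (fun ξ hξ => ?_) x
      have h2 := support_tri_subset (m : ℝ) (fun _ => (1 : X →L[ℂ] X)) hξ
      rw [Finset.mem_Icc, not_and_or, not_le, not_le] at hn
      rcases hn with hn | hn
      · have h3 : n + 2 ≤ m := by omega
        have h4 : (n : ℝ) + 2 ≤ m := by exact_mod_cast h3
        rw [abs_of_nonneg] <;> linarith [h2.1]
      · have h3 : m + 2 ≤ n := by omega
        have h4 : (m : ℝ) + 2 ≤ n := by exact_mod_cast h3
        rw [abs_of_nonpos] <;> linarith [h2.2]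
    · have h2 := support_tri_subset (m : ℝ) (fun _ => (1 : X →L[ℂ] X)) hξ
      push_cast
      constructor <;> linarith [h2.1, h2.2]
  rw [sub_eq_zero] at this
  nth_rewrite 2 [this]
  exact hs.hasSum

variable {S S' S'' : ℝ → X →L[ℂ] X} {M₀ M₁ M₂ : ℝ}

theorem SmoothSymbol.norm_opL_tri_le (h : SmoothSymbol S S' S'' M₀ M₁ M₂) {C : ℝ}
    (hC : ∀ a, ∫ t, ‖kernel (tri a S) t‖ ≤ C) (a : ℝ) (x : F) :
    ‖(h.isSymbol_tri a).opL H x‖ ≤ 3 * C * ‖phiL H a x‖ := by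
  rw [h.opL_tri_eq_sum]
  refine (norm_sum_le _ _).trans ?_
  have hle : ∀ k ∈ Finset.Icc (-1 : ℤ) 1,
      ‖(h.isSymbol_tri (a + k)).opL H (phiL H a x)‖ ≤ C * ‖phiL H a x‖ := fun k _ =>
    (norm_opConv_le H (h.isSymbol_tri (a + k)).integrable_kernel _).trans
      (mul_le_mul_of_nonneg_right (hC _) (norm_nonneg _))
  refine (Finset.sum_le_card_nsmul _ _ _ hle).trans (le_of_eq ?_)
  rw [show (Finset.Icc (-1 : ℤ) 1).card = 3 from rfl, nsmul_eq_mul]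
  push_cast
  ring

/-- Summing the localized multipliers `tri n S`. -/
theorem SmoothSymbol.exists_hasSum [CompleteSpace F] (h : SmoothSymbol S S' S'' M₀ M₁ M₂) {C : ℝ}
    (hC : ∀ a, ∫ t, ‖kernel (tri a S) t‖ ≤ C) {y : F} (hy : asIntegralNorm H y < ∞) :
    ∃ x : F, HasSum (fun n : ℤ => (h.isSymbol_tri n).opL H y) x ∧
      ∀ a, ‖phiL H a x‖ ≤ 3 * C * ‖phiL H a y‖ := by
  have hs : Summable fun n : ℤ => (h.isSymbol_tri n).opL H y :=
    .of_norm_bounded ((summable_norm_phiL H hy).mul_left (3 * C))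
      fun n => h.norm_opL_tri_le H hC n y
  refine ⟨_, hs.hasSum, fun a => ?_⟩
  -- Exchanging cutoffs in each term identifies `φ_a * x` with the multiplier `tri a S` applied to
  -- `∑ φ_n * y = y`.
  have h1 : HasSum (fun n : ℤ => phiL H a ((h.isSymbol_tri n).opL H y))
      (phiL H a (∑' n : ℤ, (h.isSymbol_tri n).opL H y)) := (phiL H a).hasSum hs.hasSum
  have h2 : HasSum (fun n : ℤ => (h.isSymbol_tri a).opL H (phiL H n y))
      ((h.isSymbol_tri a).opL H y) := ((h.isSymbol_tri a).opL H).hasSum (hasSum_phiL H hy)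
  simp only [h.phiL_opL] at h1
  rw [h1.unique h2]
  exact h.norm_opL_tri_le H hC a y

end Summable

/-! ### Mild solutions -/

/-- The primitive is continuous, so it vanishes everywhere; Lebesgue differentiation recovers `f`.
-/
theorem ae_eq_zero_of_ae_intervalIntegral_eq_zero {E : Type*} [NormedAddCommGroup E]
    [NormedSpace ℝ E] [CompleteSpace E] {f : ℝ → E}
    (hf : LocallyIntegrable f volume) (c : ℝ) (h : ∀ᵐ t, ∫ s in c..t, f s = 0) : ∀ᵐ t, f t = 0 := by
  have hc : Continuous fun t => ∫ s in c..t, f s :=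
    intervalIntegral.continuous_primitive (fun a b =>
      intervalIntegrable_iff.2 ((hf.integrableOn_isCompact isCompact_uIcc).mono_set
        Set.uIoc_subset_uIcc)) c
  have h0 : (fun t => ∫ s in c..t, f s) = fun _ => (0 : E) :=
    (hc.ae_eq_iff_eq volume continuous_const).1 h
  filter_upwards [_root_.LocallyIntegrable.ae_hasDerivAt_integral hf] with t ht
  have h1 := ht c
  rw [h0] at h1
  exact h1.unique (hasDerivAt_const t 0)

section Mild

variable {X : Type*} [NormedAddCommGroup X] [NormedSpace ℂ X] [CompleteSpace X]
variable {F : Type*} [NormedAddCommGroup F] [NormedSpace ℂ F] (H : HomogeneousSpace X F)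
variable (T : C0Semigroup X)

/-- On a bounded interval local boundedness is quadratic decay. This presents the Duhamel integral
as a convolution, hence as a bounded operator from `F` to `X`. -/
theorem exists_quadDecay_indicator (h : ℝ) :
    ∃ c, QuadDecay ((Set.Ioc 0 h).indicator fun σ : ℝ => T.toFun σ.toNNReal) c := by
  obtain ⟨C, hC0, hC⟩ := T.exists_norm_le h.toNNReal
  refine ⟨C * (1 + h ^ 2), fun f hf => ?_, fun s => ?_⟩
  · have : (fun s => (Set.Ioc 0 h).indicator (fun σ : ℝ => T.toFun σ.toNNReal) s (f s)) =
        (Set.Ioc 0 h).indicator fun s => T.toFun s.toNNReal (f s) := by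
      funext s
      by_cases hs : s ∈ Set.Ioc 0 h <;> simp [hs]
    rw [this]
    exact (T.continuous_uncurry.comp_aestronglyMeasurable
      (aestronglyMeasurable_id.prodMk hf)).indicator measurableSet_Ioc
  · by_cases hs : s ∈ Set.Ioc 0 h
    · rw [Set.indicator_of_mem hs]
      refine (hC _ (Real.toNNReal_le_toNNReal hs.2)).trans ?_
      rw [mul_assoc]
      refine le_mul_of_one_le_right hC0 ?_
      unfold wt
      rw [← div_eq_mul_inv, le_div_iff₀ (by positivity)]
      nlinarith [hs.1, hs.2]
    · rw [Set.indicator_of_notMem hs, norm_zero]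
      exact mul_nonneg (by positivity) (wt_pos s).le

/-- The bounded operator `y ↦ ∫_s^t T(t - τ) y(τ) dτ` from `F` to `X`. -/
def duhamel (s t : ℝ) : F →L[ℂ] X :=
  evalConv H (Classical.choose_spec (exists_quadDecay_indicator T (t - s))) t

theorem duhamel_apply' {s t : ℝ} (hst : s ≤ t) (y : F) :
    duhamel H T s t y = ∫ σ in (0 : ℝ)..(t - s), T.toFun σ.toNNReal (H.toAE y (t - σ)) := by
  rw [duhamel, evalConv_apply, intervalIntegral.integral_of_le (sub_nonneg.2 hst),
    ← integral_indicator measurableSet_Ioc]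
  congr 1
  funext σ
  by_cases hσ : σ ∈ Set.Ioc 0 (t - s) <;> simp only [hσ, Set.indicator_of_mem,
    Set.indicator_of_notMem, not_false_eq_true, zero_apply]

theorem duhamel_apply {s t : ℝ} (hst : s ≤ t) (y : F) :
    duhamel H T s t y = ∫ τ in s..t, T.toFun (t - τ).toNNReal (H.toAE y τ) := by
  rw [duhamel_apply' H T hst]
  have := intervalIntegral.integral_comp_sub_left (a := s) (b := t)
    (fun σ : ℝ => T.toFun σ.toNNReal (H.toAE y (t - σ))) t
  simp only [sub_sub_cancel, sub_self] at this
  exact this.symm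

/-- `u` is a representative of `x` satisfying the variation of constants formula with
inhomogeneity `-y`. -/
structure IsMild (u : ℝ → X) (x y : F) : Prop where
  ae_eq : u =ᵐ[volume] H.toAE x
  eq : ∀ s t : ℝ, s ≤ t → u t = T.toFun (t - s).toNNReal (u s) - duhamel H T s t y

variable {H T}

theorem isParabolic_iff {x y : absolutelySummable H} :
    IsParabolic H T x y ↔ ∃ u, IsMild H T u (x : F) (y : F) := by
  constructor
  · rintro ⟨u, h1, h2⟩
    exact ⟨u, h1, fun s t hst => by rw [duhamel_apply H T hst]; exact h2 s t hst⟩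
  · rintro ⟨u, h1, h2⟩
    exact ⟨u, h1, fun s t hst => by rw [← duhamel_apply H T hst]; exact h2 s t hst⟩

theorem IsMild.zero : IsMild H T (fun _ => 0) (0 : F) 0 := by
  refine ⟨?_, fun s t _ => by simp⟩
  rw [_root_.map_zero]
  exact (AEEqFun.coeFn_zero (α := ℝ) (β := X) (μ := volume)).symm

theorem IsMild.add {u u' : ℝ → X} {x x' y y' : F} (h : IsMild H T u x y)
    (h' : IsMild H T u' x' y') : IsMild H T (fun t => u t + u' t) (x + x') (y + y') := by
  refine ⟨?_, fun s t hst => ?_⟩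
  · filter_upwards [h.ae_eq, h'.ae_eq, H.toAE_add_ae x x'] with t h1 h2 h3
    rw [h1, h2, h3]
  · rw [_root_.map_add, _root_.map_add, h.eq s t hst, h'.eq s t hst]
    abel

theorem IsMild.smul {u : ℝ → X} {x y : F} (c : ℂ) (h : IsMild H T u x y) :
    IsMild H T (fun t => c • u t) (c • x) (c • y) := by
  refine ⟨?_, fun s t hst => ?_⟩
  · filter_upwards [h.ae_eq, H.toAE_smul_ae c x] with t h1 h3
    rw [h1, h3]
  · rw [map_smul, map_smul, h.eq s t hst, smul_sub]

theorem IsMild.sum {ι : Type*} (A : Finset ι) {u : ι → ℝ → X} {x y : ι → F}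
    (h : ∀ i ∈ A, IsMild H T (u i) (x i) (y i)) :
    IsMild H T (fun t => ∑ i ∈ A, u i t) (∑ i ∈ A, x i) (∑ i ∈ A, y i) := by
  classical
  induction A using Finset.induction_on with
  | empty => simpa using IsMild.zero (H := H) (T := T)
  | insert i A hi ih =>
    simp only [Finset.sum_insert hi]
    exact (h i (Finset.mem_insert_self i A)).add
      (ih fun j hj => h j (Finset.mem_insert_of_mem hj))

/-- Uniformly summable series of mild solutions. -/
theorem IsMild.tsum {u : ℤ → ℝ → X} {x y : ℤ → F} {b : ℤ → ℝ} {x₀ y₀ : F}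
    (h : ∀ n, IsMild H T (u n) (x n) (y n)) (hb : Summable b) (hub : ∀ n t, ‖u n t‖ ≤ b n)
    (hx : HasSum x x₀) (hy : HasSum y y₀) : IsMild H T (fun t => ∑' n, u n t) x₀ y₀ := by
  have hu : ∀ t, HasSum (fun n => u n t) (∑' n, u n t) := fun t =>
    (Summable.of_norm_bounded hb fun n => hub n t).hasSum
  refine ⟨?_, fun s t hst => ?_⟩
  · have hmeas : AEStronglyMeasurable (fun t => ∑' n, u n t) volume := by
      refine aestronglyMeasurable_of_tendsto_ae (atTop : Filter (Finset ℤ))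
        (f := fun A t => ∑ n ∈ A, u n t) (fun A => ?_) (Eventually.of_forall hu)
      exact (H.aestronglyMeasurable _).congr (IsMild.sum A fun n _ => h n).ae_eq.symm
    have htail : ∀ (A : Finset ℤ) t, ‖∑' n, u n t - ∑ n ∈ A, u n t‖ ≤ ∑' n, b n - ∑ n ∈ A, b n := by
      intro A t
      have h1 := (hu t).summable.sum_add_tsum_compl (s := A)
      have h2 := hb.sum_add_tsum_compl (s := A)
      rw [← h1, ← h2, add_sub_cancel_left, add_sub_cancel_left]
      exact tsum_of_norm_bounded (hb.subtype _).hasSum fun n => hub n t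
    -- Partial sums converge uniformly to the pointwise sum, and in weighted `L¹` to the sum in `F`;
    -- comparing the two identifies the limits almost everywhere.
    have hle : ∀ A : Finset ℤ,
        ∫⁻ s, ENNReal.ofReal (wt s) * ‖∑' n, u n (0 - s) - H.toAE x₀ (0 - s)‖ₑ ≤
        ENNReal.ofReal Real.pi * ENNReal.ofReal (∑' n, b n - ∑ n ∈ A, b n) +
          ENNReal.ofReal (H.const * ‖∑ n ∈ A, x n - x₀‖) := by
      intro A
      have hmw : Measurable fun s : ℝ => ENNReal.ofReal (wt s) :=
        continuous_wt.measurable.ennreal_ofReal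
      have hsub : ∀ᵐ r : ℝ, H.toAE (∑ n ∈ A, x n - x₀) r = ∑ n ∈ A, u n r - H.toAE x₀ r := by
        have h1 := AEEqFun.coeFn_sub (H.toAE (∑ n ∈ A, x n)) (H.toAE x₀)
        rw [← _root_.map_sub] at h1
        filter_upwards [h1, (IsMild.sum A fun n _ => h n).ae_eq] with r h2 h3
        rw [h2, Pi.sub_apply, h3]
      calc ∫⁻ s, ENNReal.ofReal (wt s) * ‖∑' n, u n (0 - s) - H.toAE x₀ (0 - s)‖ₑ
          ≤ ∫⁻ s, (ENNReal.ofReal (wt s) * ENNReal.ofReal (∑' n, b n - ∑ n ∈ A, b n) +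
            ENNReal.ofReal (wt s) * ‖H.toAE (∑ n ∈ A, x n - x₀) (0 - s)‖ₑ) := by
            refine lintegral_mono_ae ?_
            filter_upwards [ae_comp_sub hsub 0] with s hs
            rw [hs, ← mul_add]
            gcongr
            rw [← sub_add_sub_cancel _ (∑ n ∈ A, u n (0 - s)) _]
            refine (enorm_add_le _ _).trans (add_le_add_left ?_ _)
            rw [← ofReal_norm]
            exact ENNReal.ofReal_le_ofReal (htail A _)
        _ = (∫⁻ s, ENNReal.ofReal (wt s)) * ENNReal.ofReal (∑' n, b n - ∑ n ∈ A, b n) +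
            ∫⁻ s, ENNReal.ofReal (wt s) * ‖H.toAE (∑ n ∈ A, x n - x₀) (0 - s)‖ₑ := by
            rw [lintegral_add_left (hmw.mul_const _), lintegral_mul_const _ hmw]
        _ ≤ _ := by
            refine add_le_add (le_of_eq ?_) (H.lintegral_wt_le _ 0)
            rw [← ofReal_integral_eq_lintegral_ofReal integrable_wt
              (Eventually.of_forall fun s => (wt_pos s).le)]
            congr 2
            exact integral_univ_inv_one_add_sq
    have hlim : Tendsto (fun A : Finset ℤ =>
        ENNReal.ofReal Real.pi * ENNReal.ofReal (∑' n, b n - ∑ n ∈ A, b n) +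
          ENNReal.ofReal (H.const * ‖∑ n ∈ A, x n - x₀‖)) atTop (𝓝 0) := by
      have h1 : Tendsto (fun A : Finset ℤ => ENNReal.ofReal (∑' n, b n - ∑ n ∈ A, b n)) atTop
          (𝓝 0) := by
        have := ENNReal.tendsto_ofReal (Tendsto.sub (tendsto_const_nhds (x := ∑' n, b n)) hb.hasSum)
        simpa using this
      have h2 : Tendsto (fun A : Finset ℤ => ENNReal.ofReal (H.const * ‖∑ n ∈ A, x n - x₀‖)) atTop
          (𝓝 0) := by
        have := ENNReal.tendsto_ofReal
          ((tendsto_iff_norm_sub_tendsto_zero.1 hx).const_mul H.const)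
        simpa using this
      have := (ENNReal.Tendsto.const_mul h1 (Or.inr ENNReal.ofReal_ne_top)
        (a := ENNReal.ofReal Real.pi)).add h2
      simpa using this
    have h0 : ∫⁻ s, ENNReal.ofReal (wt s) * ‖∑' n, u n (0 - s) - H.toAE x₀ (0 - s)‖ₑ = 0 :=
      le_antisymm (ge_of_tendsto' hlim hle) zero_le
    have hm2 : AEMeasurable
        (fun s => ENNReal.ofReal (wt s) * ‖∑' n, u n (0 - s) - H.toAE x₀ (0 - s)‖ₑ) volume := by
      refine continuous_wt.measurable.ennreal_ofReal.aemeasurable.mul ?_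
      exact ((aestronglyMeasurable_comp_sub hmeas 0).sub
        (aestronglyMeasurable_comp_sub (H.aestronglyMeasurable x₀) 0)).enorm
    rw [lintegral_eq_zero_iff' hm2] at h0
    have h3 : ∀ᵐ s : ℝ, ∑' n, u n (0 - s) = H.toAE x₀ (0 - s) := by
      filter_upwards [h0] with s hs
      simpa [(wt_pos s).not_ge, sub_eq_zero] using hs
    have h4 := ae_comp_sub h3 0
    simp only [sub_sub_cancel] at h4
    exact h4
  · have h1 := ((T.toFun (t - s).toNNReal).hasSum (hu s)).sub ((duhamel H T s t).hasSum hy)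
    have h2 : (fun n => T.toFun (t - s).toNNReal (u n s) - duhamel H T s t (y n)) =
        fun n => u n t := funext fun n => ((h n).eq s t hst).symm
    rw [h2] at h1
    exact (hu t).unique h1

/-- The inhomogeneity of a mild solution is determined by the solution. -/
theorem IsMild.eq_zero {u : ℝ → X} {z : F} (h : IsMild H T u 0 z) : z = 0 := by
  have hu : ∀ᵐ t, u t = 0 := by
    have h0 := h.ae_eq
    rw [_root_.map_zero] at h0
    exact h0.trans (AEEqFun.coeFn_zero (α := ℝ) (β := X) (μ := volume))
  have hJ : ∀ s t, s ≤ t → u s = 0 → u t = 0 → duhamel H T s t z = 0 := by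
    intro s t hst hs ht
    have := h.eq s t hst
    rw [hs, ht, _root_.map_zero, zero_sub, eq_comm, neg_eq_zero] at this
    exact this
  -- For fixed `t` the Duhamel integral vanishes for almost every initial time, hence so does its
  -- integrand; the exceptional set depends on `t`.
  have key : ∀ t, u t = 0 → ∀ᵐ τ : ℝ, τ < t → T.toFun (t - τ).toNNReal (H.toAE z τ) = 0 := by
    intro t ht
    set g : ℝ → X := (Set.Ioi (0 : ℝ)).indicator fun σ => T.toFun σ.toNNReal (H.toAE z (t - σ))
      with hg
    have hloc : LocallyIntegrable g volume := by
      rw [locallyIntegrable_iff]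
      intro K hK
      obtain ⟨b, hb⟩ := hK.bddAbove
      obtain ⟨c, hc⟩ := exists_quadDecay_indicator T b
      refine (hc.integrable (H := H) z t).integrableOn.congr_fun_ae ?_
      refine (ae_restrict_iff' hK.measurableSet).2 (Eventually.of_forall fun σ hσ => ?_)
      dsimp only
      by_cases h0 : 0 < σ
      · rw [Set.indicator_of_mem (show σ ∈ Set.Ioc 0 b from ⟨h0, hb hσ⟩), hg,
          Set.indicator_of_mem (show σ ∈ Set.Ioi (0 : ℝ) from h0)]
      · rw [Set.indicator_of_notMem (show σ ∉ Set.Ioc 0 b from fun hm => h0 hm.1), hg,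
          Set.indicator_of_notMem (show σ ∉ Set.Ioi (0 : ℝ) from h0), zero_apply]
    have hint : ∀ᵐ r : ℝ, ∫ σ in (0 : ℝ)..r, g σ = 0 := by
      filter_upwards [ae_comp_sub hu t] with r hr
      rcases le_or_gt 0 r with h0 | h0
      · have h1 := hJ (t - r) t (by linarith) hr ht
        rw [duhamel_apply' H T (by linarith), sub_sub_cancel] at h1
        rw [← h1]
        refine intervalIntegral.integral_congr_ae (Eventually.of_forall fun σ hσ => ?_)
        rw [Set.uIoc_of_le h0] at hσ
        rw [hg, Set.indicator_of_mem (show σ ∈ Set.Ioi (0 : ℝ) from hσ.1)]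
      · rw [intervalIntegral.integral_congr_ae (g := fun _ => (0 : X))
          (Eventually.of_forall fun σ hσ => ?_), intervalIntegral.integral_zero]
        rw [Set.uIoc_of_ge h0.le] at hσ
        rw [hg, Set.indicator_of_notMem (show σ ∉ Set.Ioi (0 : ℝ) from hσ.2.not_gt)]
    filter_upwards [ae_comp_sub (ae_eq_zero_of_ae_intervalIntegral_eq_zero hloc 0 hint) t]
      with τ hτ hlt
    rwa [hg, Set.indicator_of_mem (show t - τ ∈ Set.Ioi (0 : ℝ) from sub_pos.2 hlt),
      sub_sub_cancel] at hτ
  -- A countable dense set of times `t` gives one common null set; off it, letting `t` decrease to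
  -- `τ` turns `T(t - τ) z(τ) = 0` into `z(τ) = 0`.
  have hdense : Dense {t | u t = 0} := Measure.dense_of_ae hu
  obtain ⟨D, hDu, hDc, hD⟩ := hdense.exists_countable_dense_subset
  have hall : ∀ᵐ τ : ℝ, ∀ t ∈ D, τ < t → T.toFun (t - τ).toNNReal (H.toAE z τ) = 0 :=
    (ae_ball_iff hDc).2 fun t ht => key t (hDu ht)
  apply HomogeneousSpace.ext (H := H)
  rw [_root_.map_zero]
  refine EventuallyEq.trans ?_ (AEEqFun.coeFn_zero (α := ℝ) (β := X) (μ := volume)).symm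
  filter_upwards [hall] with τ hτ
  have hcont : Continuous fun t : ℝ => T.toFun (t - τ).toNNReal (H.toAE z τ) :=
    (T.continuous_orbit _).comp (continuous_real_toNNReal.comp (continuous_id.sub continuous_const))
  have hcl : IsClosed {t : ℝ | T.toFun (t - τ).toNNReal (H.toAE z τ) = 0} :=
    isClosed_eq hcont continuous_const
  have hsub : closure (Set.Ioi τ ∩ D) ⊆ {t : ℝ | T.toFun (t - τ).toNNReal (H.toAE z τ) = 0} :=
    closure_minimal (fun t ht => hτ t ht.2 ht.1) hcl
  have hmem : τ ∈ closure (Set.Ioi τ ∩ D) := by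
    have h1 := closure_minimal (hD.open_subset_closure_inter (isOpen_Ioi (a := τ))) isClosed_closure
    rw [closure_Ioi] at h1
    exact h1 Set.self_mem_Ici
  have := hsub hmem
  simpa [T.map_zero] using this

end Mild

/-! ### Localized solutions -/

theorem continuous_phi (a : ℝ) : Continuous (phi a) := by
  have h : phi a = fun t : ℝ => Complex.exp (Complex.I * a * t) *
      kernel (tri 0 fun _ => (1 : ℂ)) t := by
    funext t
    rw [phi_eq_mul, kernel_tri_one]
  rw [h]
  have := continuous_kernel (integrable_tri (E := ℂ) 0 (S := fun _ => 1) continuous_const)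
  fun_prop

section Local

variable {X : Type*} [NormedAddCommGroup X] [NormedSpace ℂ X]

theorem kernel_apply {f : ℝ → X →L[ℂ] X} (hf : Integrable f) (t : ℝ) (v : X) :
    kernel f t v = (2 * Real.pi : ℂ)⁻¹ • ∫ ξ : ℝ, Complex.exp (Complex.I * ξ * t) • f ξ v := by
  rw [kernel, smul_apply, ContinuousLinearMap.integral_apply (integrable_cexp_smul hf t)]
  rfl

theorem integrable_cexp_smul_apply {f : ℝ → X →L[ℂ] X} (hf : Integrable f) (t : ℝ) (v : X) :
    Integrable fun ξ : ℝ => Complex.exp (Complex.I * ξ * t) • f ξ v :=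
  (ContinuousLinearMap.apply ℂ X v).integrable_comp (integrable_cexp_smul hf t)

variable [CompleteSpace X]
variable {F : Type*} [NormedAddCommGroup F] [NormedSpace ℂ F] (H : HomogeneousSpace X F)
variable {T : C0Semigroup X} {R R' R'' : ℝ → X →L[ℂ] X} {M₀ M₁ M₂ : ℝ}

theorem kernel_tri_commute (hres : ∀ ξ : ℝ, IsResolventAt T.generator (Complex.I * ξ) (R ξ))
    (hR : Continuous R) (a r : ℝ) (h : ℝ≥0) (v : X) :
    kernel (tri a R) r (T.toFun h v) = T.toFun h (kernel (tri a R) r v) := by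
  have hi := integrable_tri a hR
  rw [kernel_apply hi, kernel_apply hi, map_smul,
    ← ContinuousLinearMap.integral_comp_comm _ (integrable_cexp_smul_apply hi r v)]
  congr 2
  funext ξ
  simp only [tri, smul_apply, map_smul, (hres ξ).commute]

/-- Variation of constants for the kernels `kernel (tri a R)`. -/
theorem kernel_tri_add (hres : ∀ ξ : ℝ, IsResolventAt T.generator (Complex.I * ξ) (R ξ))
    (hR : Continuous R) (a r : ℝ) {h : ℝ} (hh : 0 ≤ h) (v : X) :
    kernel (tri a R) (r + h) v = T.toFun h.toNNReal (kernel (tri a R) r v) -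
      ∫ σ in (0 : ℝ)..h, phi a (r + σ) • T.toFun (h - σ).toNNReal v := by
  have hi := integrable_tri a hR
  have hcT : Continuous fun σ : ℝ => T.toFun (h - σ).toNNReal v :=
    (T.continuous_orbit v).comp (continuous_real_toNNReal.comp (by fun_prop))
  have htc : Continuous fun ξ : ℝ => (triangle (ξ - a) : ℂ) :=
    Complex.continuous_ofReal.comp (continuous_triangle.comp (by fun_prop))
  have hti : Integrable fun ξ : ℝ => (triangle (ξ - a) : ℂ) := by
    have := integrable_tri (E := ℂ) a (S := fun _ => 1) continuous_const
    exact this.congr (Eventually.of_forall fun ξ => by simp [tri])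
  have hint : Integrable (Function.uncurry fun σ ξ : ℝ =>
      ((triangle (ξ - a) : ℂ) * Complex.exp (Complex.I * ξ * (r + σ : ℝ))) •
        T.toFun (h - σ).toNNReal v) ((volume.restrict (Set.uIoc 0 h)).prod volume) := by
    have h1 : IntegrableOn (fun σ : ℝ => ‖T.toFun (h - σ).toNNReal v‖) (Set.uIoc 0 h) volume :=
      intervalIntegrable_iff.1 (hcT.norm.intervalIntegrable 0 h)
    refine (h1.mul_prod hti.norm).mono' ?_ (Eventually.of_forall fun p => ?_)
    · have : Continuous (Function.uncurry fun σ ξ : ℝ =>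
          ((triangle (ξ - a) : ℂ) * Complex.exp (Complex.I * ξ * (r + σ : ℝ))) •
            T.toFun (h - σ).toNNReal v) := by
        have e1 := htc.comp (continuous_snd (X := ℝ) (Y := ℝ))
        have e2 := hcT.comp (continuous_fst (X := ℝ) (Y := ℝ))
        simp only [Function.comp_def] at e1 e2
        simp only [Function.uncurry_def]
        fun_prop
      exact this.aestronglyMeasurable
    · simp only [Function.uncurry]
      rw [norm_smul, norm_mul, norm_cexp_I_mul_mul, mul_one, mul_comm]
  -- The formula for one exponential, multiplied by `e^{iξr}` and the cutoff; integrating over `ξ`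
  -- turns the scalar factor into `φ_a`.
  have hpoint : ∀ ξ : ℝ, Complex.exp (Complex.I * ξ * (r + h : ℝ)) • tri a R ξ v =
      T.toFun h.toNNReal (Complex.exp (Complex.I * ξ * r) • tri a R ξ v) -
      ∫ σ in (0 : ℝ)..h, ((triangle (ξ - a) : ℂ) * Complex.exp (Complex.I * ξ * (r + σ : ℝ))) •
        T.toFun (h - σ).toNNReal v := by
    intro ξ
    have e := (hres ξ).exp_smul_eq v hh
    have e1 : Complex.exp (Complex.I * ξ * (r + h : ℝ)) • tri a R ξ v =
        (Complex.exp (Complex.I * ξ * r) * (triangle (ξ - a) : ℂ)) •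
          Complex.exp (Complex.I * ξ * h) • R ξ v := by
      simp only [tri, smul_apply, smul_smul]
      congr 1
      push_cast
      rw [mul_add, Complex.exp_add]
      ring
    rw [e1, e, smul_sub, ← intervalIntegral.integral_smul]
    congr 1
    · simp only [tri, smul_apply, map_smul, smul_smul]
    · refine intervalIntegral.integral_congr fun σ _ => ?_
      simp only [smul_smul]
      congr 1
      push_cast
      rw [mul_add, Complex.exp_add]
      ring
  have hdi : Integrable fun ξ : ℝ => ∫ σ in (0 : ℝ)..h,
      ((triangle (ξ - a) : ℂ) * Complex.exp (Complex.I * ξ * (r + σ : ℝ))) •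
        T.toFun (h - σ).toNNReal v := by
    have := hint.integral_prod_right
    simpa only [intervalIntegral.integral_of_le hh, Set.uIoc_of_le hh, Function.uncurry] using this
  rw [kernel_apply hi, kernel_apply hi]
  simp only [hpoint]
  rw [integral_sub ((T.toFun h.toNNReal).integrable_comp (integrable_cexp_smul_apply hi r v)) hdi,
    ContinuousLinearMap.integral_comp_comm _ (integrable_cexp_smul_apply hi r v), smul_sub,
    map_smul, ← intervalIntegral_integral_swap hint, ← intervalIntegral.integral_smul]
  congr 1
  refine intervalIntegral.integral_congr fun σ _ => ?_
  rw [integral_smul_const, smul_smul]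
  rfl

/-- The identity for kernels, applied to `y (t - s)` and integrated over `s`. Fubini is justified by
the bound of `φ_a (s + σ)` by a multiple of `wt s`, uniform for `σ ∈ [0, h]`. -/
theorem evalL_tri_add (hres : ∀ ξ : ℝ, IsResolventAt T.generator (Complex.I * ξ) (R ξ))
    (hR : SmoothSymbol R R' R'' M₀ M₁ M₂) (a t : ℝ) {h : ℝ} (hh : 0 ≤ h) (y : F) :
    (hR.isSymbol_tri a).evalL H (t + h) y =
      T.toFun h.toNNReal ((hR.isSymbol_tri a).evalL H t y) -
      ∫ σ in (0 : ℝ)..h, T.toFun (h - σ).toNNReal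
        ((isSymbol_triOne (X := X) a).evalL H (t + σ) y) := by
  have hy := aestronglyMeasurable_comp_sub (H.aestronglyMeasurable y) t
  obtain ⟨C, hC0, hC⟩ := T.exists_norm_le h.toNNReal
  have hint : Integrable (Function.uncurry fun σ s : ℝ =>
      phi a (s + σ) • T.toFun (h - σ).toNNReal (H.toAE y (t - s)))
      ((volume.restrict (Set.uIoc 0 h)).prod volume) := by
    have h1 : Integrable (fun _ : ℝ => 4 * (1 + h ^ 2) * C) (volume.restrict (Set.uIoc 0 h)) :=
      intervalIntegrable_iff.1 intervalIntegrable_const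
    refine (h1.mul_prod (H.integrable_wt_mul_norm y t)).mono' ?_ ?_
    · have e1 : Continuous fun p : ℝ × ℝ => phi a (p.2 + p.1) :=
        (continuous_phi a).comp (by fun_prop)
      refine e1.aestronglyMeasurable.smul ?_
      refine T.continuous_uncurry.comp_aestronglyMeasurable
        (f := fun p : ℝ × ℝ => (h - p.1, H.toAE y (t - p.2))) ?_
      have e2 : Continuous fun p : ℝ × ℝ => h - p.1 := by fun_prop
      exact e2.aestronglyMeasurable.prodMk hy.comp_snd
    · have hmem : ∀ᵐ p : ℝ × ℝ ∂((volume.restrict (Set.uIoc 0 h)).prod volume),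
          p.1 ∈ Set.uIoc 0 h :=
        Measure.quasiMeasurePreserving_fst.ae (ae_restrict_mem measurableSet_uIoc)
      filter_upwards [hmem] with p hp
      rw [Set.uIoc_of_le hh] at hp
      simp only [Function.uncurry]
      have e1 : ‖phi a (p.2 + p.1)‖ ≤ 4 * (1 + h ^ 2) * wt p.2 := by
        refine (norm_phi_le a _).trans ?_
        have e2 := wt_le_mul_wt_add (p.2 + p.1) (-p.1)
        rw [add_neg_cancel_right] at e2
        have e3 : (2 * (1 + (-p.1) ^ 2)) * wt p.2 ≤ 2 * (1 + h ^ 2) * wt p.2 :=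
          mul_le_mul_of_nonneg_right (by nlinarith [hp.1, hp.2]) (wt_pos _).le
        change 2 * wt (p.2 + p.1) ≤ _
        linarith
      have e2 : ‖T.toFun (h - p.1).toNNReal (H.toAE y (t - p.2))‖ ≤ C * ‖H.toAE y (t - p.2)‖ :=
        ((T.toFun _).le_opNorm _).trans (mul_le_mul_of_nonneg_right
          (hC _ (Real.toNNReal_le_toNNReal (by linarith [hp.1]))) (norm_nonneg _))
      rw [norm_smul]
      refine (mul_le_mul e1 e2 (norm_nonneg _) ((norm_nonneg _).trans e1)).trans (le_of_eq ?_)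
      ring
  have hdi : Integrable fun s : ℝ => ∫ σ in (0 : ℝ)..h,
      phi a (s + σ) • T.toFun (h - σ).toNNReal (H.toAE y (t - s)) := by
    have := hint.integral_prod_right
    simpa only [intervalIntegral.integral_of_le hh, Set.uIoc_of_le hh, Function.uncurry] using this
  have hk := (hR.isSymbol_tri a).quadDecay.integrable (H := H) y t
  calc (hR.isSymbol_tri a).evalL H (t + h) y
      = ∫ s, kernel (tri a R) (s + h) (H.toAE y (t - s)) := by
        rw [IsSymbol.evalL_apply, ← integral_add_right_eq_self _ h]
        congr 1
        funext s
        congr 2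
        ring
    _ = ∫ s, (T.toFun h.toNNReal (kernel (tri a R) s (H.toAE y (t - s))) -
          ∫ σ in (0 : ℝ)..h, phi a (s + σ) • T.toFun (h - σ).toNNReal (H.toAE y (t - s))) := by
        congr 1
        funext s
        exact kernel_tri_add hres hR.continuous a s hh _
    _ = T.toFun h.toNNReal ((hR.isSymbol_tri a).evalL H t y) -
          ∫ σ in (0 : ℝ)..h, ∫ s, phi a (s + σ) • T.toFun (h - σ).toNNReal (H.toAE y (t - s)) := by
        rw [integral_sub ((T.toFun h.toNNReal).integrable_comp hk) hdi,
          ContinuousLinearMap.integral_comp_comm _ hk, intervalIntegral_integral_swap hint]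
        rfl
    _ = _ := by
        congr 1
        refine intervalIntegral.integral_congr fun σ _ => ?_
        have hq := (isSymbol_triOne (X := X) a).quadDecay.integrable (H := H) y (t + σ)
        rw [IsSymbol.evalL_apply, ← ContinuousLinearMap.integral_comp_comm _ hq]
        refine Eq.trans ?_ (integral_add_right_eq_self (fun s => T.toFun (h - σ).toNNReal
          (kernel (triOne X a) s (H.toAE y (t + σ - s)))) σ)
        congr 1
        funext s
        rw [kernel_triOne, smul_apply, one_apply_eq_self, map_smul,
          show t + σ - (s + σ) = t - s by ring]

/-- Localized solutions of the inhomogeneous problem. -/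
theorem isMild_tri (hres : ∀ ξ : ℝ, IsResolventAt T.generator (Complex.I * ξ) (R ξ))
    (hR : SmoothSymbol R R' R'' M₀ M₁ M₂) (a : ℝ) (y : F) :
    IsMild H T (fun t => (hR.isSymbol_tri a).evalL H t y) ((hR.isSymbol_tri a).opL H y)
      (phiL H a y) := by
  refine ⟨((hR.isSymbol_tri a).toAE_opConv H y).symm, fun s t hst => ?_⟩
  have h := evalL_tri_add H hres hR a s (sub_nonneg.2 hst) y
  rw [add_sub_cancel] at h
  rw [h, duhamel_apply H T hst]
  congr 1
  have h2 := intervalIntegral.integral_comp_add_left (a := 0) (b := t - s)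
    (fun τ => T.toFun (t - τ).toNNReal ((isSymbol_triOne (X := X) a).evalL H τ y)) s
  simp only [add_zero, add_sub_cancel, ← sub_sub] at h2
  rw [h2]
  refine intervalIntegral.integral_congr_ae ?_
  filter_upwards [(isSymbol_triOne (X := X) a).toAE_opConv H y] with τ hτ _
  rw [← hτ]
  rfl

/-- Uniqueness of mild solutions. -/
theorem IsMild.eq_zero_of_homogeneous
    (hres : ∀ ξ : ℝ, IsResolventAt T.generator (Complex.I * ξ) (R ξ))
    (hR : SmoothSymbol R R' R'' M₀ M₁ M₂) {u : ℝ → X} {x : F} (hu : IsMild H T u x 0) :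
    x = 0 := by
  refine eq_zero_of_phiL_eq_zero H x fun n => ?_
  have hm := isMild_tri H hres hR n x
  have hrep : ∀ t, (hR.isSymbol_tri n).evalL H t x = ∫ r, kernel (tri n R) r (u (t - r)) := by
    intro t
    rw [IsSymbol.evalL_apply]
    refine integral_congr_ae ?_
    filter_upwards [ae_comp_sub hu.ae_eq t] with r hr
    rw [hr]
  -- It suffices that every Duhamel integral of `φ_n * x` vanishes: the zero function is then mild
  -- with this inhomogeneity.
  refine IsMild.eq_zero (H := H) (T := T) (u := fun _ => 0)
    ⟨IsMild.zero (H := H) (T := T).ae_eq, fun s t hst => ?_⟩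
  have h1 := hm.eq s t hst
  -- The kernel commutes with the semigroup, so smoothing preserves `u t = T(t - s) u(s)`; against
  -- `h1` only the Duhamel term is left.
  have h2 : (hR.isSymbol_tri n).evalL H t x =
      T.toFun (t - s).toNNReal ((hR.isSymbol_tri n).evalL H s x) := by
    have hi : Integrable fun r => kernel (tri n R) r (u (s - r)) := by
      refine ((hR.isSymbol_tri n).quadDecay.integrable (H := H) x s).congr ?_
      filter_upwards [ae_comp_sub hu.ae_eq s] with r hr
      rw [hr]
    rw [hrep, hrep, ← ContinuousLinearMap.integral_comp_comm _ hi]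
    congr 1
    funext r
    have := hu.eq (s - r) (t - r) (by linarith)
    rw [_root_.map_zero, sub_zero, sub_sub_sub_cancel_right] at this
    rw [this, kernel_tri_commute hres hR.continuous]
  rw [h2, eq_comm, sub_eq_self] at h1
  rw [h1, _root_.map_zero, sub_zero]

/-- Existence of mild solutions. -/
theorem exists_isMild [CompleteSpace F]
    (hres : ∀ ξ : ℝ, IsResolventAt T.generator (Complex.I * ξ) (R ξ))
    (hR : SmoothSymbol R R' R'' M₀ M₁ M₂) {C : ℝ} (hC : ∀ a, ∫ t, ‖kernel (tri a R) t‖ ≤ C) {y : F}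
    (hy : asIntegralNorm H y < ∞) :
    ∃ u x, IsMild H T u x y ∧ ∀ a, ‖phiL H a x‖ ≤ 3 * C * ‖phiL H a y‖ := by
  obtain ⟨x, hx, hxC⟩ := hR.exists_hasSum H hC hy
  refine ⟨_, x, IsMild.tsum (b := fun n : ℤ => 3 * (decayConst M₀ M₁ M₂ * H.const) * ‖phiL H n y‖)
    -- The `n`-th solution is written through three cutoffs acting on `φ_n * y`, so that its sup
    -- norm is bounded by a multiple of the summable `‖φ_n * y‖`.
    (u := fun (n : ℤ) t => ∑ k ∈ Finset.Icc (-1 : ℤ) 1,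
      (hR.isSymbol_tri ((n : ℝ) + k)).evalL H t (phiL H n y)) (fun n => ?_)
    ((summable_norm_phiL H hy).mul_left _) (fun n t => ?_) hx (hasSum_phiL H hy), hxC⟩
  · have h1 := IsMild.sum (Finset.Icc (-1 : ℤ) 1) fun k _ =>
      isMild_tri H hres hR ((n : ℝ) + k) (phiL H n y)
    rw [← hR.opL_tri_eq_sum H n y] at h1
    have h2 := smoothSymbol_one.opL_tri_eq_sum H n y
    have h3 : ∑ k ∈ Finset.Icc (-1 : ℤ) 1, phiL H ((n : ℝ) + k) (phiL H n y) = phiL H n y :=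
      h2.symm
    rwa [h3] at h1
  · refine (norm_sum_le _ _).trans ?_
    refine (Finset.sum_le_card_nsmul _ _ (decayConst M₀ M₁ M₂ * H.const * ‖phiL H n y‖)
      fun k _ => ?_).trans (le_of_eq ?_)
    · exact (ContinuousLinearMap.le_opNorm _ _).trans (mul_le_mul_of_nonneg_right
        ((hR.isSymbol_tri _).norm_evalL_le H t) (norm_nonneg _))
    · rw [show (Finset.Icc (-1 : ℤ) 1).card = 3 from rfl, nsmul_eq_mul]
      push_cast
      ring

end Local

/-! ### The resolvent on the imaginary axis -/

section Resolvent

variable {X : Type*} [NormedAddCommGroup X] [NormedSpace ℂ X]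
variable {A : X →ₗ.[ℂ] X} {R : ℝ → X →L[ℂ] X} {M : ℝ}

/-- The resolvent identity is used twice: with the uniform bound it gives Lipschitz continuity, and
then the limit of the difference quotients. -/
theorem hasDerivAt_resolvent (hres : ∀ ξ : ℝ, IsResolventAt A (Complex.I * ξ) (R ξ))
    (hM : ∀ ξ, ‖R ξ‖ ≤ M) (ξ : ℝ) : HasDerivAt R (Complex.I • (R ξ * R ξ)) ξ := by
  have hM0 : 0 ≤ M := (norm_nonneg _).trans (hM 0)
  have hid : ∀ η, R η - R ξ = ((Complex.I * (η - ξ : ℝ)) : ℂ) • (R η * R ξ) := fun η => by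
    rw [(hres η).sub_eq (hres ξ)]
    push_cast
    rw [mul_sub]
  have hc : Tendsto R (𝓝 ξ) (𝓝 (R ξ)) := by
    rw [tendsto_iff_norm_sub_tendsto_zero]
    have h0 : Tendsto (fun η : ℝ => |η - ξ| * (M * M)) (𝓝 ξ) (𝓝 0) := by
      have : Continuous fun η : ℝ => |η - ξ| * (M * M) := by fun_prop
      simpa using this.tendsto ξ
    refine squeeze_zero (fun _ => norm_nonneg _) (fun η => ?_) h0
    rw [hid, norm_smul, norm_mul, Complex.norm_I, one_mul, Complex.norm_real, Real.norm_eq_abs]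
    exact mul_le_mul_of_nonneg_left ((norm_mul_le _ _).trans
      (mul_le_mul (hM _) (hM _) (norm_nonneg _) hM0)) (abs_nonneg _)
  rw [hasDerivAt_iff_tendsto_slope]
  have h1 : Tendsto (fun η => Complex.I • (R η * R ξ)) (𝓝[≠] ξ) (𝓝 (Complex.I • (R ξ * R ξ))) :=
    ((hc.mul_const (R ξ)).const_smul Complex.I).mono_left nhdsWithin_le_nhds
  refine h1.congr' ?_
  filter_upwards [self_mem_nhdsWithin] with η hη
  have hne : ((η - ξ : ℝ) : ℂ) ≠ 0 := by exact_mod_cast sub_ne_zero.2 hη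
  rw [slope, vsub_eq_sub, hid, ← Complex.coe_smul, smul_smul]
  congr 1
  push_cast at hne ⊢
  field_simp

theorem smoothSymbol_resolvent (hres : ∀ ξ : ℝ, IsResolventAt A (Complex.I * ξ) (R ξ))
    (hM : ∀ ξ, ‖R ξ‖ ≤ M) :
    SmoothSymbol R (fun ξ => Complex.I • (R ξ * R ξ)) (fun ξ => (-2 : ℂ) • (R ξ * R ξ * R ξ))
      M (M ^ 2) (2 * M ^ 3) := by
  have hM0 : 0 ≤ M := (norm_nonneg _).trans (hM 0)
  have hd := hasDerivAt_resolvent hres hM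
  have hc : Continuous R := continuous_iff_continuousAt.2 fun ξ => (hd ξ).continuousAt
  have h2 : ∀ ξ, ‖R ξ * R ξ‖ ≤ M ^ 2 := fun ξ => by
    rw [sq]
    exact (norm_mul_le _ _).trans (mul_le_mul (hM _) (hM _) (norm_nonneg _) hM0)
  refine ⟨hd, fun ξ => ?_, by fun_prop, hM, fun ξ => ?_, fun ξ => ?_⟩
  · refine (((hd ξ).mul (hd ξ)).const_smul Complex.I).congr_deriv ?_
    rw [smul_mul_assoc, mul_smul_comm, ← smul_add, smul_smul, Complex.I_mul_I, mul_assoc,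
      ← two_smul ℂ, smul_smul]
    norm_num
  · rw [norm_smul, Complex.norm_I, one_mul]
    exact h2 ξ
  · rw [norm_smul, norm_neg, Complex.norm_ofNat, pow_succ M 2]
    exact mul_le_mul_of_nonneg_left ((norm_mul_le _ _).trans
      (mul_le_mul (h2 ξ) (hM _) (norm_nonneg _) (by positivity))) (by norm_num)

theorem integral_norm_kernel_resolvent_le [CompleteSpace X]
    (hres : ∀ ξ : ℝ, IsResolventAt A (Complex.I * ξ) (R ξ)) (hM : ∀ ξ, ‖R ξ‖ ≤ M) (hM0 : 0 < M)
    (a : ℝ) :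
    ∫ t, ‖kernel (tri a R) t‖ ≤ 6 / Real.pi * M * (4 + 4 * M + 2 * M ^ 2) ^ (1 / 2 : ℝ) := by
  have hS := smoothSymbol_resolvent hres hM
  have hpi := Real.pi_pos
  have hpi4 := Real.pi_le_four
  have h0 : 0 < (2 * Real.pi)⁻¹ * M := by positivity
  have h2 : 0 < (2 * Real.pi)⁻¹ * (4 * M + 4 * M ^ 2 + 2 * (2 * M ^ 3)) := by positivity
  refine (integral_norm_le_sqrt (hS.isSymbol_tri a).continuous_kernel.aestronglyMeasurable h0 h2
    (fun t => norm_kernel_tri_le a t hS.continuous hM)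
    (fun t => sq_mul_norm_kernel_tri_le a t hS.deriv hS.deriv' hS.cont hS.bound hS.bound'
      hS.bound'')).trans ?_
  rw [← Real.sqrt_eq_rpow]
  -- The estimates give `4 + 4M + 4M²` under the root. A factor `(3/2)²` reduces it to `4 + 4M +
  -- 2M²`, and `3/2 ≤ 6/π` because `π ≤ 4`.
  have hle : (2 * Real.pi)⁻¹ * M * ((2 * Real.pi)⁻¹ * (4 * M + 4 * M ^ 2 + 2 * (2 * M ^ 3))) ≤
      ((2 * Real.pi)⁻¹ * (3 / 2) * M) ^ 2 * (4 + 4 * M + 2 * M ^ 2) := by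
    have : (2 * Real.pi)⁻¹ ^ 2 * M ^ 2 * (4 + 4 * M + 4 * M ^ 2) ≤
        (2 * Real.pi)⁻¹ ^ 2 * M ^ 2 * ((3 / 2) ^ 2 * (4 + 4 * M + 2 * M ^ 2)) :=
      mul_le_mul_of_nonneg_left (by nlinarith) (by positivity)
    linarith
  have hsq := Real.sqrt_le_sqrt hle
  rw [Real.sqrt_mul (sq_nonneg ((2 * Real.pi)⁻¹ * (3 / 2) * M)), Real.sqrt_sq (by positivity)] at hsq
  refine (mul_le_mul_of_nonneg_left hsq (by positivity)).trans ?_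
  rw [← mul_assoc, ← mul_assoc, ← mul_assoc]
  refine mul_le_mul_of_nonneg_right ?_ (Real.sqrt_nonneg _)
  refine mul_le_mul_of_nonneg_right ?_ hM0.le
  rw [mul_inv_cancel₀ (by positivity), le_div_iff₀ hpi]
  linarith

end Resolvent

/-! ### Existence with the explicit constant, and the theorem. -/

section Main

variable {X : Type*} [NormedAddCommGroup X] [NormedSpace ℂ X] [CompleteSpace X]
variable {F : Type*} [NormedAddCommGroup F] [NormedSpace ℂ F] [CompleteSpace F]
variable {H : HomogeneousSpace X F} {T : C0Semigroup X} {R : ℝ → X →L[ℂ] X} {M : ℝ}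

theorem exists_isMild_resolvent (H : HomogeneousSpace X F)
    (hres : ∀ ξ : ℝ, IsResolventAt T.generator (Complex.I * ξ) (R ξ)) (hM : ∀ ξ, ‖R ξ‖ ≤ M) {y : F}
    (hy : asIntegralNorm H y < ∞) :
    ∃ u x, IsMild H T u x y ∧ ∀ a, ‖conv H (phi a) x‖ₑ ≤
      ENNReal.ofReal (18 / Real.pi * M * (4 + 4 * M + 2 * M ^ 2) ^ (1 / 2 : ℝ)) *
        ‖conv H (phi a) y‖ₑ := by
  have hM0 : 0 ≤ M := (norm_nonneg _).trans (hM 0)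
  have hpi := Real.pi_pos
  have hS := smoothSymbol_resolvent hres hM
  have hC : ∀ a, ∫ t, ‖kernel (tri a R) t‖ ≤
      6 / Real.pi * M * (4 + 4 * M + 2 * M ^ 2) ^ (1 / 2 : ℝ) := by
    -- The optimized `L¹` bound needs positive constants; for `M = 0` the resolvent and all kernels
    -- vanish.
    rcases hM0.eq_or_lt with h0 | h0
    · intro a
      have hR : ∀ ξ, R ξ = 0 := fun ξ => norm_le_zero_iff.1 (h0 ▸ hM ξ)
      have : kernel (tri a R) = fun _ => 0 := by
        funext t
        simp [kernel, tri, hR]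
      rw [this, ← h0]
      simp
    · exact integral_norm_kernel_resolvent_le hres hM h0
  obtain ⟨u, x, hu, hx⟩ := exists_isMild H hres hS hC hy
  refine ⟨u, x, hu, fun a => ?_⟩
  have h := hx a
  rw [phiL_apply, phiL_apply] at h
  rw [← ofReal_norm, ← ofReal_norm, ← ENNReal.ofReal_mul (by positivity)]
  refine ENNReal.ofReal_le_ofReal (h.trans (le_of_eq ?_))
  ring

end Main

end AbstractParabolic

end

theorem theorem4p1 {X F : Type*} [NormedAddCommGroup X] [NormedSpace ℂ X] [CompleteSpace X]
    [NormedAddCommGroup F] [NormedSpace ℂ F] [CompleteSpace F]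
    (H : AbstractParabolic.HomogeneousSpace X F) (T : AbstractParabolic.C0Semigroup X)
    (hA : AbstractParabolic.unboundedSpectrum T.generator ∩ {z : ℂ | z.re = 0} = ∅)
    (M : ℝ)
    (hM : IsLUB ((fun z : ℂ => ‖AbstractParabolic.resolventOp T.generator z‖) ''
      {z : ℂ | z.re = 0}) M) :
    -- `L` is a well-defined operator in `F_as`
    (∀ x y y' : AbstractParabolic.absolutelySummable H,
      AbstractParabolic.IsParabolic H T x y → AbstractParabolic.IsParabolic H T x y' → y = y') ∧
    -- `L` is injective and surjective
    (∀ x : AbstractParabolic.absolutelySummable H,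
      AbstractParabolic.IsParabolic H T x 0 → x = 0) ∧
    (∀ y : AbstractParabolic.absolutelySummable H, ∃ x : AbstractParabolic.absolutelySummable H,
      AbstractParabolic.IsParabolic H T x y) ∧
    -- the inverse of `L` is a linear operator on `F_as`, bounded in both norms of `F_as`
    ∃ Linv : AbstractParabolic.absolutelySummable H →ₗ[ℂ] AbstractParabolic.absolutelySummable H,
      (∀ x y : AbstractParabolic.absolutelySummable H,
        AbstractParabolic.IsParabolic H T x y ↔ Linv y = x) ∧
      (∀ y : AbstractParabolic.absolutelySummable H, AbstractParabolic.asNorm H (y : F) < ⊤) ∧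
      (∀ y : AbstractParabolic.absolutelySummable H,
        AbstractParabolic.asNorm H (Linv y : F) ≤
          ENNReal.ofReal (18 / Real.pi * M * (4 + 4 * M + 2 * M ^ 2) ^ (1 / 2 : ℝ)) *
            AbstractParabolic.asNorm H (y : F)) ∧
      (∀ y : AbstractParabolic.absolutelySummable H,
        AbstractParabolic.asIntegralNorm H (Linv y : F) ≤
          ENNReal.ofReal (18 / Real.pi * M * (4 + 4 * M + 2 * M ^ 2) ^ (1 / 2 : ℝ)) *
            AbstractParabolic.asIntegralNorm H (y : F)) := by
  open AbstractParabolic in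
  have hre : ∀ ξ : ℝ, (Complex.I * ξ : ℂ) ∈ {z : ℂ | z.re = 0} := fun ξ => by simp
  set R : ℝ → X →L[ℂ] X := fun ξ => resolventOp T.generator (Complex.I * ξ) with hR
  have hres : ∀ ξ : ℝ, IsResolventAt T.generator (Complex.I * ξ) (R ξ) := fun ξ =>
    resolventOp_spec (by
      by_contra hn
      exact Set.eq_empty_iff_forall_notMem.1 hA _ ⟨hn, hre ξ⟩)
  have hRM : ∀ ξ, ‖R ξ‖ ≤ M := fun ξ => hM.1 ⟨_, hre ξ, rfl⟩
  have hinj : ∀ x : absolutelySummable H, IsParabolic H T x 0 → x = 0 := fun x hx => by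
    obtain ⟨u, hu⟩ := isParabolic_iff.1 hx
    exact Subtype.ext
      (IsMild.eq_zero_of_homogeneous H hres (smoothSymbol_resolvent hres hRM) hu)
  have hadd : ∀ {x x' y y' : absolutelySummable H}, IsParabolic H T x y → IsParabolic H T x' y' →
      IsParabolic H T (x + x') (y + y') := fun h h' => by
    obtain ⟨u, hu⟩ := isParabolic_iff.1 h
    obtain ⟨u', hu'⟩ := isParabolic_iff.1 h'
    exact isParabolic_iff.2 ⟨_, hu.add hu'⟩
  have hsmul : ∀ (c : ℂ) {x y : absolutelySummable H}, IsParabolic H T x y →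
      IsParabolic H T (c • x) (c • y) := fun c _ _ h => by
    obtain ⟨u, hu⟩ := isParabolic_iff.1 h
    exact isParabolic_iff.2 ⟨_, hu.smul c⟩
  have hsub : ∀ {x x' y y' : absolutelySummable H}, IsParabolic H T x y → IsParabolic H T x' y' →
      IsParabolic H T (x - x') (y - y') := fun h h' => by
    have := hadd h (hsmul (-1) h')
    rwa [neg_one_smul, neg_one_smul, ← sub_eq_add_neg, ← sub_eq_add_neg] at this
  -- The graph is a linear relation, so injectivity makes solutions unique; uniqueness in turn makes
  -- the chosen solution depend linearly on `y`.
  have huniq : ∀ {x x' y : absolutelySummable H}, IsParabolic H T x y → IsParabolic H T x' y →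
      x = x' := fun h h' => by
    have := hsub h h'
    rw [sub_self] at this
    exact sub_eq_zero.1 (hinj _ this)
  have hex : ∀ y : absolutelySummable H, ∃ x : absolutelySummable H, IsParabolic H T x y ∧
      ∀ a, ‖conv H (phi a) (x : F)‖ₑ ≤
        ENNReal.ofReal (18 / Real.pi * M * (4 + 4 * M + 2 * M ^ 2) ^ (1 / 2 : ℝ)) *
          ‖conv H (phi a) (y : F)‖ₑ := fun y => by
    obtain ⟨u, x, hu, hx⟩ := exists_isMild_resolvent H hres hRM y.2
    -- Integrating the bound over `a` shows that the solution has absolutely summable spectrum.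
    have hxm : asIntegralNorm H x < ⊤ := by
      refine (MeasureTheory.lintegral_mono hx).trans_lt ?_
      rw [MeasureTheory.lintegral_const_mul' _ _ ENNReal.ofReal_ne_top]
      exact ENNReal.mul_lt_top ENNReal.ofReal_lt_top y.2
    exact ⟨⟨x, hxm⟩, isParabolic_iff.2 ⟨u, hu⟩, hx⟩
  choose L hL hLb using hex
  refine ⟨fun x y y' h h' => ?_, hinj, fun y => ⟨L y, hL y⟩,
    { toFun := L
      map_add' := fun y y' => huniq (hL _) (hadd (hL y) (hL y'))
      map_smul' := fun c y => huniq (hL _) (hsmul c (hL y)) },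
    fun x y => ⟨fun h => huniq (hL y) h, fun h => h ▸ hL y⟩, fun y => asNorm_lt_top H y.2,
    fun y => ?_, fun y => ?_⟩
  · have h0 := hsub h h'
    rw [sub_self] at h0
    obtain ⟨u, hu⟩ := isParabolic_iff.1 h0
    exact sub_eq_zero.1 (Subtype.ext (IsMild.eq_zero hu))
  · rw [asNorm, asNorm, mul_left_comm]
    refine mul_le_mul_right ?_ _
    rw [← ENNReal.tsum_mul_left]
    exact ENNReal.tsum_le_tsum fun n => hLb y n
  · rw [asIntegralNorm, asIntegralNorm,
      ← MeasureTheory.lintegral_const_mul' _ _ ENNReal.ofReal_ne_top]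
    exact MeasureTheory.lintegral_mono fun a => hLb y a
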